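/- Let $n\ge 1$ and let $K_n$ be the unipotent group scheme associated to the $\mathbb{Z}$-Lie lattice $$\mathcal{K}_n=\Big\langle x_1,\dots,x_{2n},\,y_{ij}\ (1\le i,j\le n)\ \Big|\ [x_i,x_{n+j}]=y_{ij},\ \sum_{i=1}^n y_{ii}=0\Big\rangle_{\mathbb{Z}},$$ where all brackets of generators that do not follow from the given ones are zero. For a compact discrete valuation ring $\mathfrak{o}$ of characteristic zero, with residue field cardinality $q$, let $$\zeta_{K_n(\mathfrak{o})}(s)=\sum_{m\ge 1}\widetilde r_m(K_n(\mathfrak{o}))\,m^{-s}$$ be the representation zeta function of $K_n(\mathfrak{o})$, where $\widetilde r_m(K_n(\mathfrak{o}))$ is the (finite) number of $m$-dimensional continuous irreducible complex representations of $K_n(\mathfrak{o})$, up to isomorphism and twists by continuous one-dimensional representations. There is a rational function $W\in\mathbb{Q}(X,Y)$ such that $\zeta_{K_n(\mathfrak{o})}(s)=W(q,q^{-s})$, for $\mathrm{Re}(s)$ sufficiently large, for all $\mathfrak{o}$ as above outside finitely many residue characteristics. Writing $q^{-s}=\sum_{k\ge 0}\binom{-s}{k}(q-1)^k$, expand $W(q,q^{-s})$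 as a Laurent series in $q-1$ with coefficients in $\mathbb{Q}(s)$. This series has order $0$; its leading (i.e. constant) coefficient, the "limit $q\to 1$", is independent of the choice of $W$ and is called the topological representation zeta function $\zeta_{K_n,\mathrm{top}}(s)\in\mathbb{Q}(s)$ of $K_n$. It is equal to $$\zeta_{K_n,\mathrm{top}}(s)=\prod_{i=0}^{n-1}\frac{s-i}{s-\left(n+i-\frac{1}{n-i}\right)}.$$ -/

import Mathlib

noncomputable section

/-! ### The Lie lattice and the unipotent group scheme -/

/-- The `R`-module with generators `y i j` (`1 ≤ i, j ≤ n`) and the single relation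
`∑ i, y i i = 0`: matrices modulo scalar multiples of the identity matrix; `y i j` is the class of
the elementary matrix `E i j`. -/
abbrev KCentre (n : ℕ) (R : Type) [CommRing R] : Type :=
  Matrix (Fin n) (Fin n) R ⧸ Submodule.span R {(1 : Matrix (Fin n) (Fin n) R)}

/-- The class `∑ i j, a i * b j • y i j`. -/
def kPair {n : ℕ} {R : Type} [CommRing R] (a b : Fin n → R) : KCentre n R :=
  Submodule.Quotient.mk (Matrix.vecMulVec a b)

/-- The Lie lattice `⟨x₁, …, x₂ₙ, y i j | [x i, x (n+j)] = y i j, ∑ i, y i i = 0⟩` (all other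
brackets of generators being trivial), with coefficients extended to `R`. The triple `(a, b, c)` is
the element `∑ i, a i • x i + ∑ j, b j • x (n+j) + c`. -/
abbrev KLie (n : ℕ) (R : Type) [CommRing R] : Type :=
  (Fin n → R) × (Fin n → R) × KCentre n R

/-- The Lie bracket of the lattice. -/
def kBracket {n : ℕ} {R : Type} [CommRing R] (u v : KLie n R) : KLie n R :=
  (0, 0, kPair u.1 v.2.1 - kPair v.1 u.2.1)

/-- The `R`-points of the unipotent group scheme `K_n` attached to this Lie lattice: the underlying
affine space is that of the lattice, and `(a, b, c)` stands for
`exp (∑ j, b j • x (n+j)) * exp (∑ i, a i • x i) * exp c`. -/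
@[ext]
structure KGroup (n : ℕ) (R : Type) [CommRing R] : Type where
  a : Fin n → R
  b : Fin n → R
  c : KCentre n R

namespace KGroup

variable {n : ℕ} {R : Type} [CommRing R]

theorem kPair_add_left (a a' b : Fin n → R) : kPair (a + a') b = kPair a b + kPair a' b := by
  simp [kPair, Matrix.add_vecMulVec]

theorem kPair_add_right (a b b' : Fin n → R) : kPair a (b + b') = kPair a b + kPair a b' := by
  simp [kPair, Matrix.vecMulVec_add]

theorem kPair_neg_left (a b : Fin n → R) : kPair (-a) b = -kPair a b := by
  simp [kPair, Matrix.neg_vecMulVec]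

theorem kPair_neg_right (a b : Fin n → R) : kPair a (-b) = -kPair a b := by
  simp [kPair, Matrix.vecMulVec_neg]

theorem kPair_zero_left (b : Fin n → R) : kPair 0 b = 0 := by
  simp [kPair]

theorem kPair_zero_right (a : Fin n → R) : kPair a 0 = 0 := by
  simp [kPair]

instance : Mul (KGroup n R) := ⟨fun g h => ⟨g.a + h.a, g.b + h.b, g.c + h.c + kPair g.a h.b⟩⟩
instance : One (KGroup n R) := ⟨⟨0, 0, 0⟩⟩
instance : Inv (KGroup n R) := ⟨fun g => ⟨-g.a, -g.b, -g.c + kPair g.a g.b⟩⟩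

theorem mul_def (g h : KGroup n R) :
    g * h = ⟨g.a + h.a, g.b + h.b, g.c + h.c + kPair g.a h.b⟩ := rfl
theorem one_def : (1 : KGroup n R) = ⟨0, 0, 0⟩ := rfl
theorem inv_def (g : KGroup n R) : g⁻¹ = ⟨-g.a, -g.b, -g.c + kPair g.a g.b⟩ := rfl

instance : Group (KGroup n R) :=
  Group.ofLeftAxioms
    (fun g h k => by
      simp only [mul_def, kPair_add_left, kPair_add_right, KGroup.mk.injEq]
      refine ⟨by abel, by abel, by abel⟩)
    (fun g => by simp [mul_def, one_def, kPair_zero_left])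
    (fun g => by
      simp only [mul_def, one_def, inv_def, kPair_neg_left, KGroup.mk.injEq]
      refine ⟨by abel, by abel, by abel⟩)

/-- The logarithm, where `2` is invertible. -/
def log [Invertible (2 : R)] (g : KGroup n R) : KLie n R :=
  (g.a, g.b, g.c - (⅟2 : R) • kPair g.a g.b)

/-- Where `2` is invertible, the group law is the Hausdorff product of the Lie lattice. -/
theorem log_mul [Invertible (2 : R)] (g h : KGroup n R) :
    log (g * h) = log g + log h + (⅟2 : R) • kBracket (log g) (log h) := by
  have h2 : kPair g.a h.b = (⅟2 : R) • kPair g.a h.b + (⅟2 : R) • kPair g.a h.b := by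
    rw [← add_smul, ← two_mul, mul_invOf_self, one_smul]
  simp only [log, mul_def, kBracket, kPair_add_left, kPair_add_right, smul_add, smul_sub,
    Prod.smul_mk, Prod.mk_add_mk, smul_zero, add_zero, Prod.mk.injEq, true_and]
  nth_rewrite 1 [h2]
  abel

/-- If `R` is a topological ring then `K_n(R)` carries the topology of the free module of
coordinates. -/
instance [TopologicalSpace R] : TopologicalSpace (KGroup n R) :=
  TopologicalSpace.induced (fun g => ((g.a, g.b, g.c) : KLie n R)) inferInstance

end KGroup

/-! ### Representation zeta functions -/

/-- Continuous irreducible complex representations of dimension `m`, on the space `ℂᵐ`. -/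
structure ContIrrep (G : Type) [Group G] [TopologicalSpace G] (m : ℕ) : Type where
  ρ : Representation ℂ G (Fin m → ℂ)
  continuous_apply : ∀ v, Continuous fun g => ρ g v
  irreducible : ρ.IsIrreducible

/-- `σ` is isomorphic to the twist of `ρ` by a continuous one-dimensional representation. -/
def TwistEquiv {G : Type} [Group G] [TopologicalSpace G] {m : ℕ} (ρ σ : ContIrrep G m) : Prop :=
  ∃ χ : G →* ℂˣ, Continuous χ ∧ ∃ T : (Fin m → ℂ) ≃ₗ[ℂ] (Fin m → ℂ),
    ∀ g v, T (((χ g : ℂˣ) : ℂ) • ρ.ρ g v) = σ.ρ g (T v)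

theorem twistEquiv_equivalence (G : Type) [Group G] [TopologicalSpace G] (m : ℕ) :
    Equivalence (TwistEquiv (G := G) (m := m)) where
  refl ρ := ⟨1, continuous_const, LinearEquiv.refl ℂ _, fun g v => by simp⟩
  symm := by
    rintro ρ σ ⟨χ, hχ, T, hT⟩
    refine ⟨χ⁻¹, hχ.inv, T.symm, fun g v => ?_⟩
    have h := hT g (T.symm v)
    rw [LinearEquiv.apply_symm_apply] at h
    rw [← h, ← map_smul, LinearEquiv.symm_apply_apply, smul_smul]
    simp
  trans := by
    rintro ρ σ τ ⟨χ, hχ, T, hT⟩ ⟨ψ, hψ, S, hS⟩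
    refine ⟨χ * ψ, hχ.mul hψ, T.trans S, fun g v => ?_⟩
    simp only [LinearEquiv.trans_apply, ← hS, ← hT, map_smul, MonoidHom.mul_apply, Units.val_mul,
      smul_smul]
    rw [mul_comm]

/-- Twist-isoclasses of continuous irreducible complex representations of dimension `m`. -/
def TwistIsoclass (G : Type) [Group G] [TopologicalSpace G] (m : ℕ) : Type :=
  Quotient (⟨TwistEquiv, twistEquiv_equivalence G m⟩ : Setoid (ContIrrep G m))

/-- The coefficients of the representation zeta function `∑ m, r m * m ^ (-s)` of `G`: the number
of twist-isoclasses of dimension `m`. -/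
def repCount (G : Type) [Group G] [TopologicalSpace G] (m : ℕ) : ℂ :=
  (Nat.card (TwistIsoclass G m) : ℂ)

/-! ### Topological representation zeta functions -/

/-- The rational function `W = f / g` in two variables gives the local representation zeta function
of `K_n` at `𝔬`, i.e. `ζ_{K_n(𝔬)}(s) = W(q, q ^ (-s))` for all `s` of sufficiently large real part,
where `q` is the residue field cardinality of `𝔬`. -/
def IsLocalRepZeta (n : ℕ) (f g : MvPolynomial (Fin 2) ℚ)
    (𝔬 : Type) [CommRing 𝔬] [IsLocalRing 𝔬] [TopologicalSpace 𝔬] : Prop :=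
  (∀ m, Finite (TwistIsoclass (KGroup n 𝔬) m)) ∧
  ∃ α : ℝ, ∀ s : ℂ, α < s.re →
    let q : ℂ := Nat.card (IsLocalRing.ResidueField 𝔬)
    MvPolynomial.aeval ![q, q ^ (-s)] g ≠ 0 ∧
    LSeriesHasSum (repCount (KGroup n 𝔬)) s
      (MvPolynomial.aeval ![q, q ^ (-s)] f / MvPolynomial.aeval ![q, q ^ (-s)] g)

/-- `W = f / g` gives the local representation zeta functions of `K_n` at almost all places: it does
so for all compact discrete valuation rings of characteristic zero (the rings of integers of the
finite extensions of the fields `ℚ_p`), up to finitely many residue characteristics. -/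
def IsGenericLocalRepZeta (n : ℕ) (f g : MvPolynomial (Fin 2) ℚ) : Prop :=
  ∃ S : Finset ℕ, ∀ (𝔬 : Type) [CommRing 𝔬] [IsDomain 𝔬] [IsDiscreteValuationRing 𝔬] [CharZero 𝔬]
    [TopologicalSpace 𝔬] [IsTopologicalRing 𝔬] [CompactSpace 𝔬],
    IsAdic (IsLocalRing.maximalIdeal 𝔬) →
    ringChar (IsLocalRing.ResidueField 𝔬) ∉ S → IsLocalRepZeta n f g 𝔬

/-- For a polynomial `f(q, t)`, the expansion of `f(q, q ^ (-s))` as a power series in `q - 1` with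
coefficients in `ℚ(s)`, where `q ^ (-s) = ∑ k, choose (-s) k * (q - 1) ^ k`. Here the power series
variable stands for `q - 1` and `RatFunc.X` stands for `s`. -/
def polyExpansion (f : MvPolynomial (Fin 2) ℚ) : PowerSeries (RatFunc ℚ) :=
  MvPolynomial.aeval
    ![1 + PowerSeries.X, PowerSeries.binomialSeries (RatFunc ℚ) (-RatFunc.X : RatFunc ℚ)] f

/-- The expansion of `W(q, q ^ (-s))`, for `W = f / g`, as a Laurent series in `q - 1` with
coefficients in `ℚ(s)`. -/
def qExpansion (f g : MvPolynomial (Fin 2) ℚ) : LaurentSeries (RatFunc ℚ) :=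
  (polyExpansion f : LaurentSeries (RatFunc ℚ)) / (polyExpansion g : LaurentSeries (RatFunc ℚ))

/-- `Z ∈ ℚ(s)` is the topological representation zeta function of `K_n`: the "limit `q → 1`" of the
local representation zeta functions `W(q, q ^ (-s))`, that is, the constant and leading coefficient
of their expansion in `q - 1`. -/
def IsTopologicalRepZeta (n : ℕ) (Z : RatFunc ℚ) : Prop :=
  ∃ f g : MvPolynomial (Fin 2) ℚ, g ≠ 0 ∧ IsGenericLocalRepZeta n f g ∧
    (qExpansion f g).order = 0 ∧ (qExpansion f g).leadingCoeff = Z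

end

/-! ### Rank counts, the recursion, and the universal rational function -/

noncomputable section

/-! An irreducible representation of `K_n(𝔬)` has a central character. The centre is generated by
commutators, so twisting does not change this character, and a Stone–von Neumann argument shows that
it determines the twist-isoclass (`twistIsoclassEquiv`); the dimension is the index of the radical
of the induced pairing. Dually, a nontrivial continuous central character is a traceless matrix over
`𝔬/𝔪^(L+1)`, nonzero modulo `𝔪`, for a unique `L`, and the dimension is the size of the image of
that matrix (`exists_character_equiv`). The zeta function is therefore `1` plus the sum of `(image
size)^(-s)` over these matrices.

A matrix over `𝔬/𝔪^(L+1)` whose reduction has rank `r` becomes, by a Schur complement, an invertible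
`r × r` block and a uniformizer times a smaller matrix over `𝔬/𝔪^L` (`IsUniformStep.liftSum_eq`);
the trace is equidistributed on the lifts of a nonzero traceless matrix
(`IsUniformStep.sum_traceless_lift`). Put `x = q`, `y = q^(-s)`, `T m = levelRatio n x y m`. The
generating functions `G m` of the `m × m` matrices of all levels then satisfy `IsLevelSum`, the zeta
function is given by `IsZetaValue`, and all coefficients are matrix counts over the residue field.
Solving yields one rational function with denominator `x * ∏ (1 - T j)`.

Let `h = q - 1` tend to `0`. Then `1 - T m ~ ε m * h` with `ε m = (n - m) s - (n² - 1 - m²)`, and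
among the counts of `m × m` matrices of positive rank only that of rank one has a first-order term,
`m² h`. Hence `γ m = lim h * G m` satisfies `ε m * γ m = 1 + m² γ (m - 1)`. The counts of traceless
matrices contribute signed binomial coefficients, so the limit of the zeta function is the `n`-th
forward difference of `γ` at `0`; the Newton coefficients of `γ` obey a two-term recursion, which
gives the product (`one_add_sum_eq_prod`).

Uniqueness: two admissible rational functions agree at the points `(p, p^(-s))` for almost all
primes `p`, by way of `ℤ_[p]`, hence are equal; expansions in `q - 1` are faithful because the
monomials `q^a * q^(-bs)` are linearly independent (`polyExpansion_injective`). -/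

/-- The number of `m × k` matrices of rank `r` over a field with `x` elements, as a polynomial
in `x`. -/
def rankCount {R : Type*} [CommRing R] (x : R) (m : ℕ) : ℕ → ℕ → R
  | 0, 0 => 1
  | 0, _ + 1 => 0
  | _ + 1, 0 => 1
  | k + 1, r + 1 => x ^ (r + 1) * rankCount x m k (r + 1) + (x ^ m - x ^ r) * rankCount x m k r

/-- The sum of `ψ (tr M)` over the `k × k` matrices `M` of rank `r` over a field with `x` elements,
for a nontrivial additive character `ψ`, as a polynomial in `x`. -/
def rankCharSum {R : Type*} [CommRing R] (x : R) : ℕ → ℕ → R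
  | 0, 0 => 1
  | 0, _ + 1 => 0
  | _ + 1, 0 => 1
  | k + 1, r + 1 => x ^ (r + 1) * rankCharSum x k (r + 1) - x ^ r * rankCharSum x k r

theorem map_rankCount {R S : Type*} [CommRing R] [CommRing S] (f : R →+* S) (x : R) (m k r : ℕ) :
    f (rankCount x m k r) = rankCount (f x) m k r := by
  induction k generalizing r with
  | zero => cases r <;> simp [rankCount]
  | succ k ih => cases r <;> simp [rankCount, ih]

theorem map_rankCharSum {R S : Type*} [CommRing R] [CommRing S] (f : R →+* S) (x : R) (k r : ℕ) :
    f (rankCharSum x k r) = rankCharSum (f x) k r := by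
  induction k generalizing r with
  | zero => cases r <;> simp [rankCharSum]
  | succ k ih => cases r <;> simp [rankCharSum, ih]

theorem rankCount_zero_right {R : Type*} [CommRing R] (x : R) (m k : ℕ) :
    rankCount x m k 0 = 1 := by
  cases k <;> rfl

theorem rankCharSum_zero_right {R : Type*} [CommRing R] (x : R) (k : ℕ) :
    rankCharSum x k 0 = 1 := by
  cases k <;> rfl

/-- The ratio of the geometric progression that arises from an elementary divisor of corank `m`. -/
def levelRatio {R : Type*} [CommRing R] (n : ℕ) (x y : R) (m : ℕ) : R :=
  x ^ (n ^ 2 - 1 - m ^ 2) * y ^ (n - m)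

theorem map_levelRatio {R S : Type*} [CommRing R] [CommRing S] (f : R →+* S) (n : ℕ) (x y : R)
    (m : ℕ) : f (levelRatio n x y m) = levelRatio n (f x) (f y) m := by
  simp [levelRatio]

/-- The recursion satisfied by the generating functions of the matrices of size `m < n`. -/
def IsLevelSum {F : Type*} [CommRing F] (n : ℕ) (x y : F) (G : ℕ → F) : Prop :=
  ∀ m < n, G m * (1 - levelRatio n x y m) = 1 + ∑ r ∈ Finset.range m,
    rankCount x m m (r + 1) * y ^ (r + 1) * levelRatio n x y m * G (m - (r + 1))

/-- `x` times the number of traceless `n × n` matrices of rank `r` over a field with `x`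
elements. -/
def tracelessCount {R : Type*} [CommRing R] (x : R) (n r : ℕ) : R :=
  rankCount x n n r + (x - 1) * rankCharSum x n r

/-- The relation between the zeta function `w` and the generating functions of smaller matrices. -/
def IsZetaValue {F : Type*} [CommRing F] (n : ℕ) (x y : F) (G : ℕ → F) (w : F) : Prop :=
  x * (w - 1) = ∑ r ∈ Finset.range n, tracelessCount x n (r + 1) * y ^ (r + 1) * G (n - (r + 1))

open MvPolynomial in
/-- The denominator of the generic local representation zeta function. -/
def genericDenom (n : ℕ) : MvPolynomial (Fin 2) ℚ :=
  X 0 * ∏ j ∈ Finset.range n, (1 - levelRatio n (X 0) (X 1) j)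

theorem aeval_rankCount {F : Type*} [CommRing F] [Algebra ℚ F] (x y : F) (m k r : ℕ) :
    MvPolynomial.aeval ![x, y] (rankCount (MvPolynomial.X 0 : MvPolynomial (Fin 2) ℚ) m k r) =
      rankCount x m k r := by
  have := map_rankCount (MvPolynomial.aeval (R := ℚ) ![x, y]).toRingHom (MvPolynomial.X 0) m k r
  simpa using this

theorem aeval_tracelessCount {F : Type*} [CommRing F] [Algebra ℚ F] (x y : F) (n r : ℕ) :
    MvPolynomial.aeval ![x, y] (tracelessCount (MvPolynomial.X 0 : MvPolynomial (Fin 2) ℚ) n r) =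
      tracelessCount x n r := by
  have := map_rankCharSum (MvPolynomial.aeval (R := ℚ) ![x, y]).toRingHom (MvPolynomial.X 0) n r
  simp only [AlgHom.toRingHom_eq_coe, RingHom.coe_coe, MvPolynomial.aeval_X] at this
  simp [tracelessCount, aeval_rankCount, this]

theorem aeval_levelRatio {F : Type*} [CommRing F] [Algebra ℚ F] (x y : F) (n m : ℕ) :
    MvPolynomial.aeval ![x, y]
      (levelRatio n (MvPolynomial.X 0 : MvPolynomial (Fin 2) ℚ) (MvPolynomial.X 1) m) =
      levelRatio n x y m := by
  simp [levelRatio]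

theorem aeval_genericDenom {F : Type*} [CommRing F] [Algebra ℚ F] (x y : F) (n : ℕ) :
    MvPolynomial.aeval ![x, y] (genericDenom n) =
      x * ∏ j ∈ Finset.range n, (1 - levelRatio n x y j) := by
  simp [genericDenom, map_prod, aeval_levelRatio]

-- Each step of the recursion introduces one factor `1 - levelRatio n x y m`, so the product up to
-- `m` clears all denominators. The polynomial is chosen before the ring: the same numerator must
-- serve for complex values and for Laurent series.
open MvPolynomial in
theorem exists_levelSum_numerator (n m : ℕ) (hm : m < n) :
    ∃ P : MvPolynomial (Fin 2) ℚ, ∀ (F : Type) [CommRing F] [Algebra ℚ F] (x y : F) (G : ℕ → F),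
      IsLevelSum n x y G →
        G m * ∏ j ∈ Finset.range (m + 1), (1 - levelRatio n x y j) = aeval ![x, y] P := by
  induction m using Nat.strong_induction_on with
  | _ m ih =>
    choose! P hP using fun j (hj : j < m) => ih j hj (hj.trans hm)
    refine ⟨∏ j ∈ Finset.range m, (1 - levelRatio n (X 0) (X 1) j) +
      ∑ r ∈ Finset.range m, rankCount (X 0) m m (r + 1) * X 1 ^ (r + 1) *
        levelRatio n (X 0) (X 1) m * (P (m - (r + 1)) *
          ∏ j ∈ Finset.Ico (m - (r + 1) + 1) m, (1 - levelRatio n (X 0) (X 1) j)),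
      fun F _ _ x y G hG => ?_⟩
    rw [Finset.prod_range_succ, mul_comm (∏ j ∈ _, _), ← mul_assoc, hG m hm, add_mul, one_mul,
      Finset.sum_mul]
    simp only [map_add, map_prod, map_sum, map_sub, map_one, map_mul, map_pow, aeval_levelRatio,
      aeval_rankCount, aeval_X]
    congr 1
    refine Finset.sum_congr rfl fun r hr => ?_
    have hr' : m - (r + 1) < m := by have := Finset.mem_range.1 hr; omega
    rw [← hP _ hr' F x y G hG, ← Finset.prod_range_mul_prod_Ico _ (Nat.succ_le_of_lt hr')]
    simp only [Matrix.cons_val_one, Matrix.cons_val_zero]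
    ring

open MvPolynomial in
theorem exists_genericNumerator (n : ℕ) :
    ∃ f : MvPolynomial (Fin 2) ℚ, ∀ (F : Type) [CommRing F] [Algebra ℚ F] (x y w : F) (G : ℕ → F),
      IsLevelSum n x y G → IsZetaValue n x y G w →
        w * aeval ![x, y] (genericDenom n) = aeval ![x, y] f := by
  choose! P hP using exists_levelSum_numerator n
  refine ⟨genericDenom n + ∑ r ∈ Finset.range n, tracelessCount (X 0) n (r + 1) * X 1 ^ (r + 1) *
    (P (n - (r + 1)) * ∏ j ∈ Finset.Ico (n - (r + 1) + 1) n, (1 - levelRatio n (X 0) (X 1) j)),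
    fun F _ _ x y w G hG hw => ?_⟩
  have : w * aeval ![x, y] (genericDenom n) = aeval ![x, y] (genericDenom n) + x * (w - 1) *
      ∏ j ∈ Finset.range n, (1 - levelRatio n x y j) := by
    rw [aeval_genericDenom]; ring
  rw [this, hw, map_add, Finset.sum_mul]
  simp only [map_prod, map_sum, map_sub, map_one, map_mul, map_pow, aeval_levelRatio,
      aeval_tracelessCount, aeval_X]
  congr 1
  refine Finset.sum_congr rfl fun r hr => ?_
  have hr' : n - (r + 1) < n := by have := Finset.mem_range.1 hr; omega
  rw [← hP _ hr' F x y G hG, ← Finset.prod_range_mul_prod_Ico _ (Nat.succ_le_of_lt hr')]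
  simp only [Matrix.cons_val_one, Matrix.cons_val_zero]
  ring
end

/-! ### Newton interpolation for the limiting recursion -/

noncomputable section

section Newton

variable {K : Type*} [Field K]

/-- The Newton coefficients of the solution of `ε m * g m = 1 + m ^ 2 * g (m - 1)`. -/
def newtonCoeff (s : K) (ε : ℕ → K) : ℕ → K
  | 0 => (ε 0)⁻¹
  | k + 1 => (k + 1) * (s - k) / ε (k + 1) * newtonCoeff s ε k

/-- The difference of the two sums telescopes: its `k`-th term is `a k - a (k + 1)` with `a k =
choose m k * ε k * newtonCoeff s ε k`, where `a 0 = 1` and `a (m + 1) = 0`. The factor `(k + 1) * (s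
- k)` in `newtonCoeff` is what makes this work. -/
theorem eps_mul_sum_choose_newtonCoeff (s c : K) (ε : ℕ → K)
    (hε : ∀ m : ℕ, ε m = m ^ 2 - m * s + c) (m : ℕ) (h0 : ∀ k ≤ m, ε k ≠ 0) :
    ε m * ∑ k ∈ Finset.range (m + 1), (m.choose k : K) * newtonCoeff s ε k =
      1 + m ^ 2 * ∑ k ∈ Finset.range (m + 1), ((m - 1).choose k : K) * newtonCoeff s ε k := by
  have key : ∀ k ∈ Finset.range (m + 1),
      ε m * ((m.choose k : K) * newtonCoeff s ε k) -
        m ^ 2 * (((m - 1).choose k : K) * newtonCoeff s ε k) =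
      -((m.choose (k + 1) : K) * (ε (k + 1) * newtonCoeff s ε (k + 1)) -
        (m.choose k : K) * (ε k * newtonCoeff s ε k)) := by
    intro k hk
    have hk' : k ≤ m := by have := Finset.mem_range.1 hk; omega
    have h1 : (m : K) * (m.choose k - (m - 1).choose k) = k * m.choose k := by
      rcases m with _ | m
      · obtain rfl : k = 0 := by omega
        simp
      rcases k with _ | k
      · simp
      have := Nat.add_one_mul_choose_eq m k
      have h2 : ((m : K) + 1) * m.choose k = (m + 1).choose (k + 1) * (k + 1) := by
        exact_mod_cast congrArg (Nat.cast (R := K)) this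
      simp only [Nat.add_sub_cancel]
      rw [Nat.choose_succ_succ] at h2 ⊢
      push_cast at h2 ⊢
      linear_combination h2
    have h2 : (m.choose (k + 1) : K) * (k + 1) = m.choose k * (m - k) := by
      have := Nat.choose_succ_right_eq m k
      have := congrArg (Nat.cast (R := K)) this
      rw [Nat.cast_mul, Nat.cast_mul, Nat.cast_sub hk'] at this
      exact_mod_cast this
    have h3 : (m.choose (k + 1) : K) * (ε (k + 1) * newtonCoeff s ε (k + 1)) =
        m.choose k * (m - k) * (s - k) * newtonCoeff s ε k := by
      rcases hk'.eq_or_lt with rfl | hlt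
      · simp
      · have := h0 (k + 1) hlt
        rw [newtonCoeff, ← h2]
        field_simp
    rw [h3, hε m, hε k]
    linear_combination (m : K) * newtonCoeff s ε k * h1
  have hsum := Finset.sum_congr rfl key
  rw [Finset.sum_sub_distrib, Finset.sum_neg_distrib, Finset.sum_range_sub
    (fun k => (m.choose k : K) * (ε k * newtonCoeff s ε k)), ← Finset.mul_sum,
    ← Finset.mul_sum] at hsum
  have h00 := h0 0 (Nat.zero_le m)
  simp only [Nat.choose_succ_self, Nat.choose_zero_right, newtonCoeff, Nat.cast_zero,
    Nat.cast_one, mul_inv_cancel₀ h00] at hsum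
  linear_combination hsum

theorem eq_sum_choose_newtonCoeff (s c : K) (ε : ℕ → K)
    (hε : ∀ m : ℕ, ε m = m ^ 2 - m * s + c) (n : ℕ) (h0 : ∀ k ≤ n, ε k ≠ 0) (γ : ℕ → K)
    (hγ : ∀ m ≤ n, γ m * ε m = 1 + m ^ 2 * γ (m - 1)) (m : ℕ) (hm : m ≤ n) :
    γ m = ∑ k ∈ Finset.range (m + 1), (m.choose k : K) * newtonCoeff s ε k := by
  induction m with
  | zero =>
    have := hγ 0 hm
    have h := h0 0 hm
    simp [newtonCoeff] at this ⊢
    exact eq_inv_of_mul_eq_one_left this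
  | succ m ih =>
    have h1 := hγ (m + 1) hm
    have h2 := eps_mul_sum_choose_newtonCoeff s c ε hε (m + 1) fun k hk => h0 k (hk.trans hm)
    have h := h0 _ hm
    rw [Nat.add_sub_cancel] at h1 h2
    rw [Finset.sum_range_succ (fun k => (m.choose k : K) * _), Nat.choose_succ_self] at h2
    rw [ih (by omega)] at h1
    apply mul_right_cancel₀ h
    rw [h1, mul_comm (∑ k ∈ _, _), h2]
    simp

/-- Binomial inversion: comparison with Newton's forward difference formula identifies `d m` with
the `m`-th difference of `γ` at `0`, and the alternating sum is the `n`-th difference. -/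
theorem alternating_sum_eq_newtonCoeff (n : ℕ) (γ d : ℕ → K)
    (h : ∀ m ≤ n, γ m = ∑ k ∈ Finset.range (m + 1), (m.choose k : K) * d k) :
    ∑ r ∈ Finset.range (n + 1), (-1) ^ r * (n.choose r : K) * γ (n - r) = d n := by
  have key : ∀ m ≤ n, (fwdDiff 1)^[m] γ 0 = d m := by
    intro m
    induction m using Nat.strong_induction_on with
    | _ m ih =>
      intro hm
      have h1 := shift_eq_sum_fwdDiff_iter (h := (1 : ℕ)) γ m 0
      have h2 := h m hm
      simp only [smul_eq_mul, mul_one, zero_add, nsmul_eq_mul] at h1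
      rw [Finset.sum_range_succ] at h1 h2
      rw [h2, Finset.sum_congr rfl fun k hk => by
        rw [← ih k (Finset.mem_range.1 hk) (by have := Finset.mem_range.1 hk; omega)]] at h1
      simpa using h1.symm
  rw [← key n le_rfl, fwdDiff_iter_eq_sum_shift, ← Finset.sum_range_reflect]
  refine Finset.sum_congr rfl fun k hk => ?_
  have : k ≤ n := by have := Finset.mem_range.1 hk; omega
  rw [show n + 1 - 1 - k = n - k by omega, Nat.choose_symm this, Nat.sub_sub_self this]
  simp

theorem newtonCoeff_eq_prod (s : K) (ε : ℕ → K) (k : ℕ) :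
    newtonCoeff s ε k = (∏ i ∈ Finset.range k, ((i + 1) * (s - i) / ε i)) * (ε k)⁻¹ := by
  induction k with
  | zero => simp [newtonCoeff]
  | succ k ih =>
    rw [newtonCoeff, ih, Finset.prod_range_succ]
    simp only [div_eq_mul_inv]
    ring

/-- The closed form of the sum that computes the limit `q → 1`. -/
theorem one_add_sum_eq_prod [CharZero K] (s : K) (n : ℕ) (hn : 1 ≤ n)
    (ε : ℕ → K) (hε : ∀ m < n, ε m = (n - m) * s - (n ^ 2 - 1 - m ^ 2))
    (h0 : ∀ m < n, ε m ≠ 0) (γ : ℕ → K)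
    (hγ : ∀ m < n, γ m * ε m = 1 + m ^ 2 * γ (m - 1)) :
    1 + ∑ r ∈ Finset.range n, ((if r = 0 then (n : K) ^ 2 else 0) +
        (-1) ^ (r + 1) * (n.choose (r + 1) : K)) * γ (n - (r + 1)) =
      ∏ i ∈ Finset.range n, ((s - i) / (s - (n + i - 1 / (n - i)))) := by
  -- The quadratic that gives `ε` below `n` takes the value `1` at `n`. So `1 + n ^ 2 * γ (n - 1)`
  -- is the value at `n` prescribed by the recursion, and the separate term `n ^ 2` completes the
  -- alternating sum.
  set ε' : ℕ → K := fun m => m ^ 2 - m * s + (n * s - n ^ 2 + 1) with hε'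
  have hεε : ∀ m < n, ε' m = ε m := fun m hm => by rw [hε m hm, hε']; ring
  have hεn : ε' n = 1 := by rw [hε']; ring
  set γ' : ℕ → K := fun m => if m = n then 1 + n ^ 2 * γ (n - 1) else γ m with hγ'
  have hγγ : ∀ m < n, γ' m = γ m := fun m hm => if_neg hm.ne
  have hγn : γ' n = 1 + n ^ 2 * γ (n - 1) := if_pos rfl
  have h0' : ∀ m ≤ n, ε' m ≠ 0 := by
    intro m hm
    rcases hm.eq_or_lt with rfl | hm
    · rw [hεn]; exact one_ne_zero
    · rw [hεε m hm]; exact h0 m hm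
  have hrec : ∀ m ≤ n, γ' m * ε' m = 1 + m ^ 2 * γ' (m - 1) := by
    intro m hm
    rcases hm.eq_or_lt with rfl | hm
    · rw [hεn, hγn, hγγ _ (by omega), mul_one]
    · rw [hεε m hm, hγγ m hm, hγγ (m - 1) (by omega), hγ m hm]
  have h1 := alternating_sum_eq_newtonCoeff n γ' (newtonCoeff s ε')
    (eq_sum_choose_newtonCoeff s _ ε' (fun m => rfl) n h0' γ' hrec)
  have h2 : 1 + ∑ r ∈ Finset.range n, ((if r = 0 then (n : K) ^ 2 else 0) +
        (-1) ^ (r + 1) * (n.choose (r + 1) : K)) * γ (n - (r + 1)) =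
      ∑ r ∈ Finset.range (n + 1), (-1) ^ r * (n.choose r : K) * γ' (n - r) := by
    rw [Finset.sum_range_succ']
    simp only [add_mul, Finset.sum_add_distrib, ite_mul, zero_mul, Finset.sum_ite_eq',
      Finset.mem_range]
    rw [if_pos (by omega)]
    simp only [pow_zero, Nat.choose_zero_right, Nat.cast_one, one_mul, Nat.sub_zero, hγn, zero_add]
    rw [Finset.sum_congr rfl fun r hr => by
      rw [← hγγ (n - (r + 1)) (by have := Finset.mem_range.1 hr; omega)]]
    ring
  rw [h2, h1, newtonCoeff_eq_prod, hεn, inv_one, mul_one]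
  -- Both products are `n!`: the factors `i + 1` come from the Newton coefficients, the factors `n -
  -- i` are the coefficients of `s` in `ε i`.
  have h3 : ∏ i ∈ Finset.range n, ((i : K) + 1) = ∏ i ∈ Finset.range n, ((n : K) - i) := by
    rw [← Finset.prod_range_reflect]
    refine Finset.prod_congr rfl fun i hi => ?_
    have : i + 1 ≤ n := Finset.mem_range.1 hi
    rw [show n - 1 - i = n - (i + 1) by omega, Nat.cast_sub this]
    push_cast; ring
  have h4 : ∀ i ∈ Finset.range n, ((i : K) + 1) * (s - i) / ε' i =
      (i + 1) * (n - i : K)⁻¹ * ((s - i) / (s - (n + i - 1 / (n - i)))) := by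
    intro i hi
    have hi := Finset.mem_range.1 hi
    have hni : (n - i : K) ≠ 0 := sub_ne_zero.2 (by exact_mod_cast hi.ne')
    have : ε' i = (n - i) * (s - (n + i - 1 / (n - i))) := by
      rw [hε']; field_simp; ring
    rw [this]
    simp only [div_eq_mul_inv, mul_inv]
    ring
  rw [Finset.prod_congr rfl h4, Finset.prod_mul_distrib, Finset.prod_mul_distrib, h3,
    ← Finset.prod_mul_distrib, Finset.prod_eq_one, one_mul]
  intro i hi
  have hi := Finset.mem_range.1 hi
  exact mul_inv_cancel₀ (sub_ne_zero.2 (by exact_mod_cast hi.ne'))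

end Newton
end

/-! ### First-order behaviour at `q = 1` -/

noncomputable section

section LimitAtOne

theorem rankCount_one {R : Type*} [CommRing R] (m k r : ℕ) :
    rankCount (1 : R) m k (r + 1) = 0 := by
  induction k generalizing r with
  | zero => rfl
  | succ k ih => simp [rankCount, ih]

theorem rankCharSum_one {R : Type*} [CommRing R] (k r : ℕ) :
    rankCharSum (1 : R) k r = (-1) ^ r * (k.choose r : R) := by
  induction k generalizing r with
  | zero => cases r <;> simp [rankCharSum]
  | succ k ih =>
    cases r with
    | zero => simp [rankCharSum]
    | succ r =>
      rw [rankCharSum, ih, ih, Nat.choose_succ_succ]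
      push_cast; ring

open PowerSeries

variable {K : Type*} [Field K]

/-- Counts of positive rank vanish at `x = 1`, and so does `x ^ m - x ^ r`. Hence to first order the
second term of the recursion contributes only for `r = 0`, where it adds `m` for each column. -/
theorem coeff_one_rankCount (m k r : ℕ) :
    coeff 1 (rankCount (1 + X : K⟦X⟧) m k (r + 1)) = if r = 0 then (m : K) * k else 0 := by
  induction k generalizing r with
  | zero => simp [rankCount]
  | succ k ih =>
    have h0 : ∀ r, constantCoeff (rankCount (1 + X : K⟦X⟧) m k (r + 1)) = 0 := fun r => by
      rw [map_rankCount]; simp [rankCount_one]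
    rw [rankCount, map_add, coeff_one_mul, coeff_one_mul, ih, h0, coeff_one_pow, map_sub,
      coeff_one_pow, coeff_one_pow]
    cases r with
    | zero => simp [rankCount_zero_right]; ring
    | succ r => simp [h0]

theorem constantCoeff_tracelessCount (n r : ℕ) :
    constantCoeff (tracelessCount (1 + X : K⟦X⟧) n (r + 1)) = 0 := by
  simp [tracelessCount, map_rankCount, rankCount_one]

theorem coeff_one_tracelessCount (n r : ℕ) :
    coeff 1 (tracelessCount (1 + X : K⟦X⟧) n (r + 1)) =
      (if r = 0 then (n : K) ^ 2 else 0) + (-1) ^ (r + 1) * (n.choose (r + 1) : K) := by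
  rw [tracelessCount, map_add, coeff_one_rankCount, coeff_one_mul, map_rankCharSum, sq]
  simp [rankCharSum_one]

theorem exists_eq_X_mul (f : K⟦X⟧) (h : constantCoeff f = 0) :
    ∃ g, f = X * g ∧ constantCoeff g = coeff 1 f := by
  obtain ⟨g, rfl⟩ := X_dvd_iff.2 h
  exact ⟨g, rfl, by rw [show (1 : ℕ) = 0 + 1 from rfl, coeff_succ_X_mul]; simp⟩

theorem exists_one_sub_levelRatio (y : K⟦X⟧) (s : K) (hy0 : constantCoeff y = 1)
    (hy1 : coeff 1 y = -s) (n m : ℕ) (hm : m < n) :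
    ∃ E, 1 - levelRatio n (1 + X) y m = X * E ∧
      constantCoeff E = (n - m) * s - (n ^ 2 - 1 - m ^ 2 : K) := by
  obtain ⟨E, hE, hE'⟩ := exists_eq_X_mul (1 - levelRatio n (1 + X) y m)
    (by simp [levelRatio, hy0])
  refine ⟨E, hE, ?_⟩
  have h1 : m ^ 2 ≤ n ^ 2 - 1 := Nat.le_sub_one_of_lt (Nat.pow_lt_pow_left hm two_ne_zero)
  have h2 : 1 ≤ n ^ 2 := Nat.one_le_pow _ _ (by omega)
  rw [hE', levelRatio, map_sub, coeff_one_mul, coeff_one_pow, coeff_one_pow, map_pow, map_pow, hy0,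
    hy1, Nat.cast_sub h1, Nat.cast_sub h2, Nat.cast_sub hm.le]
  simp [coeff_one]
  ring

/-- The solution of a recursion with unit leading terms. -/
def recSolution {R : Type*} [CommRing R] (e : ℕ → R) (c : ℕ → ℕ → R) (m : ℕ) : R :=
  e m * (1 + ∑ r : Fin m, c m r * recSolution e c (m - (r + 1)))
termination_by m
decreasing_by omega

theorem recSolution_eq {R : Type*} [CommRing R] (e : ℕ → R) (c : ℕ → ℕ → R) (m : ℕ) :
    recSolution e c m =
      e m * (1 + ∑ r ∈ Finset.range m, c m r * recSolution e c (m - (r + 1))) := by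
  rw [recSolution, Finset.sum_range]

/-- The value `W(q, q ^ (-s))` as a power series in `q - 1`. -/
theorem exists_zetaValue_series [CharZero K] (y : K⟦X⟧) (s : K) (hy0 : constantCoeff y = 1)
    (hy1 : coeff 1 y = -s) (n : ℕ) (hn : 1 ≤ n)
    (hs : ∀ m < n, (n - m) * s - (n ^ 2 - 1 - m ^ 2 : K) ≠ 0) :
    ∃ (Γ : ℕ → K⟦X⟧) (w : K⟦X⟧),
      (∀ m < n, Γ m * (1 - levelRatio n (1 + X) y m) = X + ∑ r ∈ Finset.range m,
        rankCount (1 + X) m m (r + 1) * y ^ (r + 1) * levelRatio n (1 + X) y m *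
          Γ (m - (r + 1))) ∧
      X * ((1 + X) * (w - 1)) = ∑ r ∈ Finset.range n,
        tracelessCount (1 + X) n (r + 1) * y ^ (r + 1) * Γ (n - (r + 1)) ∧
      constantCoeff w = ∏ i ∈ Finset.range n, ((s - i) / (s - (n + i - 1 / (n - i)))) := by
  choose! E hE hE0 using exists_one_sub_levelRatio y s hy0 hy1 n
  have hEu : ∀ m < n, E m * (E m)⁻¹ = 1 := fun m hm =>
    PowerSeries.mul_inv_cancel _ (by rw [hE0 m hm]; exact hs m hm)
  choose N hN hN0 using fun m r => exists_eq_X_mul (rankCount (1 + X : K⟦X⟧) m m (r + 1))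
    (by simp [map_rankCount, rankCount_one])
  choose T hT hT0 using fun r => exists_eq_X_mul (tracelessCount (1 + X : K⟦X⟧) n (r + 1))
    (constantCoeff_tracelessCount n r)
  -- `Γ m` stands for `X` times the generating function of size `m`, which has a simple pole at `q =
  -- 1`. Once a factor `X` is cancelled from the recursion, its leading coefficient `E m` is a unit,
  -- since its constant term is nonzero by `hs`.
  set Γ := recSolution (fun m => (E m)⁻¹)
    (fun m r => N m r * y ^ (r + 1) * levelRatio n (1 + X) y m) with hΓ
  have hrec : ∀ m < n, Γ m * E m = 1 + ∑ r ∈ Finset.range m, N m r * y ^ (r + 1) *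
      levelRatio n (1 + X) y m * Γ (m - (r + 1)) := fun m hm => by
    rw [hΓ, recSolution_eq, mul_comm, ← mul_assoc, hEu m hm, one_mul]
  have hx : (1 + X : K⟦X⟧) * (1 + X : K⟦X⟧)⁻¹ = 1 := PowerSeries.mul_inv_cancel _ (by simp)
  refine ⟨Γ, 1 + (1 + X : K⟦X⟧)⁻¹ * ∑ r ∈ Finset.range n, T r * y ^ (r + 1) * Γ (n - (r + 1)),
    fun m hm => ?_, ?_, ?_⟩
  · rw [hE m hm, mul_left_comm, hrec m hm, mul_add, mul_one, Finset.mul_sum]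
    congr 1
    refine Finset.sum_congr rfl fun r _ => ?_
    rw [hN]; ring
  · rw [add_sub_cancel_left, ← mul_assoc (1 + X), hx, one_mul, Finset.mul_sum]
    refine Finset.sum_congr rfl fun r _ => ?_
    rw [hT]; ring
  · have hγ : ∀ m < n, constantCoeff (Γ m) * ((n - m) * s - (n ^ 2 - 1 - m ^ 2 : K)) =
        1 + m ^ 2 * constantCoeff (Γ (m - 1)) := fun m hm => by
      rw [← hE0 m hm, ← map_mul, hrec m hm]
      simp only [map_add, map_one, map_sum, map_mul, map_pow, hy0, one_pow, mul_one, hN0,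
        coeff_one_rankCount, map_levelRatio, ite_mul, zero_mul]
      rw [Finset.sum_ite_eq']
      rcases m with _ | m
      · simp
      · simp [levelRatio, sq]
    rw [← one_add_sum_eq_prod s n hn _ (fun m _ => rfl) hs _ hγ]
    simp only [map_add, map_one, map_mul, map_sum, map_pow, hy0, one_pow, mul_one, hT0,
      coeff_one_tracelessCount]
    simp

end LimitAtOne

/-! ### Laurent expansions in `q - 1` and their faithfulness -/

section Expansion

open PowerSeries

/-- `q ^ (-s)` as a power series in `q - 1`. -/
abbrev qPow : (RatFunc ℚ)⟦X⟧ :=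
  PowerSeries.binomialSeries (RatFunc ℚ) (-RatFunc.X : RatFunc ℚ)

theorem constantCoeff_qPow : constantCoeff qPow = 1 := by
  simp [qPow]

theorem coeff_one_qPow : coeff 1 qPow = -RatFunc.X := by
  simp [qPow]

theorem succ_mul_choose_succ {K : Type*} [Field K] [CharZero K] (r : K) (k : ℕ) :
    ((k : K) + 1) * Ring.choose r (k + 1) = (r - k) * Ring.choose r k := by
  have := Ring.choose_smul_choose r (Nat.le_succ k)
  simp only [Nat.succ_eq_add_one, Nat.choose_succ_self_right, nsmul_eq_mul, Nat.cast_add,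
    Nat.cast_one, Nat.add_sub_cancel_left, Ring.choose_one_right] at this
  rw [this, mul_comm]

/-- The formal version of `q * d/dq (q ^ (-s)) = -s * q ^ (-s)`; it makes `qPow` an eigenvector of
`eulerOp`. -/
theorem one_add_X_mul_derivative_qPow :
    (1 + X) * derivative (RatFunc ℚ) qPow = C (-RatFunc.X : RatFunc ℚ) * qPow := by
  ext k
  rw [add_mul, one_mul, map_add, coeff_C_mul, coeff_derivative]
  simp only [qPow, binomialSeries_coeff, smul_eq_mul, mul_one]
  have := succ_mul_choose_succ (-RatFunc.X : RatFunc ℚ) k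
  rcases k with _ | k
  · simp at this ⊢
  · rw [coeff_succ_X_mul, coeff_derivative]
    simp only [binomialSeries_coeff, smul_eq_mul, mul_one]
    push_cast at this ⊢
    linear_combination this

/-- The derivation `q * d / dq`. -/
def eulerOp : Module.End (RatFunc ℚ) (RatFunc ℚ)⟦X⟧ :=
  LinearMap.mulLeft (RatFunc ℚ) (1 + X) ∘ₗ (derivative (RatFunc ℚ)).toLinearMap

theorem eulerOp_apply (f : (RatFunc ℚ)⟦X⟧) :
    eulerOp f = (1 + X) * derivative (RatFunc ℚ) f := rfl

theorem eulerOp_mul (f g : (RatFunc ℚ)⟦X⟧) : eulerOp (f * g) = eulerOp f * g + f * eulerOp g := by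
  simp only [eulerOp_apply, Derivation.leibniz, smul_eq_mul]
  ring

theorem eulerOp_pow (f : (RatFunc ℚ)⟦X⟧) (μ : RatFunc ℚ) (hf : eulerOp f = C μ * f) (k : ℕ) :
    eulerOp (f ^ k) = C (k * μ) * f ^ k := by
  induction k with
  | zero => simp [eulerOp_apply]
  | succ k ih =>
    rw [pow_succ, eulerOp_mul, ih, hf]
    push_cast
    simp only [map_add, map_mul, map_one, map_natCast]
    ring

/-- The monomials `q ^ a * q ^ (-b s)` are eigenvectors of `q * d/dq` with eigenvalues `a - b s`,
which are pairwise distinct because `s` is an indeterminate. -/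
theorem linearIndependent_expansion : LinearIndependent (RatFunc ℚ)
    fun d : Fin 2 →₀ ℕ => (1 + X : (RatFunc ℚ)⟦X⟧) ^ d 0 * qPow ^ d 1 := by
  refine Module.End.eigenvectors_linearIndependent' eulerOp
    (fun d : Fin 2 →₀ ℕ => ((d 0 : RatFunc ℚ) - (d 1 : RatFunc ℚ) * RatFunc.X)) ?_ _
    fun d => ⟨?_, ?_⟩
  · intro d e hde
    have h : algebraMap (Polynomial ℚ) (RatFunc ℚ)
        ((d 0 : Polynomial ℚ) - (d 1 : Polynomial ℚ) * Polynomial.X) =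
        algebraMap (Polynomial ℚ) (RatFunc ℚ)
        ((e 0 : Polynomial ℚ) - (e 1 : Polynomial ℚ) * Polynomial.X) := by
      simpa using hde
    have h := IsFractionRing.injective _ _ h
    -- The values of `a - b s` at `s = 0` and `s = 1` recover the two exponents.
    have h0 := congrArg (Polynomial.eval 0) h
    have h1 := congrArg (Polynomial.eval 1) h
    simp at h0 h1
    ext i
    fin_cases i
    · exact h0
    · rw [h0] at h1
      simpa using h1
  · rw [Module.End.mem_eigenspace_iff, eulerOp_mul,
      eulerOp_pow (1 + X) 1 (by simp [eulerOp_apply, derivative_X]),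
      eulerOp_pow qPow _ one_add_X_mul_derivative_qPow, PowerSeries.smul_eq_C_mul]
    simp only [map_sub, map_mul, map_neg, map_one, map_natCast]
    ring
  · refine mul_ne_zero (pow_ne_zero _ fun h => ?_) (pow_ne_zero _ fun h => ?_)
    · simpa using congrArg constantCoeff h
    · simpa using congrArg constantCoeff h

theorem polyExpansion_injective : Function.Injective polyExpansion := by
  refine (injective_iff_map_eq_zero (MvPolynomial.aeval (R := ℚ)
    (![1 + X, qPow] : Fin 2 → (RatFunc ℚ)⟦X⟧))).2 fun f hf => ?_
  rw [MvPolynomial.aeval_def, MvPolynomial.eval₂_eq'] at hf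
  simp only [Fin.prod_univ_two, Matrix.cons_val_zero, Matrix.cons_val_one] at hf
  ext d
  by_cases hd : d ∈ f.support
  · have := linearIndependent_iff'.1 linearIndependent_expansion f.support
      (fun d => algebraMap ℚ (RatFunc ℚ) (f.coeff d)) (by
        rw [← hf]
        refine Finset.sum_congr rfl fun d _ => ?_
        rw [PowerSeries.smul_eq_C_mul, PowerSeries.algebraMap_apply]) d hd
    simpa using this
  · simpa using hd

theorem coe_polyExpansion (f : MvPolynomial (Fin 2) ℚ) :
    (polyExpansion f : LaurentSeries (RatFunc ℚ)) = MvPolynomial.aeval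
      ![((1 + X : (RatFunc ℚ)⟦X⟧) : LaurentSeries (RatFunc ℚ)),
        (qPow : LaurentSeries (RatFunc ℚ))] f := by
  have := MvPolynomial.comp_aeval_apply (R := ℚ) (![1 + X, qPow] : Fin 2 → (RatFunc ℚ)⟦X⟧)
    (HahnSeries.ofPowerSeries ℤ (RatFunc ℚ)).toRatAlgHom f
  refine this.trans (congrArg (fun v => MvPolynomial.aeval v f) ?_)
  ext i : 1
  fin_cases i <;> rfl

theorem coe_polyExpansion_ne_zero {g : MvPolynomial (Fin 2) ℚ} (hg : g ≠ 0) :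
    (polyExpansion g : LaurentSeries (RatFunc ℚ)) ≠ 0 := fun h0 => hg <| by
  apply polyExpansion_injective
  apply HahnSeries.ofPowerSeries_injective (Γ := ℤ)
  rw [h0, polyExpansion, map_zero, map_zero]

theorem qExpansion_of_mul_eq {f g : MvPolynomial (Fin 2) ℚ} (hg : g ≠ 0)
    {w : (RatFunc ℚ)⟦X⟧} (hw : constantCoeff w ≠ 0) (h : w * polyExpansion g = polyExpansion f) :
    (qExpansion f g).order = 0 ∧ (qExpansion f g).leadingCoeff = constantCoeff w := by
  have hg' := coe_polyExpansion_ne_zero hg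
  have : qExpansion f g = (w : LaurentSeries (RatFunc ℚ)) := by
    rw [qExpansion, div_eq_iff hg', ← h, PowerSeries.coe_mul]
  have hw0 : (w : LaurentSeries (RatFunc ℚ)).coeff 0 = constantCoeff w := by
    simpa using LaurentSeries.coeff_coe_powerSeries w 0
  have ho : (w : LaurentSeries (RatFunc ℚ)).order = 0 := by
    refine le_antisymm (HahnSeries.order_le_of_coeff_ne_zero (hw0 ▸ hw)) ?_
    by_contra! hlt
    have hne : (w : LaurentSeries (RatFunc ℚ)) ≠ 0 := fun h0 => hw (by rw [← hw0, h0]; simp)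
    have h1 := HahnSeries.coeff_order_eq_zero.not.2 hne
    rw [PowerSeries.coeff_coe, if_pos hlt] at h1
    exact h1 rfl
  rw [this]
  refine ⟨ho, ?_⟩
  rw [HahnSeries.leadingCoeff_eq, ho, hw0]

/-- The series recursions are multiplied by `h` to stay free of poles; after mapping to a field
where `h` is invertible, `Γ / h` is an honest solution, to which the universal numerator applies. -/
theorem isLevelSum_of_mul {R F : Type*} [CommRing R] [Field F] (φ : R →+* F) {h : R}
    (hX : φ h ≠ 0) (n : ℕ) (y w : R) (Γ : ℕ → R)
    (hΓ : ∀ m < n, Γ m * (1 - levelRatio n (1 + h) y m) = h + ∑ r ∈ Finset.range m,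
        rankCount (1 + h) m m (r + 1) * y ^ (r + 1) * levelRatio n (1 + h) y m *
          Γ (m - (r + 1)))
    (hw : h * ((1 + h) * (w - 1)) = ∑ r ∈ Finset.range n,
        tracelessCount (1 + h) n (r + 1) * y ^ (r + 1) * Γ (n - (r + 1))) :
    IsLevelSum n (φ (1 + h)) (φ y) (fun m => (φ h)⁻¹ * φ (Γ m)) ∧
      IsZetaValue n (φ (1 + h)) (φ y) (fun m => (φ h)⁻¹ * φ (Γ m)) (φ w) := by
  constructor
  · intro m hm
    apply mul_left_cancel₀ hX
    have := congrArg φ (hΓ m hm)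
    simp only [map_mul, map_sub, map_one, map_levelRatio, map_sum, map_rankCount,
      map_pow, map_add φ h (∑ _ ∈ _, _)] at this
    simp only [mul_add, mul_one, Finset.mul_sum, ← mul_assoc, mul_inv_cancel₀ hX, one_mul]
    rw [this]
    congr 1
    refine Finset.sum_congr rfl fun r _ => ?_
    rw [mul_right_comm _ _ (φ h)⁻¹]
    field_simp
  · apply mul_left_cancel₀ hX
    have := congrArg φ hw
    simp only [map_mul, map_sub, map_one, map_sum, tracelessCount, map_rankCount,
      map_rankCharSum, map_pow, map_add φ (rankCount _ _ _ _)] at this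
    simp only [tracelessCount]
    rw [this, Finset.mul_sum]
    refine Finset.sum_congr rfl fun r _ => ?_
    field_simp

theorem genericDenom_ne_zero (n : ℕ) : genericDenom n ≠ 0 := by
  intro h
  -- At the point `(1, 2)` the factors are `1 - 2 ^ (n - j)` with `j < n`, none of which is zero.
  have := congrArg (MvPolynomial.aeval (![1, 2] : Fin 2 → ℚ)) h
  rw [aeval_genericDenom, map_zero, one_mul, Finset.prod_eq_zero_iff] at this
  obtain ⟨j, hj, h⟩ := this
  rw [levelRatio, one_pow, one_mul, sub_eq_zero] at h
  exact (one_lt_pow₀ (by norm_num : (1 : ℚ) < 2)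
    (by have := Finset.mem_range.1 hj; omega)).ne h

theorem sub_ratFunc_X_ne_zero (a : ℚ) : (RatFunc.X - RatFunc.C a : RatFunc ℚ) ≠ 0 := by
  have : (RatFunc.X - RatFunc.C a : RatFunc ℚ) =
      algebraMap (Polynomial ℚ) (RatFunc ℚ) (Polynomial.X - Polynomial.C a) := by simp
  rw [this]
  exact (map_ne_zero_iff _ (IsFractionRing.injective _ _)).2 (Polynomial.X_sub_C_ne_zero a)

/-- The closed form of the topological representation zeta function. -/
abbrev topZeta (n : ℕ) : RatFunc ℚ :=
  ∏ i ∈ Finset.range n, (RatFunc.X - RatFunc.C (i : ℚ)) /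
    (RatFunc.X - RatFunc.C ((n : ℚ) + (i : ℚ) - 1 / ((n : ℚ) - (i : ℚ))))

theorem topZeta_ne_zero (n : ℕ) : topZeta n ≠ 0 :=
  Finset.prod_ne_zero_iff.2 fun _ _ =>
    div_ne_zero (sub_ratFunc_X_ne_zero _) (sub_ratFunc_X_ne_zero _)

theorem exists_genericZeta (n : ℕ) (hn : 1 ≤ n) :
    ∃ f : MvPolynomial (Fin 2) ℚ,
      (∀ (x y w : ℂ) (G : ℕ → ℂ), IsLevelSum n x y G → IsZetaValue n x y G w →
        w * MvPolynomial.aeval ![x, y] (genericDenom n) = MvPolynomial.aeval ![x, y] f) ∧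
      (qExpansion f (genericDenom n)).order = 0 ∧
      (qExpansion f (genericDenom n)).leadingCoeff = topZeta n := by
  obtain ⟨f, hf⟩ := exists_genericNumerator n
  refine ⟨f, fun x y w G => hf ℂ x y w G, ?_⟩
  have hs : ∀ m < n, ((n : RatFunc ℚ) - (m : RatFunc ℚ)) * RatFunc.X -
      ((n : RatFunc ℚ) ^ 2 - 1 - (m : RatFunc ℚ) ^ 2) ≠ 0 := fun m hm => by
    have hnm : (n - m : ℚ) ≠ 0 := sub_ne_zero.2 (by exact_mod_cast hm.ne')
    have h1 := mul_ne_zero ((map_ne_zero_iff _ (RatFunc.C_injective (K := ℚ))).2 hnm)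
      (sub_ratFunc_X_ne_zero (((n : ℚ) ^ 2 - 1 - (m : ℚ) ^ 2) / (n - m)))
    rw [mul_sub, ← map_mul, mul_div_cancel₀ _ hnm] at h1
    simpa using h1
  obtain ⟨Γ, w, hΓ, hw, hw0⟩ := exists_zetaValue_series qPow RatFunc.X constantCoeff_qPow
    coeff_one_qPow n hn hs
  have hw1 : constantCoeff w = topZeta n := by
    rw [hw0]
    refine Finset.prod_congr rfl fun i _ => ?_
    simp
  rw [← hw1]
  refine qExpansion_of_mul_eq (genericDenom_ne_zero n) (hw1 ▸ topZeta_ne_zero n) ?_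
  apply HahnSeries.ofPowerSeries_injective (Γ := ℤ)
  set φ := HahnSeries.ofPowerSeries ℤ (RatFunc ℚ)
  have hX : φ X ≠ 0 := fun h => X_ne_zero
    (HahnSeries.ofPowerSeries_injective (Γ := ℤ) (h.trans (map_zero φ).symm))
  rw [map_mul, coe_polyExpansion, coe_polyExpansion]
  obtain ⟨h1, h2⟩ := isLevelSum_of_mul φ hX n qPow w Γ hΓ hw
  exact hf _ _ _ _ _ h1 h2

end Expansion
end

/-! ### Matrices of given rank and trace over a finite field -/

noncomputable section

section FiniteFieldCounts

open Module Submodule Finset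
open scoped Classical in
theorem finrank_span_range_cons {F V : Type*} [Field F] [AddCommGroup V] [Module F V]
    [FiniteDimensional F V] {k : ℕ} (a : V) (v : Fin k → V) :
    finrank F (span F (Set.range (Fin.cons a v : Fin (k + 1) → V))) =
      finrank F (span F (Set.range v)) + if a ∈ span F (Set.range v) then 0 else 1 := by
  rw [Fin.range_cons, span_insert]
  split_ifs with h
  · rw [sup_of_le_right ((span_singleton_le_iff_mem _ _).2 h), add_zero]
  · have h0 : a ≠ 0 := fun h0 => h (h0 ▸ zero_mem _)
    have h1 := finrank_sup_add_finrank_inf_eq (span F {a}) (span F (Set.range v))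
    have h2 : span F {a} ⊓ span F (Set.range v) = ⊥ :=
      ((disjoint_span_singleton' h0).2 h).symm.eq_bot
    rw [h2, finrank_bot, finrank_span_singleton h0] at h1
    omega

theorem finrank_span_range_fin_zero {F V : Type*} [Field F] [AddCommGroup V] [Module F V]
    (v : Fin 0 → V) : finrank F (span F (Set.range v)) = 0 := by
  rw [Set.range_eq_empty, span_empty, finrank_bot]

variable {F : Type} [Field F] [Fintype F] {R : Type*} [CommRing R]

omit [Fintype F] in
open scoped Classical in
/-- Splitting a sum over tuples of vectors according to whether the first vector lies in the span
of the others. -/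
theorem sum_cons_finrank {V : Type} [AddCommGroup V] [Module F V] [Fintype V] {k : ℕ}
    (g : V → (Fin k → V) → R) (r : ℕ) :
    ∑ v : Fin (k + 1) → V, (if finrank F (span F (Set.range v)) = r then
        g (v 0) (fun i => v i.succ) else 0) =
      ∑ v : Fin k → V,
        ((if finrank F (span F (Set.range v)) = r then
            ∑ a : span F (Set.range v), g a v else 0) +
          if finrank F (span F (Set.range v)) + 1 = r then
            ∑ a : V, g a v - ∑ a : span F (Set.range v), g a v else 0) := by
  rw [← (Fin.consEquiv fun _ => V).sum_comp, Fintype.sum_prod_type_right]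
  refine Finset.sum_congr rfl fun v _ => ?_
  have h : ∀ a : V, (if finrank F (span F (Set.range (Fin.cons a v : Fin (k + 1) → V))) = r then
      g a v else 0) =
      (if finrank F (span F (Set.range v)) = r then
        (if a ∈ span F (Set.range v) then g a v else 0) else 0) +
      if finrank F (span F (Set.range v)) + 1 = r then
        (g a v - if a ∈ span F (Set.range v) then g a v else 0) else 0 := by
    intro a
    rw [finrank_span_range_cons]
    by_cases ha : a ∈ span F (Set.range v) <;> simp [ha]
  have h' : ∀ a ∈ (univ : Finset V), (if finrank F (span F (Set.range
      ((Fin.consEquiv fun _ => V) (a, v)))) = r then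
      g ((Fin.consEquiv fun _ => V) (a, v) 0) (fun i => (Fin.consEquiv fun _ => V) (a, v) i.succ)
      else 0) = _ := fun a _ => h a
  rw [Finset.sum_congr rfl h', Finset.sum_add_distrib]
  have h3 : ∑ a : V, (if a ∈ span F (Set.range v) then g a v else 0) =
      ∑ a : span F (Set.range v), g a v := by
    rw [← Finset.sum_filter]
    exact (Finset.sum_subtype _ (by simp) fun a => g a v)
  congr 1
  · split_ifs
    · exact h3
    · simp
  · split_ifs
    · rw [Finset.sum_sub_distrib, h3]
    · simp

-- Add one vector to a tuple: it either lies in the span of the others, which has `q ^ rank`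
-- elements, or it lies outside and raises the rank by one.
open scoped Classical in
theorem sum_finrank_eq_rankCount {V : Type} [AddCommGroup V] [Module F V] [Fintype V] (k r : ℕ) :
    ∑ v : Fin k → V, (if finrank F (span F (Set.range v)) = r then (1 : R) else 0) =
      rankCount (Fintype.card F : R) (finrank F V) k r := by
  have hc : ∀ U : Submodule F V, (Fintype.card U : R) = (Fintype.card F : R) ^ finrank F U :=
    fun U => by rw [← Nat.cast_pow, Module.card_eq_pow_finrank (K := F)]
  induction k generalizing r with
  | zero => cases r <;> simp [rankCount, finrank_span_range_fin_zero]
  | succ k ih =>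
    rw [sum_cons_finrank (F := F) (fun _ _ => (1 : R)) r]
    simp only [Finset.sum_const, nsmul_one, Finset.card_univ, hc]
    rw [Finset.sum_add_distrib, Module.card_eq_pow_finrank (K := F) (V := V)]
    cases r with
    | zero =>
      simp only [Nat.succ_ne_zero, if_false, Finset.sum_const_zero, add_zero, rankCount]
      rw [← rankCount_zero_right (Fintype.card F : R) (finrank F V) k, ← ih]
      refine Finset.sum_congr rfl fun v _ => ?_
      split_ifs with h <;> simp [h]
    | succ r =>
      rw [rankCount, ← ih, ← ih, Finset.mul_sum, Finset.mul_sum]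
      congr 1
      · refine Finset.sum_congr rfl fun v _ => ?_
        split_ifs with h <;> simp [h]
      · refine Finset.sum_congr rfl fun v _ => ?_
        simp only [Nat.add_right_cancel_iff]
        split_ifs with h <;> simp [h]

-- A nonzero linear form takes all values equally often, so the sum is a multiple of the total
-- weight, which is zero.
open scoped Classical in
theorem sum_translate_linearForm (w : F → R) (hw : ∑ x, w x = 0) {U : Type} [AddCommGroup U]
    [Module F U] [Fintype U] (f : Dual F U) (c : F) :
    ∑ a : U, w (f a + c) = if f = 0 then (Fintype.card U : R) * w c else 0 := by
  split_ifs with hf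
  · simp [hf]
  · have hs : Function.Surjective f := LinearMap.surjective hf
    obtain ⟨N, hN⟩ : ∃ N : ℕ, ∀ x : F, (univ.filter fun a => f a = x).card = N := by
      refine ⟨(univ.filter fun a => f a = 0).card, fun x => ?_⟩
      obtain ⟨b, rfl⟩ := hs x
      refine (Finset.card_equiv (Equiv.addRight b) fun a => ?_).symm
      simp
    rw [← Finset.sum_fiberwise_of_maps_to (t := univ) (g := fun a => f a) (by simp)]
    have : ∀ x ∈ (univ : Finset F), ∑ a with f a = x, w (f a + c) = N * w (x + c) := by
      intro x _
      rw [← hN x, ← nsmul_eq_mul, ← Finset.sum_const]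
      exact Finset.sum_congr rfl fun a ha => by rw [(Finset.mem_filter.1 ha).2]
    rw [Finset.sum_congr rfl this, ← Finset.mul_sum, show ∑ x, w (x + c) = ∑ x, w x from
      (Equiv.sum_comp (Equiv.addRight c) w), hw, mul_zero]

-- Sum over the first vector. Over the whole space the sum is zero because `f 0 ≠ 0`; over the span
-- `U` of the other vectors it is zero unless `f 0` vanishes on `U`. So only tuples inside `ker (f
-- 0)` remain, and the induction continues in that kernel; hence the statement for arbitrary `V` and
-- independent forms.
open scoped Classical in
theorem sum_finrank_weight_eq_rankCharSum (w : F → R) (hw : ∑ x, w x = 0) (k : ℕ) :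
    ∀ (r : ℕ) (V : Type) [AddCommGroup V] [Module F V] [Fintype V] (f : Fin k → Dual F V),
      LinearIndependent F f →
      ∑ v : Fin k → V, (if finrank F (span F (Set.range v)) = r then w (∑ i, f i (v i)) else 0) =
        w 0 * rankCharSum (Fintype.card F : R) k r := by
  induction k with
  | zero => intro r V _ _ _ f _; cases r <;> simp [rankCharSum, finrank_span_range_fin_zero]
  | succ k ih =>
    intro r V _ _ _ f hf
    have hf0 : f 0 ≠ 0 := hf.ne_zero 0
    set V' : Submodule F V := LinearMap.ker (f 0) with hV'
    set f' : Fin k → Dual F V' := fun i => (f i.succ).comp V'.subtype with hf'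
    have hli : LinearIndependent F f' := by
      rw [Fintype.linearIndependent_iff]
      intro g hg
      obtain ⟨a, ha⟩ := LinearMap.surjective hf0 1
      set φ : Dual F V := ∑ i, g i • f i.succ with hφ
      have h0 : ∀ x ∈ V', φ x = 0 := fun x hx => by
        have := LinearMap.congr_fun hg ⟨x, hx⟩
        simpa [hφ, hf'] using this
      -- A form vanishing on the kernel of `f 0` is a multiple of `f 0`, and since `f 0 a = 1` the
      -- factor is `φ a`; a relation among the restrictions thus lifts to one among the `f i`.
      have h1 : ∑ i, (Fin.cons (-φ a) g : Fin (k + 1) → F) i • f i = 0 := by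
        rw [Fin.sum_univ_succ]
        simp only [Fin.cons_zero, Fin.cons_succ, ← hφ]
        ext x
        have := h0 (x - f 0 x • a) (by simp [hV', ha])
        simp only [map_sub, map_smul, smul_eq_mul] at this
        simp only [LinearMap.add_apply, LinearMap.smul_apply, smul_eq_mul, LinearMap.zero_apply]
        linear_combination this
      intro i
      simpa using Fintype.linearIndependent_iff.1 hf _ h1 i.succ
    have hin : ∀ v : Fin k → V, ((f 0).comp (span F (Set.range v)).subtype = 0) ↔
        ∀ i, v i ∈ V' := by
      intro v
      rw [← LinearMap.range_le_ker_iff, range_subtype, span_le, Set.range_subset_iff]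
      rfl
    have hsum : ∀ v : Fin k → V, ∑ a : span F (Set.range v), w (f 0 a + ∑ i, f i.succ (v i)) =
        if ∀ i, v i ∈ V' then
          (Fintype.card F : R) ^ finrank F (span F (Set.range v)) * w (∑ i, f i.succ (v i))
        else 0 := by
      intro v
      have := sum_translate_linearForm w hw ((f 0).comp (span F (Set.range v)).subtype)
        (∑ i, f i.succ (v i))
      simp only [hin] at this
      rw [← Nat.cast_pow, ← Module.card_eq_pow_finrank (K := F)]
      exact this
    have hall : ∀ v : Fin k → V, ∑ a : V, w (f 0 a + ∑ i, f i.succ (v i)) = 0 := by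
      intro v
      rw [sum_translate_linearForm w hw, if_neg hf0]
    have hih : ∀ r, ∑ v : Fin k → V, (if finrank F (span F (Set.range v)) = r then
        (if ∀ i, v i ∈ V' then w (∑ i, f i.succ (v i)) else 0) else 0) =
        w 0 * rankCharSum (Fintype.card F : R) k r := by
      intro r
      rw [← ih r V' f' hli, ← (Equiv.subtypePiEquivPi (β := fun _ : Fin k => V)
        (p := fun _ x => x ∈ V')).sum_comp]
      have hcomm : ∀ v : Fin k → V, (if finrank F (span F (Set.range v)) = r then
          (if ∀ i, v i ∈ V' then w (∑ i, f i.succ (v i)) else 0) else 0) =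
          if ∀ i, v i ∈ V' then (if finrank F (span F (Set.range v)) = r then
            w (∑ i, f i.succ (v i)) else 0) else 0 := fun v => by split_ifs <;> rfl
      simp only [hcomm]
      rw [← Finset.sum_filter, Finset.sum_subtype _ (p := fun v : Fin k → V => ∀ i, v i ∈ V')
        (by simp)]
      refine Finset.sum_congr rfl fun v _ => ?_
      have hspan : span F (Set.range v.1) = (span F (Set.range (Equiv.subtypePiEquivPi v))).map
          V'.subtype := by
        rw [map_span, ← Set.range_comp]; rfl
      rw [hspan, finrank_map_subtype_eq]
      rfl
    simp only [Fin.sum_univ_succ]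
    rw [sum_cons_finrank (F := F) (fun a v => w (f 0 a + ∑ i, f i.succ (v i))) r]
    simp only [hsum, hall, zero_sub]
    rw [Finset.sum_add_distrib]
    cases r with
    | zero =>
      simp only [Nat.succ_ne_zero, if_false, Finset.sum_const_zero, add_zero]
      have h0 : rankCharSum (Fintype.card F : R) (k + 1) 0 =
        rankCharSum (Fintype.card F : R) k 0 := by rw [rankCharSum, rankCharSum_zero_right]
      rw [h0, ← hih]
      refine Finset.sum_congr rfl fun v _ => ?_
      split_ifs with h <;> simp [h]
    | succ r =>
      rw [rankCharSum, mul_sub, mul_left_comm, mul_left_comm (w 0), ← hih, ← hih, Finset.mul_sum,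
        Finset.mul_sum, sub_eq_add_neg, ← Finset.sum_neg_distrib]
      congr 1
      · refine Finset.sum_congr rfl fun v _ => ?_
        split_ifs with h <;> simp [h]
      · refine Finset.sum_congr rfl fun v _ => ?_
        simp only [Nat.add_right_cancel_iff]
        split_ifs with h <;> simp [h]

/-- A matrix as the tuple of its columns. -/
def matrixColsEquiv (m k : ℕ) : Matrix (Fin m) (Fin k) F ≃ (Fin k → Fin m → F) where
  toFun M := M.col
  invFun v := Matrix.of fun i j => v j i
  left_inv _ := rfl
  right_inv _ := rfl

open scoped Classical in
theorem sum_rank_eq_rankCount (m k r : ℕ) :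
    ∑ M : Matrix (Fin m) (Fin k) F, (if M.rank = r then (1 : R) else 0) =
      rankCount (Fintype.card F : R) m k r := by
  have := sum_finrank_eq_rankCount (F := F) (R := R) (V := Fin m → F) k r
  rw [finrank_fin_fun] at this
  rw [← this]
  refine Fintype.sum_equiv (matrixColsEquiv m k) _ _ fun M => ?_
  rw [Matrix.rank_eq_finrank_span_cols]
  rfl

open scoped Classical in
/-- The number of traceless matrices of given rank over a finite field. -/
theorem sum_rank_traceless (n r : ℕ) :
    (Fintype.card F : R) *
      ∑ M : Matrix (Fin n) (Fin n) F, (if M.rank = r ∧ M.trace = 0 then (1 : R) else 0) =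
      tracelessCount (Fintype.card F : R) n r := by
  -- The weight `q * 1_{x = 0} - 1` has total zero and value `q - 1` at `0`; adding the plain rank
  -- count to its sum isolates the matrices of trace zero.
  have hw : ∑ x : F, ((Fintype.card F : R) * (if x = 0 then 1 else 0) - 1) = 0 := by
    simp
  have h := sum_finrank_weight_eq_rankCharSum _ hw n r (Fin n → F)
    (fun i => LinearMap.proj i) (by
      rw [Fintype.linearIndependent_iff]
      intro g hg i
      have := LinearMap.congr_fun hg (Pi.single i 1)
      simpa [Pi.single_apply] using this)
  rw [tracelessCount, ← sum_rank_eq_rankCount (F := F)]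
  simp only [if_true, mul_one] at h
  rw [← h, Finset.mul_sum]
  rw [show (∑ v : Fin n → Fin n → F, _ : R) = _ from
    (Fintype.sum_equiv (matrixColsEquiv n n) (fun M : Matrix (Fin n) (Fin n) F =>
      if M.rank = r then (Fintype.card F : R) * (if M.trace = 0 then 1 else 0) - 1 else 0) _
      fun M => by rw [Matrix.rank_eq_finrank_span_cols]; rfl).symm, ← Finset.sum_add_distrib]
  refine Finset.sum_congr rfl fun M _ => ?_
  by_cases h1 : M.rank = r <;> by_cases h2 : M.trace = 0 <;> simp [h1, h2]

end FiniteFieldCounts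
end

/-! ### Sizes of images of matrices -/

noncomputable section

section ImageCard

open Matrix

/-- The cardinality of the image of the linear map given by a matrix. -/
def imCard {A : Type} [CommRing A] {m n : Type} [Fintype n] (M : Matrix m n A) : ℕ :=
  Nat.card (LinearMap.range M.mulVecLin)

variable {A : Type} [CommRing A]

theorem imCard_mul_mul {m : Type} [Fintype m] [DecidableEq m] (M : Matrix m m A)
    {P Q : Matrix m m A} (hP : IsUnit P) (hQ : IsUnit Q) : imCard (P * M * Q) = imCard M := by
  have hPi : Function.Injective P.mulVecLin := by
    rw [← LinearMap.ker_eq_bot, LinearMap.ker_eq_bot']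
    intro v hv
    obtain ⟨u, rfl⟩ := hP
    have := congrArg (fun w => (↑u⁻¹ : Matrix m m A) *ᵥ w) hv
    simpa [Matrix.mulVec_mulVec] using this
  have hQs : LinearMap.range Q.mulVecLin = ⊤ := by
    rw [LinearMap.range_eq_top]
    intro v
    obtain ⟨u, rfl⟩ := hQ
    exact ⟨(↑u⁻¹ : Matrix m m A) *ᵥ v, by simp [Matrix.mulVec_mulVec]⟩
  rw [imCard, Matrix.mulVecLin_mul, LinearMap.range_comp_of_range_eq_top _ hQs,
    Matrix.mulVecLin_mul, LinearMap.range_comp]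
  exact Nat.card_congr (Submodule.equivMapOfInjective _ hPi _).toEquiv.symm

theorem imCard_submatrix {m n : Type} [Fintype m] [Fintype n] (M : Matrix m m A) (e : n ≃ m) :
    imCard (M.submatrix e e) = imCard M := by
  refine Nat.card_congr (Equiv.subtypeEquiv (Equiv.arrowCongr e (Equiv.refl A)) fun w => ?_)
  simp only [LinearMap.mem_range]
  constructor
  · rintro ⟨v, rfl⟩
    refine ⟨v ∘ e.symm, ?_⟩
    ext i
    simp [Matrix.submatrix_mulVec_equiv]
  · rintro ⟨v, hv⟩
    refine ⟨v ∘ e, ?_⟩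
    ext i
    have := congrFun hv (e i)
    simpa [Matrix.submatrix_mulVec_equiv, Function.comp_assoc] using this

/-- Block elimination turns the matrix into the diagonal blocks `a` and the Schur complement; the
invertible block `a` has full image. -/
theorem imCard_fromBlocks {r d : Type} [Fintype r] [Fintype d] [DecidableEq r] [DecidableEq d]
    (a : Matrix r r A) (b : Matrix r d A) (c : Matrix d r A) (D : Matrix d d A) [Invertible a] :
    imCard (fromBlocks a b c D) = Nat.card A ^ Fintype.card r * imCard (D - c * ⅟a * b) := by
  have hl : IsUnit (fromBlocks (1 : Matrix r r A) 0 (c * ⅟a) (1 : Matrix d d A)) := by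
    rw [Matrix.isUnit_iff_isUnit_det, Matrix.det_fromBlocks_zero₁₂]; simp
  have hu : IsUnit (fromBlocks (1 : Matrix r r A) (⅟a * b) 0 (1 : Matrix d d A)) := by
    rw [Matrix.isUnit_iff_isUnit_det, Matrix.det_fromBlocks_zero₂₁]; simp
  rw [Matrix.fromBlocks_eq_of_invertible₁₁, imCard_mul_mul _ hl hu]
  set S := D - c * ⅟a * b
  have : Nat.card A ^ Fintype.card r = Nat.card (r → A) := by
    rw [Nat.card_fun, Nat.card_eq_fintype_card (α := r)]
  rw [this, imCard, imCard, ← Nat.card_prod]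
  refine Nat.card_congr ((Equiv.subtypeEquiv (Equiv.sumArrowEquivProdArrow r d A)
    (q := fun w => w.2 ∈ LinearMap.range S.mulVecLin) fun w => ?_).trans
    ⟨fun w => (w.1.1, ⟨w.1.2, w.2⟩), fun w => ⟨(w.1, w.2.1), w.2.2⟩, fun _ => rfl, fun _ => rfl⟩)
  simp only [LinearMap.mem_range, Matrix.mulVecLin_apply, Matrix.fromBlocks_mulVec]
  constructor
  · rintro ⟨v, rfl⟩
    refine ⟨v ∘ Sum.inr, ?_⟩
    ext i
    simp
  · rintro ⟨v, hv⟩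
    refine ⟨Sum.elim (⅟a *ᵥ (w ∘ Sum.inl)) v, ?_⟩
    ext (i | i)
    · simp [Matrix.mulVec_mulVec]
    · have := congrFun hv i
      simpa using this

end ImageCard

/-! ### Lifting matrices from the residue field -/

section Lifting

open Matrix IsLocalRing

variable {A A' : Type} [CommRing A] [CommRing A']

/-- `A'` is the quotient of the local ring `A` by the annihilator of a generator of the maximal
ideal, and `θ` is multiplication by this generator. -/
structure IsUniformStep (red : A →+* A') (θ : A' →+ A) [IsLocalRing A] : Prop where
  surjective : Function.Surjective red
  injective : Function.Injective θ
  mul : ∀ x a, θ x * a = θ (x * red a)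
  mem_range : ∀ a, a ∈ maximalIdeal A ↔ ∃ x, θ x = a

variable [IsLocalRing A] {red : A →+* A'} {θ : A' →+ A} (h : IsUniformStep red θ)
include h

theorem IsUniformStep.map_mul {l m n : Type} [Fintype m] (M : Matrix l m A') (N : Matrix m n A) :
    M.map θ * N = (M * N.map red).map θ := by
  ext i j
  simp [Matrix.mul_apply, map_sum, h.mul]

theorem IsUniformStep.imCard_map {m n : Type} [Fintype n] (M : Matrix m n A') :
    imCard (M.map θ) = imCard M := by
  have hm : ∀ v, M.map θ *ᵥ v = θ ∘ (M *ᵥ (red ∘ v)) := fun v => by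
    ext i
    simp [Matrix.mulVec, dotProduct, map_sum, h.mul]
  refine (Nat.card_congr (Equiv.ofBijective (fun w : LinearMap.range M.mulVecLin =>
    (⟨θ ∘ w.1, ?_⟩ : LinearMap.range (M.map θ).mulVecLin)) ⟨?_, ?_⟩)).symm
  · obtain ⟨_, v, rfl⟩ := w
    obtain ⟨u, rfl⟩ := h.surjective.comp_left v
    exact ⟨u, hm u⟩
  · intro w w' hw
    exact Subtype.ext (h.injective.comp_left (congrArg Subtype.val hw))
  · rintro ⟨_, v, rfl⟩
    exact ⟨⟨M *ᵥ (red ∘ v), red ∘ v, rfl⟩, Subtype.ext (hm v).symm⟩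

theorem IsUniformStep.residue_eq_iff (a b : A) :
    residue A a = residue A b ↔ ∃ x, a = b + θ x := by
  rw [← sub_eq_zero, ← map_sub, residue_eq_zero_iff, h.mem_range]
  exact exists_congr fun x => ⟨fun hx => by rw [hx]; ring, fun hx => by rw [hx]; ring⟩

variable [Fintype A] [Fintype A']

open scoped Classical in
theorem IsUniformStep.sum_lift {R : Type*} [CommRing R] {m n : Type} [Fintype m] [Fintype n]
    [DecidableEq m] [DecidableEq n]
    (M : Matrix m n A) (g : Matrix m n A → R) :
    ∑ X : Matrix m n A, (if X.map (residue A) = M.map (residue A) then g X else 0) =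
      ∑ Y : Matrix m n A', g (M + Y.map θ) := by
  rw [← Finset.sum_filter]
  refine (Finset.sum_bij (fun Y _ => M + Y.map θ) ?_ ?_ ?_ fun _ _ => rfl).symm
  · intro Y _
    simp only [Finset.mem_filter, Finset.mem_univ, true_and]
    ext i j
    exact (h.residue_eq_iff _ _).2 ⟨Y i j, rfl⟩
  · intro Y _ Z _ hYZ
    ext i j
    have := congrFun (congrFun hYZ i) j
    exact h.injective (add_left_cancel (a := M i j) this)
  · intro X hX
    have hX' := (Finset.mem_filter.1 hX).2
    choose Y hY using fun i j => (h.residue_eq_iff (X i j) (M i j)).1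
      (congrFun (congrFun hX' i) j)
    exact ⟨Matrix.of Y, Finset.mem_univ _, by ext i j; simp [hY]⟩

omit h [Fintype A] [Fintype A'] in
theorem isUnit_of_map_residue {m : Type} [Fintype m] [DecidableEq m] (M : Matrix m m A)
    (hM : IsUnit (M.map (residue A))) : IsUnit M := by
  rw [Matrix.isUnit_iff_isUnit_det] at hM ⊢
  have : (M.map (residue A)).det = residue A M.det := ((residue A).map_det M).symm
  rw [this] at hM
  exact isUnit_of_map_unit _ _ hM

omit [Fintype A] [Fintype A'] in
theorem IsUniformStep.isUnit_one_add {m : Type} [Fintype m] [DecidableEq m] (Y : Matrix m m A') :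
    IsUnit (1 + Y.map θ) := by
  refine isUnit_of_map_residue _ ?_
  have : (1 + Y.map θ).map (residue A) = (1 : Matrix m m A).map (residue A) := by
    ext i j
    exact (h.residue_eq_iff _ _).2 ⟨Y i j, rfl⟩
  rw [this, Matrix.map_one _ (map_zero _) (map_one _)]
  exact isUnit_one

variable {R : Type*} [CommRing R] (φ : ℕ →* R)

open scoped Classical in
omit h in
/-- The sum of `φ (imCard M)` over the lifts `M` of a matrix over the residue field. -/
def liftSum {m : Type} [Fintype m] [DecidableEq m] (N : Matrix m m (ResidueField A)) : R :=
  ∑ M : Matrix m m A, if M.map (residue A) = N then φ (imCard M) else 0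

omit h [Fintype A] [Fintype A'] in
theorem exists_lift_matrix {m n : Type} (N : Matrix m n (ResidueField A)) :
    ∃ M : Matrix m n A, M.map (residue A) = N := by
  choose M hM using fun i j => residue_surjective (N i j)
  exact ⟨Matrix.of M, by ext i j; exact hM i j⟩

omit h [Fintype A'] in
theorem liftSum_mul_mul {m : Type} [Fintype m] [DecidableEq m]
    (N P Q : Matrix m m (ResidueField A)) (hP : IsUnit P) (hQ : IsUnit Q) :
    liftSum φ (P * N * Q) = liftSum φ N := by
  obtain ⟨P', rfl⟩ := exists_lift_matrix P
  obtain ⟨Q', rfl⟩ := exists_lift_matrix Q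
  obtain ⟨p, rfl⟩ := isUnit_of_map_residue _ hP
  obtain ⟨q, rfl⟩ := isUnit_of_map_residue _ hQ
  symm
  refine Fintype.sum_equiv (p.mulLeft.trans q.mulRight) _ _ fun M => ?_
  have hM : (p.mulLeft.trans q.mulRight) M = (p : Matrix m m A) * M * (q : Matrix m m A) := rfl
  rw [hM, imCard_mul_mul M p.isUnit q.isUnit, Matrix.map_mul, Matrix.map_mul]
  congr 1
  rw [hQ.mul_left_inj, hP.mul_right_inj]

omit h [Fintype A'] in
theorem liftSum_submatrix {m n : Type} [Fintype m] [Fintype n] [DecidableEq m] [DecidableEq n]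
    (N : Matrix m m (ResidueField A)) (e : n ≃ m) :
    liftSum φ (N.submatrix e e) = liftSum φ N := by
  symm
  refine Fintype.sum_equiv (Matrix.reindex e.symm e.symm) _ _ fun M => ?_
  simp only [Matrix.reindex_apply, Equiv.symm_symm, imCard_submatrix, ← Matrix.submatrix_map]
  congr 1
  rw [(Matrix.reindex e.symm e.symm).injective.eq_iff.symm]
  rfl

/-- A block matrix as the quadruple of its blocks. -/
def fromBlocksEquiv (r d : Type) (S : Type) :
    ((Matrix r r S × Matrix r d S × Matrix d r S) × Matrix d d S) ≃
      Matrix (r ⊕ d) (r ⊕ d) S where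
  toFun p := fromBlocks p.1.1 p.1.2.1 p.1.2.2 p.2
  invFun M := ((M.toBlocks₁₁, M.toBlocks₁₂, M.toBlocks₂₁), M.toBlocks₂₂)
  left_inv _ := rfl
  right_inv M := M.fromBlocks_toBlocks

/-- Every lift has an invertible upper left block `1 + θ Y`, and its Schur complement is `θ` of a `d
× d` matrix over `A'`. The other three blocks are free, which accounts for the power of
`Fintype.card A'`. -/
theorem IsUniformStep.liftSum_fromBlocks (r d : ℕ) :
    liftSum φ (fromBlocks 1 0 0 0 : Matrix (Fin r ⊕ Fin d) (Fin r ⊕ Fin d) (ResidueField A)) =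
      (Fintype.card A' : R) ^ (r * r + r * d + d * r) * φ (Nat.card A) ^ r *
        ∑ M : Matrix (Fin d) (Fin d) A', φ (imCard M) := by
  classical
  have hX : (fromBlocks 1 0 0 0 : Matrix (Fin r ⊕ Fin d) (Fin r ⊕ Fin d) (ResidueField A)) =
      (fromBlocks 1 0 0 0 : Matrix (Fin r ⊕ Fin d) (Fin r ⊕ Fin d) A).map (residue A) := by
    rw [Matrix.fromBlocks_map, Matrix.map_one _ (map_zero _) (map_one _)]
    simp
  rw [hX, liftSum]
  have hs := h.sum_lift (fromBlocks 1 0 0 0 : Matrix (Fin r ⊕ Fin d) (Fin r ⊕ Fin d) A)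
    fun M => φ (imCard M)
  rw [← (fromBlocksEquiv (Fin r) (Fin d) A').sum_comp, Fintype.sum_prod_type] at hs
  have hin : ∀ p :
      Matrix (Fin r) (Fin r) A' × Matrix (Fin r) (Fin d) A' × Matrix (Fin d) (Fin r) A',
      ∑ D : Matrix (Fin d) (Fin d) A', φ (imCard
        ((fromBlocks 1 0 0 0 : Matrix (Fin r ⊕ Fin d) (Fin r ⊕ Fin d) A) +
          (fromBlocksEquiv (Fin r) (Fin d) A' (p, D)).map θ)) =
      φ (Nat.card A) ^ r * ∑ M : Matrix (Fin d) (Fin d) A', φ (imCard M) := by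
    intro p
    let := (h.isUnit_one_add p.1).invertible
    -- The correction term of the Schur complement is `θ` of `E`, and `E` does not depend on `D`;
    -- replacing `D` by `D - E` permutes the summation range.
    set E := p.2.2 * (⅟(1 + p.1.map θ) * p.2.1.map θ).map red with hE
    rw [← (Equiv.subRight E).sum_comp (fun M => φ (imCard M)), Finset.mul_sum]
    refine Finset.sum_congr rfl fun D _ => ?_
    have : (fromBlocks 1 0 0 0 : Matrix (Fin r ⊕ Fin d) (Fin r ⊕ Fin d) A) +
        (fromBlocksEquiv (Fin r) (Fin d) A' (p, D)).map θ =
        fromBlocks (1 + p.1.map θ) (p.2.1.map θ) (p.2.2.map θ) (D.map θ) := by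
      ext (i | i) (j | j) <;> simp <;> rfl
    rw [this, imCard_fromBlocks, Matrix.mul_assoc (p.2.2.map θ), h.map_mul, ← hE,
      show D.map θ - E.map θ = (D - E).map θ by ext i j; simp, h.imCard_map,
      _root_.map_mul, map_pow,
      Fintype.card_fin]
    rfl
  rw [Finset.sum_congr rfl fun p _ => hin p, Finset.sum_const, nsmul_eq_mul] at hs
  rw [hs, Finset.card_univ, Fintype.card_prod, Fintype.card_prod]
  have hc : ∀ a b : ℕ, Fintype.card (Matrix (Fin a) (Fin b) A') = Fintype.card A' ^ (a * b) := by
    intro a b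
    rw [show Fintype.card (Matrix (Fin a) (Fin b) A') = Fintype.card (Fin a → Fin b → A') from
      Fintype.card_congr (Equiv.refl _)]
    simp [← pow_mul, mul_comm]
  rw [hc, hc, hc]
  push_cast
  ring

/-- Summing over the lifts of a matrix of rank `r`. -/
theorem IsUniformStep.liftSum_eq {n : ℕ} (N : Matrix (Fin n) (Fin n) (ResidueField A)) :
    liftSum φ N = (Fintype.card A' : R) ^ (n ^ 2 - (n - N.rank) ^ 2) * φ (Nat.card A) ^ N.rank *
        ∑ M : Matrix (Fin (n - N.rank)) (Fin (n - N.rank)) A', φ (imCard M) := by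
  -- Invertible matrices over the residue field lift to invertible matrices over `A`, so `liftSum`
  -- depends only on the rank of `N`.
  have hnf := Matrix.exists_rank_normal_form N
  rw [Fintype.card_fin] at hnf
  obtain ⟨V, U, e, hV, hU, he⟩ := hnf
  have hr : N.rank ≤ n := N.rank_le_width
  rw [← liftSum_mul_mul φ N V U hV hU, he, liftSum_submatrix, h.liftSum_fromBlocks]
  congr 3
  obtain ⟨d, hd⟩ := Nat.exists_eq_add_of_le hr
  generalize N.rank = r at *
  subst hd
  rw [Nat.add_sub_cancel_left]
  symm
  apply Nat.sub_eq_of_eq_add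
  ring

open scoped Classical in
/-- The values of the trace are equidistributed on the lifts of a traceless nonzero matrix. -/
theorem IsUniformStep.sum_traceless_lift [IsDomain R] [CharZero R] {n : ℕ}
    (N : Matrix (Fin n) (Fin n) (ResidueField A)) (hN : N ≠ 0) (ht : N.trace = 0) :
    (Fintype.card A' : R) * ∑ M : Matrix (Fin n) (Fin n) A,
      (if M.map (residue A) = N ∧ M.trace = 0 then φ (imCard M) else 0) = liftSum φ N := by
  obtain ⟨i₀, j₀, hij⟩ : ∃ i j, N i j ≠ 0 := by
    by_contra! h0
    exact hN (by ext i j; exact h0 i j)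
  -- The sum is averaged over left multiplication by `1 + θ Y`, which preserves the residue and the
  -- image size. The trace becomes `θ (t + tr (Y * red M))`, and `Y ↦ tr (Y * red M)` is onto `A'`
  -- because `M` has a unit entry; so the trace vanishes for one in `card A'` of the `Y`.
  have hcount : ∀ M : Matrix (Fin n) (Fin n) A, M.map (residue A) = N →
      (Fintype.card A' : R) * ∑ Y : Matrix (Fin n) (Fin n) A',
        (if ((1 + Y.map θ) * M).trace = 0 then (1 : R) else 0) =
        Fintype.card (Matrix (Fin n) (Fin n) A') := by
    rintro M rfl
    obtain ⟨t, ht⟩ : ∃ t, θ t = M.trace := by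
      rw [← h.mem_range, ← residue_eq_zero_iff, ← ht]
      simp [Matrix.trace, map_sum]
    have hu : IsUnit (red (M i₀ j₀)) := by
      refine IsUnit.map red (isUnit_of_map_unit (residue A) _ (IsUnit.mk0 _ hij))
    let f : Matrix (Fin n) (Fin n) A' →+ A' :=
      { toFun := fun Y => (Y * M.map red).trace
        map_zero' := by simp
        map_add' := fun Y Z => by rw [Matrix.add_mul, Matrix.trace_add] }
    have hf : Function.Surjective f := fun x => by
      obtain ⟨u, hu⟩ := hu
      refine ⟨Matrix.single j₀ i₀ (x * ↑u⁻¹), ?_⟩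
      change (Matrix.single j₀ i₀ (x * ↑u⁻¹) * M.map red).trace = x
      rw [Matrix.trace_single_mul]
      simp [← hu]
    have htr : ∀ Y : Matrix (Fin n) (Fin n) A', ((1 + Y.map θ) * M).trace = 0 ↔ f Y = -t := by
      intro Y
      have : ((1 + Y.map θ) * M).trace = θ (t + f Y) := by
        rw [Matrix.add_mul, Matrix.trace_add, one_mul, h.map_mul, map_add, ht]
        congr 1
        exact (AddMonoidHom.map_trace θ (Y * M.map red)).symm
      rw [this, map_eq_zero_iff θ h.injective, add_comm, eq_neg_iff_add_eq_zero]
    simp only [htr]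
    have hfib : ∀ x : A', (Finset.univ.filter fun Y => f Y = x).card =
        (Finset.univ.filter fun Y => f Y = -t).card := fun x =>
      AddMonoidHom.card_fiber_eq_of_mem_range f (hf x) (hf _)
    have := Finset.card_eq_sum_card_fiberwise (f := f) (s := Finset.univ) (t := Finset.univ)
      (by simp)
    rw [Finset.sum_congr rfl fun x _ => hfib x, Finset.sum_const, smul_eq_mul, Finset.card_univ,
      Finset.card_univ] at this
    rw [Finset.sum_boole, this]
    push_cast
    rfl
  have hY : ∀ Y : Matrix (Fin n) (Fin n) A', ∑ M : Matrix (Fin n) (Fin n) A,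
      (if M.map (residue A) = N ∧ M.trace = 0 then φ (imCard M) else 0) =
      ∑ M : Matrix (Fin n) (Fin n) A,
      (if M.map (residue A) = N ∧ ((1 + Y.map θ) * M).trace = 0 then φ (imCard M) else 0) := by
    intro Y
    obtain ⟨u, hu⟩ := h.isUnit_one_add Y
    refine (Fintype.sum_equiv u.mulLeft _ _ fun M => ?_).symm
    have h1 : (u * M : Matrix (Fin n) (Fin n) A).map (residue A) = M.map (residue A) := by
      rw [hu, Matrix.add_mul, one_mul, h.map_mul]
      ext i j
      exact (h.residue_eq_iff _ _).2 ⟨_, rfl⟩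
    have h2 : imCard (u * M : Matrix (Fin n) (Fin n) A) = imCard M := by
      rw [← imCard_mul_mul M u.isUnit isUnit_one, mul_one]
    rw [Units.mulLeft_apply, h1, h2, hu]
  have hcard : (Fintype.card (Matrix (Fin n) (Fin n) A') : R) ≠ 0 := by
    exact_mod_cast Fintype.card_ne_zero
  apply mul_left_cancel₀ hcard
  have hsum := Finset.sum_congr rfl fun Y (_ : Y ∈ Finset.univ) => hY Y
  rw [Finset.sum_const, Finset.card_univ, nsmul_eq_mul, Finset.sum_comm] at hsum
  rw [mul_left_comm, hsum, Finset.mul_sum, liftSum, Finset.mul_sum]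
  refine Finset.sum_congr rfl fun M _ => ?_
  split_ifs with hM
  · rw [← hcount M hM, mul_assoc, Finset.sum_mul]
    congr 1
    refine Finset.sum_congr rfl fun Y _ => ?_
    simp [hM]
  · simp [hM]

end Lifting
end

/-! ### One-step recursions for sums over matrices -/

noncomputable section

section UniformStepSums

open Matrix IsLocalRing

/-- The sum of `φ (imCard M)` over all square matrices of size `m`. -/
def sumImCard (A : Type) [CommRing A] [Fintype A] {R : Type*} [CommRing R] (φ : ℕ →* R) (m : ℕ) :
    R :=
  ∑ M : Matrix (Fin m) (Fin m) A, φ (imCard M)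

open scoped Classical in
/-- The sum of `φ (imCard M)` over the traceless `n × n` matrices that are nonzero over the residue
field. -/
def sumPrimitive (A : Type) [CommRing A] [IsLocalRing A] [Fintype A] {R : Type*} [CommRing R]
    (φ : ℕ →* R) (n : ℕ) : R :=
  ∑ M : Matrix (Fin n) (Fin n) A,
    if M.trace = 0 ∧ M.map (residue A) ≠ 0 then φ (imCard M) else 0

theorem sum_by_rank {F : Type} [Field F] [Fintype F] {n : ℕ} (P : Matrix (Fin n) (Fin n) F → Prop)
    [DecidablePred P] [DecidableEq F] {R : Type*} [CommRing R] (f : ℕ → R) :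
    ∑ N : Matrix (Fin n) (Fin n) F, (if P N then f N.rank else 0) =
      ∑ r ∈ Finset.range (n + 1),
        (∑ N : Matrix (Fin n) (Fin n) F, if N.rank = r ∧ P N then 1 else 0) * f r := by
  simp only [Finset.sum_mul]
  rw [Finset.sum_comm]
  refine Finset.sum_congr rfl fun N _ => ?_
  have : N.rank ∈ Finset.range (n + 1) := Finset.mem_range.2 (Nat.lt_succ_of_le N.rank_le_width)
  simp only [ite_and, ite_mul, one_mul, zero_mul]
  rw [Finset.sum_ite_eq, if_pos this]

variable {A A' : Type} [CommRing A] [CommRing A'] [IsLocalRing A] {red : A →+* A'} {θ : A' →+ A}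
  (h : IsUniformStep red θ) [Fintype A] [Fintype A'] [Fintype (ResidueField A)]
  {R : Type*} [CommRing R] (φ : ℕ →* R)
include h

theorem IsUniformStep.sumImCard_eq (m : ℕ) :
    sumImCard A φ m = ∑ r ∈ Finset.range (m + 1),
      rankCount (Fintype.card (ResidueField A) : R) m m r *
        ((Fintype.card A' : R) ^ (m ^ 2 - (m - r) ^ 2) * φ (Nat.card A) ^ r *
          sumImCard A' φ (m - r)) := by
  classical
  have h1 : sumImCard A φ m = ∑ N : Matrix (Fin m) (Fin m) (ResidueField A), liftSum φ N := by
    simp only [liftSum]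
    rw [Finset.sum_comm]
    simp [sumImCard]
  rw [h1, Finset.sum_congr rfl fun N _ => h.liftSum_eq φ N]
  have := sum_by_rank (R := R) (fun _ : Matrix (Fin m) (Fin m) (ResidueField A) => True)
    (fun r => (Fintype.card A' : R) ^ (m ^ 2 - (m - r) ^ 2) * φ (Nat.card A) ^ r *
          sumImCard A' φ (m - r))
  simp only [if_true, and_true] at this
  refine this.trans (Finset.sum_congr rfl fun r _ => ?_)
  rw [← sum_rank_eq_rankCount (F := ResidueField A)]

/-- Primitivity removes the rank `0` term. The factor `card A'` on the left is the cost of the trace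
condition on lifts, and the residue field factor matches the normalization of `tracelessCount`. -/
theorem IsUniformStep.sumPrimitive_eq [IsDomain R] [CharZero R] (n : ℕ) :
    (Fintype.card (ResidueField A) : R) * (Fintype.card A' : R) * sumPrimitive A φ n =
      ∑ r ∈ Finset.range n,
      tracelessCount (Fintype.card (ResidueField A) : R) n (r + 1) *
        ((Fintype.card A' : R) ^ (n ^ 2 - (n - (r + 1)) ^ 2) * φ (Nat.card A) ^ (r + 1) *
          sumImCard A' φ (n - (r + 1))) := by
  classical
  have h1 : (Fintype.card A' : R) * sumPrimitive A φ n =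
      ∑ N : Matrix (Fin n) (Fin n) (ResidueField A),
        if N.trace = 0 ∧ N ≠ 0 then liftSum φ N else 0 := by
    have : ∀ N : Matrix (Fin n) (Fin n) (ResidueField A),
        (if N.trace = 0 ∧ N ≠ 0 then liftSum φ N else 0) = (Fintype.card A' : R) *
        ∑ M : Matrix (Fin n) (Fin n) A, if N = M.map (residue A) then
          (if M.trace = 0 ∧ M.map (residue A) ≠ 0 then φ (imCard M) else 0) else 0 := by
      intro N
      split_ifs with hN
      · rw [← h.sum_traceless_lift φ N hN.2 hN.1]
        congr 1
        refine Finset.sum_congr rfl fun M _ => ?_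
        by_cases h1 : N = M.map (residue A)
        · by_cases h2 : M.trace = 0 <;> simp [← h1, h2, hN.2]
        · simp [h1, Ne.symm h1]
      · rw [Finset.sum_eq_zero, mul_zero]
        intro M _
        split_ifs with h1 h2
        · refine absurd ⟨?_, h1 ▸ h2.2⟩ hN
          have := congrArg (residue A) h2.1
          rw [map_zero] at this
          rw [h1, ← this]
          exact (AddMonoidHom.map_trace (residue A).toAddMonoidHom M).symm
        · rfl
        · rfl
    rw [Finset.sum_congr rfl fun N _ => this N, ← Finset.mul_sum, Finset.sum_comm]
    simp [sumPrimitive]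
  have := sum_by_rank (R := R) (fun N : Matrix (Fin n) (Fin n) (ResidueField A) =>
      N.trace = 0 ∧ N ≠ 0)
    (fun r => (Fintype.card A' : R) ^ (n ^ 2 - (n - r) ^ 2) * φ (Nat.card A) ^ r *
          sumImCard A' φ (n - r))
  rw [mul_assoc, h1, Finset.sum_congr rfl fun N _ => by rw [h.liftSum_eq φ N]]
  refine (congrArg _ this).trans ?_
  rw [Finset.mul_sum, Finset.sum_range_succ']
  have h0 : ∑ N : Matrix (Fin n) (Fin n) (ResidueField A),
      (if N.rank = 0 ∧ N.trace = 0 ∧ N ≠ 0 then (1 : R) else 0) = 0 := by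
    refine Finset.sum_eq_zero fun N _ => if_neg ?_
    rintro ⟨h1, -, h2⟩
    rw [Matrix.rank_eq_finrank_span_cols, Submodule.finrank_eq_zero, Submodule.span_eq_bot] at h1
    exact h2 (by ext i j; exact congrFun (h1 _ ⟨j, rfl⟩) i)
  rw [h0, zero_mul, mul_zero, add_zero]
  refine Finset.sum_congr rfl fun r _ => ?_
  rw [← sum_rank_traceless (F := ResidueField A), ← mul_assoc]
  congr 2
  refine Finset.sum_congr (by congr!) fun N _ => ?_
  have : N.rank = r + 1 → N ≠ 0 := by rintro h1 rfl; simp at h1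
  by_cases h1 : N.rank = r + 1 <;> by_cases h2 : N.trace = 0 <;> simp [h1, h2, this]

end UniformStepSums

/-! ### Quotients of a discrete valuation ring -/

section DVR

open IsLocalRing

variable (𝔬 : Type) [CommRing 𝔬] [IsDomain 𝔬] [IsDiscreteValuationRing 𝔬]

/-- The quotient of a discrete valuation ring by a power of the maximal ideal. -/
abbrev LevelRing (L : ℕ) : Type := 𝔬 ⧸ maximalIdeal 𝔬 ^ L

theorem card_levelRing (L : ℕ) : Nat.card (LevelRing 𝔬 L) = Nat.card (ResidueField 𝔬) ^ L :=
  cardQuot_pow_of_prime (IsDiscreteValuationRing.not_a_field 𝔬)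

instance finite_levelRing [Finite (ResidueField 𝔬)] (L : ℕ) : Finite (LevelRing 𝔬 L) :=
  Nat.finite_of_card_ne_zero (by
    rw [card_levelRing]; exact pow_ne_zero _ Nat.card_pos.ne')

instance fintype_levelRing [Finite (ResidueField 𝔬)] (L : ℕ) : Fintype (LevelRing 𝔬 L) :=
  Fintype.ofFinite _

instance nontrivial_levelRing (L : ℕ) : Nontrivial (LevelRing 𝔬 (L + 1)) :=
  Ideal.Quotient.nontrivial_iff.2 (ne_top_of_le_ne_top (Ideal.IsPrime.ne_top inferInstance)
    (Ideal.pow_le_self L.succ_ne_zero))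

instance isLocalRing_levelRing (L : ℕ) : IsLocalRing (LevelRing 𝔬 (L + 1)) :=
  IsLocalRing.of_surjective' (Ideal.Quotient.mk _) Ideal.Quotient.mk_surjective

theorem mk_mem_maximalIdeal (L : ℕ) (x : 𝔬) :
    Ideal.Quotient.mk (maximalIdeal 𝔬 ^ (L + 1)) x ∈ maximalIdeal (LevelRing 𝔬 (L + 1)) ↔
      x ∈ maximalIdeal 𝔬 := by
  have : IsLocalHom (Ideal.Quotient.mk (maximalIdeal 𝔬 ^ (L + 1))) :=
    IsLocalHom.of_surjective _ Ideal.Quotient.mk_surjective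
  exact map_mem_nonunits_iff _ x

theorem card_residueField_levelRing (L : ℕ) :
    Nat.card (ResidueField (LevelRing 𝔬 (L + 1))) = Nat.card (ResidueField 𝔬) := by
  set f : 𝔬 →+* ResidueField (LevelRing 𝔬 (L + 1)) :=
    (residue _).comp (Ideal.Quotient.mk (maximalIdeal 𝔬 ^ (L + 1))) with hf
  have hs : Function.Surjective f := residue_surjective.comp Ideal.Quotient.mk_surjective
  have hk : RingHom.ker f = maximalIdeal 𝔬 := by
    ext x
    rw [RingHom.mem_ker, hf, RingHom.comp_apply, residue_eq_zero_iff, mk_mem_maximalIdeal]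
  exact Nat.card_congr ((RingHom.quotientKerEquivOfSurjective hs).symm.trans
    (Ideal.quotEquivOfEq hk)).toEquiv

/-- Reduction between the quotients of a discrete valuation ring. -/
def levelRed (L : ℕ) : LevelRing 𝔬 (L + 1) →+* LevelRing 𝔬 L :=
  Ideal.Quotient.factor (Ideal.pow_le_pow_right L.le_succ)

/-- Multiplication by a uniformizer descends to an injection of `𝔬/𝔪^L` into `𝔬/𝔪^(L+1)` with image
the maximal ideal. For `L = 0` the source is the zero ring. -/
theorem exists_isUniformStep (L : ℕ) :
    ∃ θ : LevelRing 𝔬 L →+ LevelRing 𝔬 (L + 1), IsUniformStep (levelRed 𝔬 L) θ := by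
  obtain ⟨π, hπ⟩ := IsDiscreteValuationRing.exists_irreducible 𝔬
  have hm : maximalIdeal 𝔬 = Ideal.span {π} := hπ.maximalIdeal_eq
  have hmem : ∀ k x, x ∈ maximalIdeal 𝔬 ^ k ↔ π ^ k ∣ x := fun k x => by
    rw [hm, Ideal.span_singleton_pow, Ideal.mem_span_singleton]
  let θ := ((maximalIdeal 𝔬 ^ L).mapQ (maximalIdeal 𝔬 ^ (L + 1)) (LinearMap.mulLeft 𝔬 π)
    (fun x hx => by
      rw [Submodule.mem_comap, LinearMap.mulLeft_apply, hmem, pow_succ']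
      exact mul_dvd_mul_left _ ((hmem _ _).1 hx))).toAddMonoidHom
  have hθ : ∀ x : 𝔬, θ (Ideal.Quotient.mk _ x) = Ideal.Quotient.mk _ (π * x) := fun x => rfl
  refine ⟨θ, ⟨Ideal.Quotient.factor_surjective _, ?_, ?_, ?_⟩⟩
  · refine (injective_iff_map_eq_zero θ).2 fun x hx => ?_
    obtain ⟨x, rfl⟩ := Ideal.Quotient.mk_surjective x
    rw [hθ, Ideal.Quotient.eq_zero_iff_mem, hmem, pow_succ',
      mul_dvd_mul_iff_left hπ.ne_zero] at hx
    rwa [Ideal.Quotient.eq_zero_iff_mem, hmem]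
  · intro x a
    obtain ⟨x, rfl⟩ := Ideal.Quotient.mk_surjective x
    obtain ⟨a, rfl⟩ := Ideal.Quotient.mk_surjective a
    change _ = θ (_ * Ideal.Quotient.mk _ a)
    rw [← map_mul, hθ, hθ, ← map_mul, mul_assoc]
  · intro a
    obtain ⟨a, rfl⟩ := Ideal.Quotient.mk_surjective a
    have hm1 := hmem 1 a
    rw [pow_one, pow_one] at hm1
    rw [mk_mem_maximalIdeal, hm1]
    constructor
    · rintro ⟨x, rfl⟩
      exact ⟨Ideal.Quotient.mk _ x, hθ x⟩
    · rintro ⟨x, hx⟩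
      obtain ⟨x, rfl⟩ := Ideal.Quotient.mk_surjective x
      rw [hθ, Ideal.Quotient.eq, hmem] at hx
      have := (dvd_pow_self π L.succ_ne_zero).trans hx
      exact (dvd_sub_right (dvd_mul_right π x)).1 this

end DVR
end

/-! ### Generating functions over all levels and their convergence -/

noncomputable section

section LevelSums

open IsLocalRing

variable (𝔬 : Type) [CommRing 𝔬] [IsDomain 𝔬] [IsDiscreteValuationRing 𝔬]
  [Finite (ResidueField 𝔬)] (φ : ℕ →* ℂ)

/-- The cardinality of the residue field. -/
abbrev resCard : ℕ := Nat.card (ResidueField 𝔬)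

theorem one_lt_resCard : 1 < resCard 𝔬 := Finite.one_lt_card

theorem fintype_card_levelRing (L : ℕ) : Fintype.card (LevelRing 𝔬 L) = resCard 𝔬 ^ L := by
  rw [← Nat.card_eq_fintype_card, card_levelRing]

theorem sumImCard_levelRing_zero (m : ℕ) : sumImCard (LevelRing 𝔬 0) φ m = 1 := by
  have hs : Subsingleton (LevelRing 𝔬 0) :=
    (Nat.card_eq_one_iff_unique.1 (by rw [card_levelRing, pow_zero])).1
  have h1 : ∀ M : Matrix (Fin m) (Fin m) (LevelRing 𝔬 0), imCard M = 1 := fun M =>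
    Nat.card_unique
  simp only [sumImCard, h1, map_one, Finset.sum_const, nsmul_eq_mul, mul_one]
  have : Fintype.card (Matrix (Fin m) (Fin m) (LevelRing 𝔬 0)) = 1 :=
    Fintype.card_eq_one_iff_nonempty_unique.2 ⟨⟨⟨0⟩, fun _ => Subsingleton.elim _ _⟩⟩
  rw [Finset.card_univ, this, Nat.cast_one]

theorem sumImCard_levelRing_succ (m L : ℕ) :
    sumImCard (LevelRing 𝔬 (L + 1)) φ m = ∑ r ∈ Finset.range (m + 1),
      rankCount (resCard 𝔬 : ℂ) m m r *
        (((resCard 𝔬 : ℂ) ^ L) ^ (m ^ 2 - (m - r) ^ 2) * (φ (resCard 𝔬) ^ (L + 1)) ^ r *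
          sumImCard (LevelRing 𝔬 L) φ (m - r)) := by
  obtain ⟨θ, hθ⟩ := exists_isUniformStep 𝔬 L
  have : Finite (ResidueField (LevelRing 𝔬 (L + 1))) := Finite.of_surjective _ residue_surjective
  let _ : Fintype (ResidueField (LevelRing 𝔬 (L + 1))) := Fintype.ofFinite _
  rw [hθ.sumImCard_eq φ m]
  rw [← Nat.card_eq_fintype_card, card_residueField_levelRing, fintype_card_levelRing,
    card_levelRing, map_pow, Nat.cast_pow]

theorem sumPrimitive_levelRing_succ (n L : ℕ) :
    (resCard 𝔬 : ℂ) * (resCard 𝔬 : ℂ) ^ L * sumPrimitive (LevelRing 𝔬 (L + 1)) φ n =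
      ∑ r ∈ Finset.range n, tracelessCount (resCard 𝔬 : ℂ) n (r + 1) *
        (((resCard 𝔬 : ℂ) ^ L) ^ (n ^ 2 - (n - (r + 1)) ^ 2) *
          (φ (resCard 𝔬) ^ (L + 1)) ^ (r + 1) *
          sumImCard (LevelRing 𝔬 L) φ (n - (r + 1))) := by
  obtain ⟨θ, hθ⟩ := exists_isUniformStep 𝔬 L
  have : Finite (ResidueField (LevelRing 𝔬 (L + 1))) := Finite.of_surjective _ residue_surjective
  let _ : Fintype (ResidueField (LevelRing 𝔬 (L + 1))) := Fintype.ofFinite _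
  have := hθ.sumPrimitive_eq φ n
  rwa [← Nat.card_eq_fintype_card, card_residueField_levelRing, fintype_card_levelRing,
    card_levelRing, map_pow, Nat.cast_pow] at this

theorem card_matrix_levelRing (m L : ℕ) :
    Fintype.card (Matrix (Fin m) (Fin m) (LevelRing 𝔬 L)) = (resCard 𝔬 ^ m ^ 2) ^ L := by
  rw [show Fintype.card (Matrix (Fin m) (Fin m) (LevelRing 𝔬 L)) =
    Fintype.card (Fin m → Fin m → LevelRing 𝔬 L) from Fintype.card_congr (Equiv.refl _)]
  simp only [Fintype.card_pi, Finset.prod_const, Finset.card_univ, Fintype.card_fin,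
    fintype_card_levelRing, ← pow_mul]
  congr 1
  ring

theorem imCard_pos {A : Type} [CommRing A] [Finite A] {m n : Type} [Fintype n] [Finite m]
    (M : Matrix m n A) : 0 < imCard M := Nat.card_pos

variable {φ}

theorem norm_sumImCard_le (hφ : ∀ k ≠ 0, ‖φ k‖ ≤ 1) (m L : ℕ) :
    ‖sumImCard (LevelRing 𝔬 L) φ m‖ ≤ ((resCard 𝔬 : ℝ) ^ m ^ 2) ^ L := by
  have h := norm_sum_le_of_le (f := fun M : Matrix (Fin m) (Fin m) (LevelRing 𝔬 L) =>
    φ (imCard M)) Finset.univ (fun M _ => hφ _ (imCard_pos M).ne')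
  refine h.trans (le_of_eq ?_)
  rw [Finset.sum_const, Finset.card_univ, card_matrix_levelRing]
  simp

theorem summable_level (hφ : ∀ k ≠ 0, ‖φ k‖ ≤ 1) (m : ℕ) (t : ℂ)
    (ht : ‖t‖ * (resCard 𝔬 : ℝ) ^ m ^ 2 < 1) :
    Summable fun L => t ^ L * sumImCard (LevelRing 𝔬 L) φ m := by
  refine Summable.of_norm_bounded
    (summable_geometric_of_lt_one (by positivity) ht) fun L => ?_
  rw [norm_mul, norm_pow, mul_pow]
  gcongr
  exact norm_sumImCard_le 𝔬 hφ m L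

variable (n : ℕ) (hφ : ∀ k ≠ 0, ‖φ k‖ ≤ 1)
  (hy : ‖φ (resCard 𝔬)‖ * (resCard 𝔬 : ℝ) ^ n ^ 2 ≤ 1)
include hφ hy

-- The powers of `q` combine to `q ^ (n ^ 2 - 1) * ‖y‖ ^ (n - m)`, which is at most `q ^ (n ^ 2 - 1)
-- * ‖y‖ < 1`. This is what convergence requires under the trivial bound `q ^ (m ^ 2 * L)` on the
-- level sums.
omit hφ in
theorem norm_levelRatio_lt (m : ℕ) (hm : m < n) :
    ‖levelRatio n (resCard 𝔬 : ℂ) (φ (resCard 𝔬)) m‖ * (resCard 𝔬 : ℝ) ^ m ^ 2 < 1 := by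
  have hq : (1 : ℝ) < resCard 𝔬 := by exact_mod_cast one_lt_resCard 𝔬
  have hnm : m ^ 2 < n ^ 2 := Nat.pow_lt_pow_left hm two_ne_zero
  have hy' : ‖φ (resCard 𝔬)‖ ≤ 1 := by
    refine le_trans (le_mul_of_one_le_right (norm_nonneg _) (one_le_pow₀ hq.le)) hy
  rw [levelRatio, norm_mul, norm_pow, norm_pow, Complex.norm_natCast]
  calc (resCard 𝔬 : ℝ) ^ (n ^ 2 - 1 - m ^ 2) * ‖φ (resCard 𝔬)‖ ^ (n - m) * (resCard 𝔬 : ℝ) ^ m ^ 2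
      = (resCard 𝔬 : ℝ) ^ (n ^ 2 - 1) * ‖φ (resCard 𝔬)‖ ^ (n - m) := by
        rw [mul_right_comm, ← pow_add, Nat.sub_add_cancel (Nat.le_sub_one_of_lt hnm)]
    _ ≤ (resCard 𝔬 : ℝ) ^ (n ^ 2 - 1) * ‖φ (resCard 𝔬)‖ := by
        gcongr
        exact pow_le_of_le_one (norm_nonneg _) hy' (by omega)
    _ < 1 := by
        by_cases h0 : ‖φ (resCard 𝔬)‖ = 0
        · rw [h0, mul_zero]; exact one_pos
        · refine lt_of_lt_of_le ?_ hy
          rw [mul_comm]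
          have hlt : n ^ 2 - 1 < n ^ 2 := by omega
          have : 0 < ‖φ (resCard 𝔬)‖ := lt_of_le_of_ne (norm_nonneg _) (Ne.symm h0)
          exact mul_lt_mul_of_pos_left (pow_lt_pow_right₀ hq hlt) this

/-- The generating functions of the level sums, at the points needed. -/
def levelSeries (m : ℕ) : ℂ :=
  ∑' L, levelRatio n (resCard 𝔬 : ℂ) (φ (resCard 𝔬)) m ^ L * sumImCard (LevelRing 𝔬 L) φ m

-- The reason for the shape of `levelRatio`: the weight gained per level on dropping from size `m`
-- to `m - r` turns the ratio of size `m` into that of size `m - r`, so the recursion closes on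
-- `levelSeries`.
omit [Finite (ResidueField 𝔬)] hφ hy in
theorem levelRatio_mul_pow (x y : ℂ) (m r : ℕ) (hm : m < n) (hr : r ≤ m) :
    levelRatio n x y m * x ^ (m ^ 2 - (m - r) ^ 2) * y ^ r = levelRatio n x y (m - r) := by
  have hnm : m ^ 2 < n ^ 2 := Nat.pow_lt_pow_left hm two_ne_zero
  have hmr : (m - r) ^ 2 ≤ m ^ 2 := Nat.pow_le_pow_left (Nat.sub_le _ _) 2
  rw [levelRatio, levelRatio, mul_right_comm (x ^ _), ← pow_add, mul_assoc, ← pow_add]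
  congr 2 <;> omega

theorem isLevelSum_levelSeries :
    IsLevelSum n (resCard 𝔬 : ℂ) (φ (resCard 𝔬)) (levelSeries (φ := φ) 𝔬 n) := by
  intro m hm
  set x : ℂ := (resCard 𝔬 : ℂ)
  set y : ℂ := φ (resCard 𝔬)
  have hsum := fun m hm => summable_level 𝔬 hφ m _ (norm_levelRatio_lt 𝔬 n hy m hm)
  have h1 : levelSeries (φ := φ) 𝔬 n m = 1 + ∑ r ∈ Finset.range (m + 1),
      rankCount x m m r * y ^ r * levelRatio n x y m * levelSeries (φ := φ) 𝔬 n (m - r) := by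
    rw [levelSeries, (hsum m hm).tsum_eq_zero_add, pow_zero, sumImCard_levelRing_zero, mul_one]
    congr 1
    have hterm : ∀ L, levelRatio n x y m ^ (L + 1) * sumImCard (LevelRing 𝔬 (L + 1)) φ m =
        ∑ r ∈ Finset.range (m + 1), rankCount x m m r * y ^ r * levelRatio n x y m *
          (levelRatio n x y (m - r) ^ L * sumImCard (LevelRing 𝔬 L) φ (m - r)) := by
      intro L
      rw [sumImCard_levelRing_succ, Finset.mul_sum]
      refine Finset.sum_congr rfl fun r hr => ?_
      rw [← levelRatio_mul_pow n x y m r hm (by have := Finset.mem_range.1 hr; omega)]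
      ring
    rw [tsum_congr hterm, Summable.tsum_finsetSum]
    · exact Finset.sum_congr rfl fun r _ => tsum_mul_left
    · intro r _
      exact (hsum (m - r) (by omega)).mul_left _
  rw [Finset.sum_range_succ', rankCount_zero_right] at h1
  simp only [pow_zero, Nat.sub_zero, mul_one, one_mul] at h1
  linear_combination h1

theorem isZetaValue_levelSeries :
    IsZetaValue n (resCard 𝔬 : ℂ) (φ (resCard 𝔬)) (levelSeries (φ := φ) 𝔬 n)
      (1 + ∑' L, sumPrimitive (LevelRing 𝔬 (L + 1)) φ n) := by
  set x : ℂ := (resCard 𝔬 : ℂ) with hx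
  set y : ℂ := φ (resCard 𝔬) with hy'
  have hx0 : x ≠ 0 := by
    have := one_lt_resCard 𝔬
    exact Nat.cast_ne_zero.2 (by omega)
  have hsum := fun m hm => summable_level 𝔬 hφ m _ (norm_levelRatio_lt 𝔬 n hy m hm)
  rw [IsZetaValue, add_sub_cancel_left, ← tsum_mul_left]
  have hterm : ∀ L, x * sumPrimitive (LevelRing 𝔬 (L + 1)) φ n =
      ∑ r ∈ Finset.range n, tracelessCount x n (r + 1) * y ^ (r + 1) *
          (levelRatio n x y (n - (r + 1)) ^ L * sumImCard (LevelRing 𝔬 L) φ (n - (r + 1))) := by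
    intro L
    apply mul_left_cancel₀ (pow_ne_zero L hx0)
    rw [← mul_assoc, mul_comm (x ^ L), sumPrimitive_levelRing_succ, Finset.mul_sum]
    refine Finset.sum_congr rfl fun r hr => ?_
    have hr := Finset.mem_range.1 hr
    have hlt : (n - (r + 1)) ^ 2 < n ^ 2 := Nat.pow_lt_pow_left (by omega) two_ne_zero
    -- The split-off `x`, raised to the power `L`, cancels the `x ^ L` lost to the trace condition;
    -- this is the origin of the `- 1` in the exponent of `levelRatio`.
    have : x ^ (n ^ 2 - (n - (r + 1)) ^ 2) = x * x ^ (n ^ 2 - 1 - (n - (r + 1)) ^ 2) := by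
      rw [← pow_succ']; congr 1; omega
    rw [levelRatio, Nat.sub_sub_self (show r + 1 ≤ n from hr), ← hx, ← hy', ← pow_mul x L,
      mul_comm L,
      pow_mul x, this, ← pow_mul y (L + 1), mul_comm (L + 1), pow_mul y]
    ring
  rw [tsum_congr hterm, Summable.tsum_finsetSum]
  · exact Finset.sum_congr rfl fun r _ => tsum_mul_left
  · intro r hr
    have hr := Finset.mem_range.1 hr
    exact (hsum _ (by omega)).mul_left _

-- A unit entry in row `i` makes the `i`-th coordinate map the image onto `A`.
omit [Finite (ResidueField 𝔬)] hφ hy in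
theorem card_le_imCard {A : Type} [CommRing A] [IsLocalRing A] [Finite A] {m : Type} [Fintype m]
    (M : Matrix m m A) (hM : M.map (residue A) ≠ 0) : Nat.card A ≤ imCard M := by
  classical
  obtain ⟨i, j, hij⟩ : ∃ i j, residue A (M i j) ≠ 0 := by
    by_contra! h0
    exact hM (by ext i j; exact h0 i j)
  have hu : IsUnit (M i j) := isUnit_of_map_unit (residue A) _ (IsUnit.mk0 _ hij)
  refine Nat.card_le_card_of_surjective
    (fun w : LinearMap.range M.mulVecLin => w.1 i) fun x => ?_
  obtain ⟨u, hu⟩ := hu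
  refine ⟨⟨_, Pi.single j (↑u⁻¹ * x), rfl⟩, ?_⟩
  simp [← hu]

omit hφ hy in
/-- Primitive traceless matrices over the quotients of `𝔬` by positive powers of the maximal
ideal. -/
abbrev PrimitiveMatrix : Type :=
  Σ L : ℕ, {M : Matrix (Fin n) (Fin n) (LevelRing 𝔬 (L + 1)) //
    M.trace = 0 ∧ M.map (residue (LevelRing 𝔬 (L + 1))) ≠ 0}

omit hφ hy in
theorem summable_primitiveMatrix (hanti : ∀ j k, 0 < j → j ≤ k → ‖φ k‖ ≤ ‖φ j‖)
    (hy' : ‖φ (resCard 𝔬)‖ * (resCard 𝔬 : ℝ) ^ n ^ 2 < 1) :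
    Summable fun p : PrimitiveMatrix 𝔬 n => ‖φ (imCard p.2.1)‖ := by
  classical
  rw [summable_sigma_of_nonneg fun _ => norm_nonneg _]
  refine ⟨fun L => Summable.of_finite, ?_⟩
  refine Summable.of_nonneg_of_le (fun L => tsum_nonneg fun _ => norm_nonneg _) (fun L => ?_)
    ((summable_nat_add_iff 1).2 (summable_geometric_of_lt_one (by positivity) hy'))
  rw [tsum_fintype]
  have hb : ∀ M : {M : Matrix (Fin n) (Fin n) (LevelRing 𝔬 (L + 1)) //
      M.trace = 0 ∧ M.map (residue (LevelRing 𝔬 (L + 1))) ≠ 0},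
      ‖φ (imCard M.1)‖ ≤ ‖φ (resCard 𝔬)‖ ^ (L + 1) := fun M => by
    rw [← norm_pow, ← map_pow, ← card_levelRing]
    exact hanti _ _ Nat.card_pos (card_le_imCard M.1 M.2.2)
  refine (Finset.sum_le_sum fun M _ => hb M).trans ?_
  rw [Finset.sum_const, nsmul_eq_mul, mul_comm, mul_pow, Finset.card_univ]
  have := Fintype.card_subtype_le (fun M : Matrix (Fin n) (Fin n) (LevelRing 𝔬 (L + 1)) =>
    M.trace = 0 ∧ M.map (residue (LevelRing 𝔬 (L + 1))) ≠ 0)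
  rw [card_matrix_levelRing] at this
  gcongr
  exact_mod_cast this

omit hφ hy in
theorem hasSum_primitiveMatrix
    (hs : Summable fun p : PrimitiveMatrix 𝔬 n => ‖φ (imCard p.2.1)‖) :
    HasSum (fun p : PrimitiveMatrix 𝔬 n => φ (imCard p.2.1))
      (∑' L, sumPrimitive (LevelRing 𝔬 (L + 1)) φ n) := by
  classical
  have h := hs.of_norm
  have : ∀ L, HasSum (fun M : {M : Matrix (Fin n) (Fin n) (LevelRing 𝔬 (L + 1)) //
      M.trace = 0 ∧ M.map (residue (LevelRing 𝔬 (L + 1))) ≠ 0} => φ (imCard M.1))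
      (sumPrimitive (LevelRing 𝔬 (L + 1)) φ n) := fun L => by
    have h3 := hasSum_fintype (fun M : {M : Matrix (Fin n) (Fin n) (LevelRing 𝔬 (L + 1)) //
      M.trace = 0 ∧ M.map (residue (LevelRing 𝔬 (L + 1))) ≠ 0} => φ (imCard M.1))
    rwa [← Finset.sum_subtype (Finset.univ.filter fun M : Matrix (Fin n) (Fin n)
      (LevelRing 𝔬 (L + 1)) => M.trace = 0 ∧ M.map (residue (LevelRing 𝔬 (L + 1))) ≠ 0)
      (by simp) (fun M => φ (imCard M)), Finset.sum_filter] at h3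
  have h2 := HasSum.sigma h.hasSum this
  rw [h2.tsum_eq]
  exact h.hasSum

end LevelSums
end

/-! ### Characters of the centre and their pairings -/

noncomputable section

section Characters

variable {n : ℕ} {R : Type} [CommRing R]

/-- The radical of the pairing given by a character of the centre. -/
def charRad (l : AddChar (KCentre n R) ℂ) : AddSubgroup (Fin n → R) where
  carrier := {b | ∀ a, l (kPair a b) = 1}
  zero_mem' a := by rw [KGroup.kPair_zero_right, AddChar.map_zero_eq_one]
  add_mem' hb hb' a := by
    rw [KGroup.kPair_add_right, AddChar.map_add_eq_mul, hb a, hb' a, one_mul]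
  neg_mem' hb a := by rw [KGroup.kPair_neg_right, ← KGroup.kPair_neg_left]; exact hb (-a)

theorem mem_charRad {l : AddChar (KCentre n R) ℂ} {b : Fin n → R} :
    b ∈ charRad l ↔ ∀ a, l (kPair a b) = 1 := Iff.rfl

/-- The dimension of the representations with a given central character. -/
def charDim (l : AddChar (KCentre n R) ℂ) : ℕ := Nat.card ((Fin n → R) ⧸ charRad l)

/-- The pairing, on the quotient by the radical. -/
def charPair (l : AddChar (KCentre n R) ℂ) (a : Fin n → R) (x : (Fin n → R) ⧸ charRad l) : ℂ :=
  l (kPair a x.out)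

theorem charPair_mk (l : AddChar (KCentre n R) ℂ) (a b : Fin n → R) :
    charPair l a (b : (Fin n → R) ⧸ charRad l) = l (kPair a b) := by
  have h : -(Quotient.out (b : (Fin n → R) ⧸ charRad l)) + b ∈ charRad l :=
    QuotientAddGroup.eq.1 (QuotientAddGroup.out_eq' _)
  have h1 : b = Quotient.out (b : (Fin n → R) ⧸ charRad l) +
    (-(Quotient.out (b : (Fin n → R) ⧸ charRad l)) + b) := by abel
  rw [charPair]
  conv_rhs => rw [h1, KGroup.kPair_add_right, AddChar.map_add_eq_mul, h a, mul_one]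

theorem charPair_add_left (l : AddChar (KCentre n R) ℂ) (a a' : Fin n → R)
    (x : (Fin n → R) ⧸ charRad l) :
    charPair l (a + a') x = charPair l a x * charPair l a' x := by
  rw [charPair, KGroup.kPair_add_left, AddChar.map_add_eq_mul]
  rfl

theorem charPair_zero_left (l : AddChar (KCentre n R) ℂ) (x : (Fin n → R) ⧸ charRad l) :
    charPair l 0 x = 1 := by
  rw [charPair, KGroup.kPair_zero_left, AddChar.map_zero_eq_one]

theorem charPair_add_right (l : AddChar (KCentre n R) ℂ) (a b : Fin n → R)
    (x : (Fin n → R) ⧸ charRad l) :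
    charPair l a (x + b) = charPair l a x * l (kPair a b) := by
  induction x using QuotientAddGroup.induction_on with
  | _ x => rw [← QuotientAddGroup.mk_add, charPair_mk, charPair_mk, KGroup.kPair_add_right,
      AddChar.map_add_eq_mul]

theorem charPair_injective (l : AddChar (KCentre n R) ℂ) (x y : (Fin n → R) ⧸ charRad l)
    (h : ∀ a, charPair l a x = charPair l a y) : x = y := by
  induction x using QuotientAddGroup.induction_on with
  | _ x =>
  induction y using QuotientAddGroup.induction_on with
  | _ y =>
  refine QuotientAddGroup.eq.2 fun a => ?_
  have := h a
  rw [charPair_mk, charPair_mk] at this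
  rw [KGroup.kPair_add_right, AddChar.map_add_eq_mul, ← this, KGroup.kPair_neg_right,
    ← AddChar.map_add_eq_mul, neg_add_cancel, AddChar.map_zero_eq_one]

/-- The pairing with a class, as a character. -/
def charPairHom (l : AddChar (KCentre n R) ℂ) (x : (Fin n → R) ⧸ charRad l) :
    Multiplicative (Fin n → R) →* ℂ where
  toFun a := charPair l a.toAdd x
  map_one' := charPair_zero_left l x
  map_mul' _ _ := charPair_add_left l _ _ x

/-- The elements `kPair a b` are commutators in the group, so this forces every one-dimensional
representation to be trivial on the centre. -/
theorem span_kPair_eq_top (n : ℕ) (R : Type) [CommRing R] :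
    AddSubgroup.closure {c : KCentre n R | ∃ a b, c = kPair a b} = ⊤ := by
  rw [eq_top_iff]
  rintro c -
  obtain ⟨M, rfl⟩ := Submodule.Quotient.mk_surjective _ c
  rw [Matrix.matrix_eq_sum_single M]
  rw [← Submodule.mkQ_apply, map_sum]
  refine AddSubgroup.sum_mem _ fun i _ => ?_
  rw [map_sum]
  refine AddSubgroup.sum_mem _ fun j _ => AddSubgroup.subset_closure
    ⟨Pi.single i (M i j), Pi.single j 1, ?_⟩
  rw [kPair, Submodule.mkQ_apply]
  congr 1
  ext k l
  simp only [Matrix.single_apply, Matrix.vecMulVec_apply, Pi.single_apply]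
  by_cases h1 : i = k <;> by_cases h2 : j = l <;> simp [h1, h2, eq_comm (a := k), eq_comm (a := l)]

end Characters

/-! ### Joint eigenvectors and Schur's lemma -/

section LinearAlgebra

open Module

variable {V : Type*} [AddCommGroup V] [Module ℂ V] [FiniteDimensional ℂ V]

/-- On a minimal nonzero subspace invariant under the whole family each operator is scalar: it has
an eigenvector there, and commutation makes the eigenspace invariant, so by minimality the
eigenspace is everything. -/
theorem exists_joint_eigenvector [Nontrivial V] {ι : Type*} (T : ι → End ℂ V)
    (hT : ∀ i j, Commute (T i) (T j)) : ∃ v ≠ 0, ∀ i, ∃ μ : ℂ, T i v = μ • v := by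
  obtain ⟨W, ⟨hW0, hWT⟩, hmin⟩ := WellFounded.has_min (wellFounded_lt (α := Submodule ℂ V))
    {W | W ≠ ⊥ ∧ ∀ i, ∀ v ∈ W, T i v ∈ W} ⟨⊤, top_ne_bot, fun _ _ _ => Submodule.mem_top⟩
  obtain ⟨v, hv, hv0⟩ := Submodule.exists_mem_ne_zero_of_ne_bot hW0
  refine ⟨v, hv0, fun i => ?_⟩
  have : Nontrivial W := Submodule.nontrivial_iff_ne_bot.2 hW0
  obtain ⟨μ, hμ⟩ := End.exists_eigenvalue ((T i).restrict (hWT i))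
  obtain ⟨w, hw⟩ := hμ.exists_hasEigenvector
  refine ⟨μ, ?_⟩
  set W' := W ⊓ End.eigenspace (T i) μ with hW'
  have hle : W' ≤ W := inf_le_left
  have hmem : (w : V) ∈ W' := by
    refine ⟨w.2, End.mem_eigenspace_iff.2 ?_⟩
    have := hw.apply_eq_smul
    exact congrArg Subtype.val this
  have h1 : ¬ W' < W := hmin W'
    ⟨fun h0 => hw.2 (Subtype.ext ((Submodule.eq_bot_iff _).1 h0 _ hmem)),
    fun j u hu => ⟨hWT j u hu.1, by
      have h2 := End.mem_eigenspace_iff.1 hu.2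
      refine End.mem_eigenspace_iff.2 ?_
      have h3 : T i (T j u) = T j (T i u) := LinearMap.congr_fun (hT i j) u
      rw [h3, h2, map_smul]⟩⟩
  have h2 : W ≤ W' := (hle.lt_or_eq.resolve_left h1).ge
  exact End.mem_eigenspace_iff.1 (h2 hv).2

omit [FiniteDimensional ℂ V] in
theorem isIrreducible_iff {G : Type*} [Group G] (ρ : Representation ℂ G V) :
    ρ.IsIrreducible ↔ Nontrivial V ∧ ∀ W : Submodule ℂ V, (∀ g, ∀ v ∈ W, ρ g v ∈ W) →
      W = ⊥ ∨ W = ⊤ := by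
  constructor
  · intro h
    refine ⟨?_, fun W hW => ?_⟩
    · by_contra hV
      rw [not_nontrivial_iff_subsingleton] at hV
      exact bot_ne_top (α := Subrepresentation ρ)
        (Subrepresentation.toSubmodule_injective (Subsingleton.elim _ _))
    · rcases h.eq_bot_or_eq_top ⟨W, fun g v => hW g v⟩ with h | h
      · exact Or.inl (congrArg Subrepresentation.toSubmodule h)
      · exact Or.inr (congrArg Subrepresentation.toSubmodule h)
  · rintro ⟨hV, h⟩
    have : Nontrivial (Subrepresentation ρ) := ⟨⊥, ⊤, fun h0 => bot_ne_top (α := Submodule ℂ V)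
      (congrArg Subrepresentation.toSubmodule h0)⟩
    refine ⟨fun W => ?_⟩
    rcases h W.toSubmodule fun g v => W.apply_mem_toSubmodule g (v := v) with h | h
    · exact Or.inl (Subrepresentation.toSubmodule_injective h)
    · exact Or.inr (Subrepresentation.toSubmodule_injective h)

theorem exists_scalar_of_commute {G : Type*} [Group G] (ρ : Representation ℂ G V)
    (hρ : ρ.IsIrreducible) (T : End ℂ V) (hT : ∀ g v, T (ρ g v) = ρ g (T v)) :
    ∃ μ : ℂ, ∀ v, T v = μ • v := by
  obtain ⟨hV, h⟩ := (isIrreducible_iff ρ).1 hρ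
  obtain ⟨μ, hμ⟩ := End.exists_eigenvalue T
  refine ⟨μ, fun v => ?_⟩
  have := (h (End.eigenspace T μ) fun g v hv => End.mem_eigenspace_iff.2 (by
    rw [hT, End.mem_eigenspace_iff.1 hv, map_smul])).resolve_left hμ
  exact End.mem_eigenspace_iff.1 (this ▸ Submodule.mem_top : v ∈ End.eigenspace T μ)

end LinearAlgebra
end

/-! ### The central character determines the twist-isoclass -/

noncomputable section

section HeisenbergIrreps

open Module

namespace KGroup

variable {n : ℕ} {R : Type} [CommRing R]

/-- The elements with only a first coordinate. -/
def ofA (a : Fin n → R) : KGroup n R := ⟨a, 0, 0⟩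
/-- The elements with only a second coordinate. -/
def ofB (b : Fin n → R) : KGroup n R := ⟨0, b, 0⟩
/-- The central elements. -/
def ofC (c : KCentre n R) : KGroup n R := ⟨0, 0, c⟩

theorem eq_mul (g : KGroup n R) : g = ofC g.c * (ofB g.b * ofA g.a) := by
  ext1 <;> simp [mul_def, ofA, ofB, ofC, kPair_zero_left]

theorem ofA_add (a a' : Fin n → R) : ofA (a + a') = ofA a * ofA a' := by
  ext1 <;> simp [mul_def, ofA, kPair_zero_right]

theorem ofB_add (b b' : Fin n → R) : ofB (b + b') = (ofB b * ofB b' : KGroup n R) := by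
  ext1 <;> simp [mul_def, ofB, kPair_zero_left]

theorem ofC_add (c c' : KCentre n R) : ofC (c + c') = ofC c * ofC c' := by
  ext1 <;> simp [mul_def, ofC, kPair_zero_left]

theorem ofA_mul_ofB (a b : Fin n → R) : ofA a * ofB b = ofC (kPair a b) * (ofB b * ofA a) := by
  ext1 <;> simp [mul_def, ofA, ofB, ofC, kPair_zero_left]

theorem ofC_mul (c : KCentre n R) (g : KGroup n R) : ofC c * g = g * ofC c := by
  ext1 <;> simp [mul_def, ofC, kPair_zero_left, kPair_zero_right, add_comm]

theorem mul_ofB (g : KGroup n R) (b : Fin n → R) :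
    g * ofB b = ofC (kPair g.a b) * (ofB b * g) := by
  ext1 <;> simp [mul_def, ofB, ofC, kPair_zero_left, add_comm]

variable [TopologicalSpace R]

theorem continuous_coords : Continuous fun g : KGroup n R => ((g.a, g.b, g.c) : KLie n R) :=
  continuous_induced_dom

theorem continuous_a : Continuous fun g : KGroup n R => g.a := continuous_coords.fst
theorem continuous_b : Continuous fun g : KGroup n R => g.b := continuous_coords.snd.fst
theorem continuous_c : Continuous fun g : KGroup n R => g.c := continuous_coords.snd.snd

theorem continuous_ofA : Continuous (ofA : (Fin n → R) → KGroup n R) :=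
  continuous_induced_rng.2 (by
    exact continuous_id.prodMk (continuous_const.prodMk continuous_const))
theorem continuous_ofB : Continuous (ofB : (Fin n → R) → KGroup n R) :=
  continuous_induced_rng.2 (by
    exact continuous_const.prodMk (continuous_id.prodMk continuous_const))
theorem continuous_ofC : Continuous (ofC : KCentre n R → KGroup n R) :=
  continuous_induced_rng.2 (by
    exact continuous_const.prodMk (continuous_const.prodMk continuous_id))

end KGroup

open KGroup

variable {n : ℕ} {R : Type} [CommRing R] [TopologicalSpace R] {m : ℕ}

/-- `ρ` has central character `l`. -/
def HasCentralChar (ρ : ContIrrep (KGroup n R) m) (l : AddChar (KCentre n R) ℂ) : Prop :=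
  ∀ c v, ρ.ρ (ofC c) v = l c • v

theorem ContIrrep.nontrivial {G : Type} [Group G] [TopologicalSpace G] (ρ : ContIrrep G m) :
    Nontrivial (Fin m → ℂ) := ((isIrreducible_iff ρ.ρ).1 ρ.irreducible).1

/-- A continuous homomorphism from an additive group that acts on a vector by scalars does so by a
continuous character. -/
theorem exists_addChar_of_eigenvector {G : Type} [Group G] [TopologicalSpace G]
    (ρ : ContIrrep G m) {H : Type} [AddGroup H] [TopologicalSpace H] (i : H → G)
    (hi : Continuous i) (hadd : ∀ x y, i (x + y) = i x * i y) {v : Fin m → ℂ} (hv : v ≠ 0)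
    (h : ∀ x, ∃ μ : ℂ, ρ.ρ (i x) v = μ • v) :
    ∃ l : AddChar H ℂ, Continuous l ∧ ∀ x, ρ.ρ (i x) v = l x • v := by
  choose l hl using h
  have h0 : i 0 = 1 := by
    have := hadd 0 0
    rw [add_zero] at this
    exact (mul_eq_left.1 this.symm)
  have hinj : ∀ a b : ℂ, a • v = b • v → a = b := fun a b hab => smul_left_injective ℂ hv hab
  refine ⟨⟨l, hinj _ _ ?_, fun x y => hinj _ _ ?_⟩, ?_, hl⟩
  · rw [← hl, h0, map_one, one_smul]; rfl
  · rw [← hl, hadd, map_mul, Module.End.mul_apply, hl, map_smul, hl, smul_smul, mul_comm]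
  · obtain ⟨j, hj⟩ := Function.ne_iff.1 hv
    have h1 : l = fun x => ρ.ρ (i x) v j / v j := by
      ext x
      rw [hl, Pi.smul_apply, smul_eq_mul, mul_div_cancel_right₀ _ hj]
    change Continuous l
    rw [h1]
    exact (((continuous_apply j).comp ((ρ.continuous_apply v).comp hi))).div_const _

theorem exists_centralChar (ρ : ContIrrep (KGroup n R) m) :
    ∃ l : AddChar (KCentre n R) ℂ, Continuous l ∧ HasCentralChar ρ l := by
  have hnt := ρ.nontrivial
  obtain ⟨v, hv⟩ := exists_ne (0 : Fin m → ℂ)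
  have hs : ∀ c, ∃ μ : ℂ, ∀ v, ρ.ρ (ofC c) v = μ • v := fun c =>
    exists_scalar_of_commute ρ.ρ ρ.irreducible (ρ.ρ (ofC c)) fun g v => by
      rw [← Module.End.mul_apply, ← map_mul, ofC_mul, map_mul, Module.End.mul_apply]
  obtain ⟨l, hl, hlv⟩ := exists_addChar_of_eigenvector ρ ofC continuous_ofC ofC_add hv
    fun c => (hs c).imp fun μ h => h v
  refine ⟨l, hl, fun c w => ?_⟩
  obtain ⟨μ, hμ⟩ := hs c
  rw [hμ w, smul_left_injective ℂ hv ((hμ v).symm.trans (hlv c))]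

/-- The twist of a representation by a one-dimensional representation. -/
def ContIrrep.twist {G : Type} [Group G] [TopologicalSpace G] (ρ : ContIrrep G m) (χ : G →* ℂˣ)
    (hχ : Continuous χ) : ContIrrep G m where
  ρ :=
    { toFun := fun g => (χ g : ℂ) • ρ.ρ g
      map_one' := by simp
      map_mul' := fun g h => by
        ext v : 1
        simp [smul_smul, mul_comm] }
  continuous_apply v := (Units.continuous_val.comp hχ).smul (ρ.continuous_apply v)
  irreducible := by
    refine (isIrreducible_iff _).2 ⟨ρ.nontrivial, fun W hW => ?_⟩
    refine ((isIrreducible_iff ρ.ρ).1 ρ.irreducible).2 W fun g v hv => ?_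
    have := W.smul_mem ((χ g)⁻¹ : ℂˣ).val (hW g v hv)
    simpa [smul_smul] using this

theorem ContIrrep.twist_apply {G : Type} [Group G] [TopologicalSpace G] (ρ : ContIrrep G m)
    (χ : G →* ℂˣ) (hχ : Continuous χ) (g : G) (v : Fin m → ℂ) :
    (ρ.twist χ hχ).ρ g v = (χ g : ℂ) • ρ.ρ g v := rfl

theorem twistEquiv_twist {G : Type} [Group G] [TopologicalSpace G] (ρ : ContIrrep G m)
    (χ : G →* ℂˣ) (hχ : Continuous χ) : TwistEquiv ρ (ρ.twist χ hχ) :=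
  ⟨χ, hχ, LinearEquiv.refl ℂ _, fun _ _ => rfl⟩

/-- The one-dimensional representation given by characters of the first two coordinates. -/
def abChar (α β : AddChar (Fin n → R) ℂ) : KGroup n R →* ℂˣ :=
  MonoidHom.toHomUnits
    { toFun := fun g => α g.a * β g.b
      map_one' := by simp [KGroup.one_def]
      map_mul' := fun g h => by
        simp only [KGroup.mul_def, AddChar.map_add_eq_mul]
        ring }

omit [TopologicalSpace R] in
theorem abChar_apply (α β : AddChar (Fin n → R) ℂ) (g : KGroup n R) :
    (abChar α β g : ℂ) = α g.a * β g.b := rfl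

theorem continuous_abChar {α β : AddChar (Fin n → R) ℂ} (hα : Continuous α)
    (hβ : Continuous β) : Continuous (abChar α β) := by
  have h : Continuous fun g => (abChar α β g : ℂ) :=
    (hα.comp continuous_a).mul (hβ.comp continuous_b)
  refine Units.continuous_iff.2 ⟨h, ?_⟩
  simp only [Units.val_inv_eq_inv_val]
  exact h.inv₀ fun g => (abChar α β g).ne_zero

/-- The commuting operators of each abelian subgroup have a joint eigenvector. Its character extends
to the whole group through the abelianization, so one twist by the inverses makes both eigenvectors
fixed; the twist is trivial on the centre. -/
theorem exists_twist_fixed [IsTopologicalRing R] (ρ : ContIrrep (KGroup n R) m) :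
    ∃ σ, TwistEquiv ρ σ ∧ (∀ l, HasCentralChar ρ l → HasCentralChar σ l) ∧
      (∃ v ≠ 0, ∀ a, σ.ρ (ofA a) v = v) ∧ ∃ v ≠ 0, ∀ b, σ.ρ (ofB b) v = v := by
  have hnt := ρ.nontrivial
  obtain ⟨v, hv, hva⟩ := exists_joint_eigenvector (fun a : Fin n → R => ρ.ρ (ofA a))
    fun a a' => by
      rw [Commute, SemiconjBy, ← map_mul, ← map_mul, ← ofA_add, ← ofA_add, add_comm]
  obtain ⟨w, hw, hwb⟩ := exists_joint_eigenvector (fun b : Fin n → R => ρ.ρ (ofB b))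
    fun a a' => by
      rw [Commute, SemiconjBy, ← map_mul, ← map_mul, ← ofB_add, ← ofB_add, add_comm]
  obtain ⟨α, hα, hαv⟩ := exists_addChar_of_eigenvector ρ ofA continuous_ofA ofA_add hv hva
  obtain ⟨β, hβ, hβw⟩ := exists_addChar_of_eigenvector ρ ofB continuous_ofB ofB_add hw hwb
  have hcont : ∀ γ : AddChar (Fin n → R) ℂ, Continuous γ → Continuous (γ⁻¹ : AddChar _ ℂ) :=
    fun γ hγ => by
      have : ((γ⁻¹ : AddChar (Fin n → R) ℂ) : (Fin n → R) → ℂ) = fun x => γ (-x) := by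
        ext x; exact AddChar.inv_apply γ x
      rw [this]
      exact hγ.comp continuous_neg
  have hχ := continuous_abChar (hcont α hα) (hcont β hβ)
  refine ⟨ρ.twist _ hχ, twistEquiv_twist ρ _ hχ, fun l hl c u => ?_, ⟨v, hv, fun a => ?_⟩,
    ⟨w, hw, fun b => ?_⟩⟩
  · rw [ContIrrep.twist_apply, abChar_apply, hl c u]
    simp [ofC]
  · rw [ContIrrep.twist_apply, abChar_apply, hαv, smul_smul]
    simp [ofA, ← AddChar.map_add_eq_mul]
  · rw [ContIrrep.twist_apply, abChar_apply, hβw, smul_smul]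
    simp [ofB, ← AddChar.map_add_eq_mul]

/-- The standard basis of a representation with vectors fixed by the two abelian subgroups. -/
theorem exists_basis_of_fixed (ρ : ContIrrep (KGroup n R) m) (l : AddChar (KCentre n R) ℂ)
    (hl : HasCentralChar ρ l) (hA : ∃ v ≠ 0, ∀ a, ρ.ρ (ofA a) v = v)
    (hB : ∃ v ≠ 0, ∀ b, ρ.ρ (ofB b) v = v) :
    ∃ u : Basis ((Fin n → R) ⧸ charRad l) ℂ (Fin m → ℂ),
      ∀ g x, ρ.ρ g (u x) = (l g.c * charPair l g.a x) • u (x + g.b) := by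
  obtain ⟨v, hv, hva⟩ := hA
  obtain ⟨w, hw, hwb⟩ := hB
  have hmul : ∀ (g h : KGroup n R) v, ρ.ρ (g * h) v = ρ.ρ g (ρ.ρ h v) := fun g h v => by
    rw [map_mul, Module.End.mul_apply]
  -- For `b` in the radical `ofB b` acts centrally, hence by a scalar, and the fixed vector `w`
  -- shows that the scalar is `1`. Thus `ofB b` applied to `v` depends only on the class of `b`.
  have hrad : ∀ b ∈ charRad l, ∀ u, ρ.ρ (ofB b) u = u := by
    intro b hb
    obtain ⟨μ, hμ⟩ := exists_scalar_of_commute ρ.ρ ρ.irreducible (ρ.ρ (ofB b)) fun g u => by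
      rw [← hmul, ← hmul, mul_ofB, hmul (ofC _), hl, hb, one_smul]
    have : μ = 1 := smul_left_injective ℂ hw (by
      change μ • w = (1 : ℂ) • w
      rw [← hμ, hwb, one_smul])
    intro u
    rw [hμ, this, one_smul]
  set u : ((Fin n → R) ⧸ charRad l) → (Fin m → ℂ) := fun x => ρ.ρ (ofB x.out) v with hu
  have humk : ∀ b : Fin n → R, u (b : (Fin n → R) ⧸ charRad l) = ρ.ρ (ofB b) v := by
    intro b
    have h : -(Quotient.out (b : (Fin n → R) ⧸ charRad l)) + b ∈ charRad l :=
      QuotientAddGroup.eq.1 (QuotientAddGroup.out_eq' _)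
    have h1 : b = Quotient.out (b : (Fin n → R) ⧸ charRad l) +
      (-(Quotient.out (b : (Fin n → R) ⧸ charRad l)) + b) := by abel
    conv_rhs => rw [h1, ofB_add, hmul, hrad _ h]
  have hact : ∀ g x, ρ.ρ g (u x) = (l g.c * charPair l g.a x) • u (x + g.b) := by
    intro g x
    induction x using QuotientAddGroup.induction_on with
    | _ b =>
    rw [← QuotientAddGroup.mk_add, humk, humk, charPair_mk, ← hmul]
    conv_lhs => rw [eq_mul g]
    rw [mul_assoc, mul_assoc, ofA_mul_ofB, ← mul_assoc (ofB g.b), ← ofC_mul, mul_assoc, hmul, hl,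
      hmul, hl, smul_smul, ← mul_assoc, ← ofB_add, hmul, hva, add_comm]
  have hu0 : ∀ x, u x ≠ 0 := fun x h0 => by
    have h1 : ρ.ρ (ofB (-x.out)) (u x) = v := by
      rw [hu, ← hmul, ← ofB_add, neg_add_cancel]
      exact congrFun (congrArg _ (map_one ρ.ρ)) v
    rw [h0, map_zero] at h1
    exact hv h1.symm
  have hactA : ∀ a x, ρ.ρ (ofA a) (u x) = charPair l a x • u x := fun a x => by
    rw [hact]
    change (l 0 * charPair l a x) • u (x + ((0 : Fin n → R) : (Fin n → R) ⧸ charRad l)) = _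
    rw [AddChar.map_zero_eq_one, one_mul, QuotientAddGroup.mk_zero, add_zero]
  -- The vectors `u x` are eigenvectors of the first abelian subgroup for pairwise distinct
  -- characters; independence of characters applies to a coordinate `i` where `u x` is nonzero.
  have hli : LinearIndependent ℂ u := by
    have hind := (linearIndependent_monoidHom (Multiplicative (Fin n → R)) ℂ).comp
      (charPairHom l) fun x y hxy => charPair_injective l x y fun a =>
        DFunLike.congr_fun hxy (Multiplicative.ofAdd a)
    rw [linearIndependent_iff'] at hind ⊢
    intro s c hc x hx
    obtain ⟨i, hi⟩ := Function.ne_iff.1 (hu0 x)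
    refine (mul_eq_zero.1 (hind s (fun x => c x * u x i) ?_ x hx)).resolve_right hi
    ext a
    have h1 := congrFun (congrArg (ρ.ρ (ofA a.toAdd)) hc) i
    rw [map_zero, map_sum, Finset.sum_apply] at h1
    rw [Finset.sum_apply]
    refine Eq.trans (Finset.sum_congr rfl fun y _ => ?_) h1
    rw [map_smul, hactA]
    simp only [Pi.smul_apply, smul_eq_mul, Function.comp_apply]
    change c y * u y i * charPair l a.toAdd y = _
    ring
  have hspan : Submodule.span ℂ (Set.range u) = ⊤ := by
    refine (((isIrreducible_iff ρ.ρ).1 ρ.irreducible).2 _ fun g y hy => ?_).resolve_left fun h => ?_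
    · induction hy using Submodule.span_induction with
      | mem y hy =>
        obtain ⟨x, rfl⟩ := hy
        rw [hact]
        exact Submodule.smul_mem _ _ (Submodule.subset_span ⟨_, rfl⟩)
      | zero => rw [map_zero]; exact Submodule.zero_mem _
      | add y z _ _ hy hz => rw [map_add]; exact Submodule.add_mem _ hy hz
      | smul c y _ hy => rw [map_smul]; exact Submodule.smul_mem _ _ hy
    · refine hv (Submodule.span_eq_bot.1 h v ⟨((0 : Fin n → R) : (Fin n → R) ⧸ charRad l), ?_⟩)
      rw [humk]
      exact congrFun (congrArg _ (map_one ρ.ρ)) v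
  refine ⟨Basis.mk hli hspan.ge, fun g x => ?_⟩
  rw [Basis.mk_apply, Basis.mk_apply]
  exact hact g x

theorem charDim_eq [IsTopologicalRing R] (ρ : ContIrrep (KGroup n R) m)
    (l : AddChar (KCentre n R) ℂ) (hl : HasCentralChar ρ l) : charDim l = m := by
  obtain ⟨σ, -, hσ, hA, hB⟩ := exists_twist_fixed ρ
  obtain ⟨u, -⟩ := exists_basis_of_fixed σ l (hσ l hl) hA hB
  rw [charDim, ← Module.finrank_eq_nat_card_basis u, Module.finrank_fin_fun]

/-- Stone–von Neumann uniqueness: after a twist both representations act by the same formula on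
bases indexed by the quotient by the radical. -/
theorem twistEquiv_of_centralChar [IsTopologicalRing R] (ρ σ : ContIrrep (KGroup n R) m)
    (l : AddChar (KCentre n R) ℂ) (hρ : HasCentralChar ρ l) (hσ : HasCentralChar σ l) :
    TwistEquiv ρ σ := by
  have heq := twistEquiv_equivalence (KGroup n R) m
  obtain ⟨ρ', h1, h2, hA, hB⟩ := exists_twist_fixed ρ
  obtain ⟨σ', h1', h2', hA', hB'⟩ := exists_twist_fixed σ
  obtain ⟨u, hu⟩ := exists_basis_of_fixed ρ' l (h2 l hρ) hA hB
  obtain ⟨w, hw⟩ := exists_basis_of_fixed σ' l (h2' l hσ) hA' hB'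
  refine heq.trans h1 (heq.trans ⟨1, continuous_const, u.equiv w (Equiv.refl _), fun g v => ?_⟩
    (heq.symm h1'))
  have : (u.equiv w (Equiv.refl _)).toLinearMap ∘ₗ ρ'.ρ g =
      σ'.ρ g ∘ₗ (u.equiv w (Equiv.refl _)).toLinearMap := by
    refine u.ext fun x => ?_
    simp [hu, hw]
  simpa using LinearMap.congr_fun this v

theorem centralChar_eq_of_twistEquiv (ρ σ : ContIrrep (KGroup n R) m)
    (l k : AddChar (KCentre n R) ℂ) (hρ : HasCentralChar ρ l) (hσ : HasCentralChar σ k)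
    (h : TwistEquiv ρ σ) : l = k := by
  obtain ⟨χ, -, T, hT⟩ := h
  have hχ : ∀ c, χ (ofC c) = 1 := by
    intro c
    have hc : c ∈ AddSubgroup.closure {c : KCentre n R | ∃ a b, c = kPair a b} := by
      rw [span_kPair_eq_top]; trivial
    induction hc using AddSubgroup.closure_induction with
    | mem c hc =>
      obtain ⟨a, b, rfl⟩ := hc
      have := congrArg χ (ofA_mul_ofB a b)
      rw [map_mul, map_mul, map_mul, mul_comm (χ (ofA a))] at this
      exact mul_eq_right.1 this.symm
    | zero => exact map_one χ
    | add c d _ _ hc hd => rw [ofC_add, map_mul, hc, hd, one_mul]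
    | neg c _ hc =>
      have := ofC_add (-c) c
      rw [neg_add_cancel] at this
      have h0 : χ (ofC (0 : KCentre n R)) = 1 := map_one χ
      rwa [this, map_mul, hc, mul_one] at h0
  have hnt := ρ.nontrivial
  obtain ⟨v, hv⟩ := exists_ne (0 : Fin m → ℂ)
  ext c
  have := hT (ofC c) v
  rw [hχ, hρ, hσ, Units.val_one, one_smul, map_smul] at this
  exact smul_left_injective ℂ (by simpa using hv : T v ≠ 0) this

end HeisenbergIrreps
end

/-! ### Construction of a representation with given central character -/

noncomputable section

section HeisenbergModel

open KGroup

variable {n : ℕ} {R : Type} [CommRing R]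

/-- The monomial representation with a given central character. -/
def modelRep (l : AddChar (KCentre n R) ℂ) {m : ℕ} (e : ((Fin n → R) ⧸ charRad l) ≃ Fin m) :
    Representation ℂ (KGroup n R) (Fin m → ℂ) where
  toFun g :=
    { toFun := fun f i => l g.c * charPair l g.a (e.symm i - g.b) * f (e (e.symm i - g.b))
      map_add' := fun f f' => by
        ext i
        simp [mul_add]
      map_smul' := fun c f => by
        ext i
        simp only [Pi.smul_apply, smul_eq_mul, RingHom.id_apply]
        ring }
  map_one' := by
    refine LinearMap.ext fun f => funext fun i => ?_
    simp [KGroup.one_def, charPair_zero_left]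
  map_mul' g h := by
    refine LinearMap.ext fun f => funext fun i => ?_
    have h1 : e.symm i - ((g * h).b : Fin n → R) =
        e.symm i - (g.b : (Fin n → R) ⧸ charRad l) - (h.b : (Fin n → R) ⧸ charRad l) := by
      rw [KGroup.mul_def, QuotientAddGroup.mk_add, sub_sub]
    have h2 : charPair l g.a (e.symm i - (g.b : (Fin n → R) ⧸ charRad l)) =
        charPair l g.a (e.symm i - (g.b : (Fin n → R) ⧸ charRad l) - h.b) *
          l (kPair g.a h.b) := by
      rw [← charPair_add_right, sub_add_cancel]
    simp only [LinearMap.coe_mk, AddHom.coe_mk, Module.End.mul_apply, Equiv.symm_apply_apply]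
    rw [h1, h2]
    simp only [KGroup.mul_def, AddChar.map_add_eq_mul, charPair_add_left]
    ring

theorem modelRep_apply (l : AddChar (KCentre n R) ℂ) {m : ℕ}
    (e : ((Fin n → R) ⧸ charRad l) ≃ Fin m) (g : KGroup n R) (f : Fin m → ℂ) (i : Fin m) :
    modelRep l e g f i = l g.c * charPair l g.a (e.symm i - g.b) * f (e (e.symm i - g.b)) := rfl

theorem modelRep_ofA (l : AddChar (KCentre n R) ℂ) {m : ℕ}
    (e : ((Fin n → R) ⧸ charRad l) ≃ Fin m) (a : Fin n → R) (f : Fin m → ℂ) (i : Fin m) :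
    modelRep l e (ofA a) f i = charPair l a (e.symm i) * f i := by
  simp [modelRep_apply, ofA]

theorem modelRep_ofB (l : AddChar (KCentre n R) ℂ) {m : ℕ}
    (e : ((Fin n → R) ⧸ charRad l) ≃ Fin m) (b : Fin n → R) (f : Fin m → ℂ) (i : Fin m) :
    modelRep l e (ofB b) f i = f (e (e.symm i - b)) := by
  simp [modelRep_apply, ofB, charPair_zero_left]

/-- A nonzero invariant subspace contains a joint eigenvector of the first abelian subgroup.
Distinct points carry distinct characters, so this vector is supported at one point, and the
translations from the second subgroup then produce all basis vectors. -/
theorem modelRep_isIrreducible (l : AddChar (KCentre n R) ℂ) {m : ℕ}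
    (e : ((Fin n → R) ⧸ charRad l) ≃ Fin m) : (modelRep l e).IsIrreducible := by
  refine (isIrreducible_iff _).2 ⟨?_, fun W hW => or_iff_not_imp_left.2 fun hW0 => ?_⟩
  · have : Nonempty (Fin m) := ⟨e 0⟩
    infer_instance
  have : Nontrivial W := Submodule.nontrivial_iff_ne_bot.2 hW0
  obtain ⟨⟨v, hvW⟩, hv, hva⟩ := exists_joint_eigenvector
    (fun a : Fin n → R => (modelRep l e (ofA a)).restrict (hW (ofA a))) fun a a' => by
      ext1 w
      refine Subtype.ext ?_
      change modelRep l e (ofA a) (modelRep l e (ofA a') w) =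
        modelRep l e (ofA a') (modelRep l e (ofA a) w)
      ext i
      simp only [modelRep_ofA]
      ring
  have hv0 : v ≠ 0 := fun h0 => hv (Subtype.ext h0)
  obtain ⟨i, hi⟩ := Function.ne_iff.1 hv0
  have hsupp : ∀ j, v j ≠ 0 → j = i := fun j hj => by
    refine e.symm.injective (charPair_injective l _ _ fun a => ?_)
    obtain ⟨μ, hμ⟩ := hva a
    have h1 : modelRep l e (ofA a) v = μ • v := congrArg Subtype.val hμ
    have h2 : ∀ k, v k ≠ 0 → charPair l a (e.symm k) = μ := fun k hk => by
      have := congrFun h1 k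
      rw [modelRep_ofA, Pi.smul_apply, smul_eq_mul] at this
      exact mul_right_cancel₀ hk this
    rw [h2 j hj, h2 i hi]
  have hsingle : ∀ j, Pi.single j (1 : ℂ) ∈ W := fun j => by
    obtain ⟨b, hb⟩ := QuotientAddGroup.mk_surjective (e.symm j - e.symm i)
    have h1 : (v i)⁻¹ • modelRep l e (ofB b) v ∈ W := W.smul_mem _ (hW _ _ hvW)
    convert h1 using 1
    ext k
    rw [Pi.smul_apply, modelRep_ofB, smul_eq_mul, hb]
    by_cases hk : k = j
    · subst hk
      rw [sub_sub_cancel, Equiv.apply_symm_apply, Pi.single_eq_same, inv_mul_cancel₀ hi]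
    · rw [Pi.single_eq_of_ne hk]
      by_contra h0
      have h2 := hsupp _ (right_ne_zero_of_mul (Ne.symm h0))
      rw [← e.eq_symm_apply, sub_eq_iff_eq_add, add_sub_cancel] at h2
      exact hk (e.symm.injective h2)
  rw [eq_top_iff]
  rintro f -
  rw [pi_eq_sum_univ' f]
  refine W.sum_mem fun j _ => W.smul_mem _ ?_
  convert hsingle j using 1

variable [TopologicalSpace R] [IsTopologicalRing R]

theorem continuous_kPair_left (b : Fin n → R) : Continuous fun a : Fin n → R => kPair a b := by
  refine continuous_quot_mk.comp ?_
  refine continuous_matrix fun i j => ?_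
  simp only [Matrix.vecMulVec_apply]
  fun_prop

/-- The coordinate `b` enters only through its class modulo the open radical, which is locally
constant; with this class fixed, the formula is continuous in `a` and `c`. -/
theorem modelRep_continuous (l : AddChar (KCentre n R) ℂ) (hl : Continuous l)
    (hrad : IsOpen (charRad l : Set (Fin n → R))) {m : ℕ}
    (e : ((Fin n → R) ⧸ charRad l) ≃ Fin m) (f : Fin m → ℂ) :
    Continuous fun g => modelRep l e g f := by
  refine continuous_pi fun i => continuous_iff_continuousAt.2 fun g₀ => ?_
  have hev : ∀ᶠ g : KGroup n R in nhds g₀,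
      (g.b : (Fin n → R) ⧸ charRad l) = (g₀.b : (Fin n → R) ⧸ charRad l) := by
    have hopen : IsOpen {g : KGroup n R | -g₀.b + g.b ∈ charRad l} :=
      hrad.preimage (continuous_const.add continuous_b)
    filter_upwards [hopen.mem_nhds (by simp [(charRad l).zero_mem])] with g hg
    exact (QuotientAddGroup.eq.2 hg).symm
  refine ContinuousAt.congr (f := fun g : KGroup n R =>
    l g.c * charPair l g.a (e.symm i - g₀.b) * f (e (e.symm i - g₀.b))) ?_ ?_
  · refine Continuous.continuousAt (((hl.comp continuous_c).mul ?_).mul continuous_const)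
    exact hl.comp ((continuous_kPair_left _).comp continuous_a)
  · filter_upwards [hev] with g hg
    rw [modelRep_apply, hg]

theorem exists_contIrrep (l : AddChar (KCentre n R) ℂ) (hl : Continuous l)
    (hrad : IsOpen (charRad l : Set (Fin n → R))) [Finite ((Fin n → R) ⧸ charRad l)] :
    ∃ ρ : ContIrrep (KGroup n R) (charDim l), HasCentralChar ρ l := by
  let e := Finite.equivFin ((Fin n → R) ⧸ charRad l)
  refine ⟨⟨modelRep l e, modelRep_continuous l hl hrad e, modelRep_isIrreducible l e⟩,
    fun c v => ?_⟩
  ext i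
  refine (modelRep_apply l e (ofC c) v i).trans ?_
  simp only [ofC, QuotientAddGroup.mk_zero, sub_zero, charPair_zero_left, mul_one]
  exact congrArg (fun j => l c * v j) (e.apply_symm_apply i)

/-- Twist-isoclasses are classified by their central characters. -/
def twistIsoclassEquiv (H : ∀ l : AddChar (KCentre n R) ℂ, Continuous l →
    IsOpen (charRad l : Set (Fin n → R)) ∧ Finite ((Fin n → R) ⧸ charRad l)) (m : ℕ) :
    {l : {l : AddChar (KCentre n R) ℂ // Continuous l} // charDim l.1 = m} ≃
      TwistIsoclass (KGroup n R) m := by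
  have hex : ∀ l : {l : {l : AddChar (KCentre n R) ℂ // Continuous l} // charDim l.1 = m},
      ∃ ρ : ContIrrep (KGroup n R) m, HasCentralChar ρ l.1.1 := by
    rintro ⟨⟨l, hl⟩, rfl⟩
    have := (H l hl).2
    exact exists_contIrrep l hl (H l hl).1
  refine Equiv.ofBijective (fun l => Quotient.mk _ (hex l).choose) ⟨fun l k h => ?_, fun c => ?_⟩
  · exact Subtype.ext (Subtype.ext (centralChar_eq_of_twistEquiv _ _ _ _ (hex l).choose_spec
      (hex k).choose_spec (Quotient.exact h)))
  · induction c using Quotient.inductionOn with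
    | _ ρ =>
    obtain ⟨l, hl, hρ⟩ := exists_centralChar ρ
    refine ⟨⟨⟨l, hl⟩, charDim_eq ρ l hρ⟩, Quotient.sound ?_⟩
    exact twistEquiv_of_centralChar _ _ l (hex ⟨⟨l, hl⟩, charDim_eq ρ l hρ⟩).choose_spec hρ

end HeisenbergModel
end

/-! ### Central characters as traceless matrices -/

noncomputable section

section LevelDuality

open IsLocalRing

variable (𝔬 : Type) [CommRing 𝔬] [IsDomain 𝔬] [IsDiscreteValuationRing 𝔬]
  [Finite (ResidueField 𝔬)]

/-- Every nonzero element of `𝔬/𝔪^(L+1)` has `π ^ L` as a multiple, so a character that is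
nontrivial at `π ^ L` is primitive. -/
theorem exists_isPrimitive_levelRing (L : ℕ) :
    ∃ ψ : AddChar (LevelRing 𝔬 (L + 1)) ℂ, ψ.IsPrimitive := by
  obtain ⟨π, hπ⟩ := IsDiscreteValuationRing.exists_irreducible 𝔬
  have hmem : ∀ k x, x ∈ maximalIdeal 𝔬 ^ k ↔ π ^ k ∣ x := fun k x => by
    rw [hπ.maximalIdeal_eq, Ideal.span_singleton_pow, Ideal.mem_span_singleton]
  have h0 : Ideal.Quotient.mk (maximalIdeal 𝔬 ^ (L + 1)) (π ^ L) ≠ 0 := by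
    rw [Ne, Ideal.Quotient.eq_zero_iff_mem, hmem,
      pow_dvd_pow_iff hπ.ne_zero hπ.not_isUnit]
    omega
  obtain ⟨ψ, hψ⟩ := AddChar.exists_apply_ne_zero.2 h0
  refine ⟨ψ, fun a ha h1 => hψ ?_⟩
  obtain ⟨x, rfl⟩ := Ideal.Quotient.mk_surjective a
  have hx0 : x ≠ 0 := by rintro rfl; exact ha (map_zero _)
  obtain ⟨k, u, rfl⟩ := IsDiscreteValuationRing.eq_unit_mul_pow_irreducible hx0 hπ
  have hk : k ≤ L := by
    by_contra! h
    exact ha (Ideal.Quotient.eq_zero_iff_mem.2 ((hmem _ _).2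
      (dvd_mul_of_dvd_right (pow_dvd_pow π h) _)))
  have h2 := DFunLike.congr_fun h1 (Ideal.Quotient.mk _ (↑u⁻¹ * π ^ (L - k)))
  rw [AddChar.mulShift_apply, AddChar.one_apply, ← map_mul] at h2
  convert h2 using 3
  rw [mul_mul_mul_comm, u.mul_inv, one_mul, ← pow_add, Nat.add_sub_cancel' hk]

/-- A primitive additive character of a quotient of `𝔬`. -/
def levelChar (L : ℕ) : AddChar (LevelRing 𝔬 (L + 1)) ℂ := (exists_isPrimitive_levelRing 𝔬 L).choose

theorem levelChar_isPrimitive (L : ℕ) : (levelChar 𝔬 L).IsPrimitive :=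
  (exists_isPrimitive_levelRing 𝔬 L).choose_spec

theorem eq_zero_of_levelChar_smul {L : ℕ} {a : LevelRing 𝔬 (L + 1)}
    (h : ∀ x : 𝔬, levelChar 𝔬 L (x • a) = 1) : a = 0 := by
  by_contra ha
  refine levelChar_isPrimitive 𝔬 L ha ?_
  ext y
  obtain ⟨x, rfl⟩ := Ideal.Quotient.mk_surjective y
  rw [AddChar.mulShift_apply, AddChar.one_apply, mul_comm, ← h x]
  rfl

theorem exists_eq_mulShift_levelChar (L : ℕ) (χ : AddChar (LevelRing 𝔬 (L + 1)) ℂ) :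
    ∃ a, ∀ x, χ x = levelChar 𝔬 L (x * a) := by
  classical
  have hfin : Finite (AddChar (LevelRing 𝔬 (L + 1)) ℂ) := Nat.finite_of_card_ne_zero (by
    rw [Nat.card_eq_fintype_card, AddChar.card_eq]
    exact Fintype.card_ne_zero)
  have hb := (Nat.bijective_iff_injective_and_card (levelChar 𝔬 L).mulShift).2
    ⟨AddChar.to_mulShift_inj_of_isPrimitive (levelChar_isPrimitive 𝔬 L), by
      rw [Nat.card_eq_fintype_card, Nat.card_eq_fintype_card, AddChar.card_eq]⟩
  obtain ⟨a, rfl⟩ := hb.2 χ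
  exact ⟨a, fun x => by rw [AddChar.mulShift_apply, mul_comm]⟩

variable (n : ℕ)

variable {𝔬 n} in
/-- The character `l` is trivial on the classes of the matrices with entries in the `L`-th power
of the maximal ideal. -/
def TrivialAtLevel (l : AddChar (KCentre n 𝔬) ℂ) (L : ℕ) : Prop :=
  ∀ X : Matrix (Fin n) (Fin n) 𝔬, (∀ i j, X i j ∈ maximalIdeal 𝔬 ^ L) →
    l (Submodule.Quotient.mk X) = 1

variable {𝔬 n} in
omit [Finite (ResidueField 𝔬)] in
theorem TrivialAtLevel.mono {l : AddChar (KCentre n 𝔬) ℂ} {L K : ℕ}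
    (h : TrivialAtLevel l L) (hLK : L ≤ K) : TrivialAtLevel l K :=
  fun X hX => h X fun i j => Ideal.pow_le_pow_right hLK (hX i j)

/-- The pairing with a traceless matrix. -/
def matrixPairing {L : ℕ} (M : Matrix (Fin n) (Fin n) (LevelRing 𝔬 (L + 1))) (hM : M.trace = 0) :
    KCentre n 𝔬 →ₗ[𝔬] LevelRing 𝔬 (L + 1) :=
  Submodule.liftQ _
    { toFun := fun X => ∑ i, ∑ j, X i j • M i j
      map_add' := fun X Y => by simp [add_smul, Finset.sum_add_distrib]
      map_smul' := fun c X => by simp [Finset.smul_sum, mul_smul] } (by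
    rw [Submodule.span_singleton_le_iff_mem, LinearMap.mem_ker, ← hM]
    simp [Matrix.one_apply, Matrix.trace])

omit [Finite (ResidueField 𝔬)] in
theorem matrixPairing_mk {L : ℕ} (M : Matrix (Fin n) (Fin n) (LevelRing 𝔬 (L + 1)))
    (hM : M.trace = 0) (X : Matrix (Fin n) (Fin n) 𝔬) :
    matrixPairing 𝔬 n M hM (Submodule.Quotient.mk X) = ∑ i, ∑ j, X i j • M i j := rfl

variable {𝔬 n} in
omit [Finite (ResidueField 𝔬)] in
theorem matrixPairing_single {L : ℕ} (M : Matrix (Fin n) (Fin n) (LevelRing 𝔬 (L + 1)))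
    (hM : M.trace = 0) (i j : Fin n) (x : 𝔬) :
    matrixPairing 𝔬 n M hM (Submodule.Quotient.mk (Matrix.single i j x)) = x • M i j := by
  rw [matrixPairing_mk, Finset.sum_eq_single i, Finset.sum_eq_single j]
  · simp
  · intro k _ hk; simp [hk.symm]
  · simp
  · intro k _ hk; simp [hk.symm]
  · simp

/-- The character of the centre given by a traceless matrix. -/
def matrixChar {L : ℕ} (M : Matrix (Fin n) (Fin n) (LevelRing 𝔬 (L + 1))) (hM : M.trace = 0) :
    AddChar (KCentre n 𝔬) ℂ :=
  (levelChar 𝔬 L).compAddMonoidHom (matrixPairing 𝔬 n M hM).toAddMonoidHom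

theorem matrixChar_apply {L : ℕ} (M : Matrix (Fin n) (Fin n) (LevelRing 𝔬 (L + 1)))
    (hM : M.trace = 0) (c : KCentre n 𝔬) :
    matrixChar 𝔬 n M hM c = levelChar 𝔬 L (matrixPairing 𝔬 n M hM c) := rfl

variable {𝔬 n}

omit [Finite (ResidueField 𝔬)] in
theorem smul_levelRing_eq_zero {L : ℕ} {x : 𝔬} (hx : x ∈ maximalIdeal 𝔬 ^ L)
    (a : LevelRing 𝔬 L) : x • a = 0 := by
  rw [Algebra.smul_def, Ideal.Quotient.algebraMap_eq, Ideal.Quotient.eq_zero_iff_mem.2 hx, zero_mul]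

theorem trivialAtLevel_matrixChar {L : ℕ} (M : Matrix (Fin n) (Fin n) (LevelRing 𝔬 (L + 1)))
    (hM : M.trace = 0) : TrivialAtLevel (matrixChar 𝔬 n M hM) (L + 1) := fun X hX => by
  rw [matrixChar_apply, matrixPairing_mk, Finset.sum_eq_zero, AddChar.map_zero_eq_one]
  exact fun i _ => Finset.sum_eq_zero fun j _ => smul_levelRing_eq_zero (hX i j) _

/-- This matches primitivity of the matrix with exactness of the level: a unit entry is detected by
the multiples of `π ^ L` in that position, as `π ^ L` is nonzero modulo `𝔪^(L+1)`, while entries in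
`𝔪` send `𝔪^L` into `𝔪^(L+1)`. -/
theorem trivialAtLevel_matrixChar_iff {L : ℕ} (M : Matrix (Fin n) (Fin n) (LevelRing 𝔬 (L + 1)))
    (hM : M.trace = 0) :
    TrivialAtLevel (matrixChar 𝔬 n M hM) L ↔ M.map (residue (LevelRing 𝔬 (L + 1))) = 0 := by
  obtain ⟨π, hπ⟩ := IsDiscreteValuationRing.exists_irreducible 𝔬
  have hmem : ∀ k x, x ∈ maximalIdeal 𝔬 ^ k ↔ π ^ k ∣ x := fun k x => by
    rw [hπ.maximalIdeal_eq, Ideal.span_singleton_pow, Ideal.mem_span_singleton]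
  constructor
  · intro h
    ext i j
    rw [Matrix.map_apply, Matrix.zero_apply, residue_eq_zero_iff]
    by_contra hu
    rw [mem_maximalIdeal, mem_nonunits_iff, not_not] at hu
    have h1 : π ^ L • M i j = 0 := eq_zero_of_levelChar_smul 𝔬 fun x => by
      have := h (Matrix.single i j (x * π ^ L)) fun k m => by
        rw [Matrix.single_apply]
        split_ifs
        · exact (hmem _ _).2 (dvd_mul_left _ _)
        · exact zero_mem _
      rwa [matrixChar_apply, matrixPairing_single, mul_smul] at this
    rw [Algebra.smul_def, hu.mul_left_eq_zero, Ideal.Quotient.algebraMap_eq,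
      Ideal.Quotient.eq_zero_iff_mem, hmem, pow_dvd_pow_iff hπ.ne_zero hπ.not_isUnit] at h1
    omega
  · intro h X hX
    rw [matrixChar_apply, matrixPairing_mk, Finset.sum_eq_zero, AddChar.map_zero_eq_one]
    refine fun i _ => Finset.sum_eq_zero fun j _ => ?_
    have h1 : residue _ (M i j) = 0 := congrFun (congrFun h i) j
    rw [residue_eq_zero_iff] at h1
    obtain ⟨a, ha⟩ := Ideal.Quotient.mk_surjective (M i j)
    rw [← ha, mk_mem_maximalIdeal] at h1
    rw [← ha, Algebra.smul_def, Ideal.Quotient.algebraMap_eq, ← map_mul,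
      Ideal.Quotient.eq_zero_iff_mem, pow_succ]
    exact Ideal.mul_mem_mul (hX i j) h1

theorem matrixChar_injective {L : ℕ} {M N : Matrix (Fin n) (Fin n) (LevelRing 𝔬 (L + 1))}
    {hM : M.trace = 0} {hN : N.trace = 0} (h : matrixChar 𝔬 n M hM = matrixChar 𝔬 n N hN) :
    M = N := by
  ext i j
  refine sub_eq_zero.1 (eq_zero_of_levelChar_smul 𝔬 fun x => ?_)
  have h1 := DFunLike.congr_fun h (Submodule.Quotient.mk (Matrix.single i j x))
  rw [matrixChar_apply, matrixChar_apply, matrixPairing_single, matrixPairing_single] at h1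
  rw [smul_sub, sub_eq_add_neg, AddChar.map_add_eq_mul, h1, ← AddChar.map_add_eq_mul,
    add_neg_cancel, AddChar.map_zero_eq_one]

theorem exists_addChar_quotient {R : Type} [CommRing R] (I : Ideal R) (f : AddChar R ℂ)
    (hf : ∀ x ∈ I, f x = 1) : ∃ χ : AddChar (R ⧸ I) ℂ, ∀ x, χ (Ideal.Quotient.mk I x) = f x := by
  have hout : ∀ x, f (Quotient.out (Ideal.Quotient.mk I x)) = f x := fun x => by
    have h := hf _ (Ideal.Quotient.eq.1 (Ideal.Quotient.mk_out (Ideal.Quotient.mk I x)))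
    rw [← one_mul (f x), ← h, ← AddChar.map_add_eq_mul, sub_add_cancel]
  refine ⟨⟨fun a => f a.out, ?_, fun a b => ?_⟩, hout⟩
  · rw [← map_zero (Ideal.Quotient.mk I), hout, AddChar.map_zero_eq_one]
  · obtain ⟨x, rfl⟩ := Ideal.Quotient.mk_surjective a
    obtain ⟨y, rfl⟩ := Ideal.Quotient.mk_surjective b
    rw [← map_add, hout, hout, hout, AddChar.map_add_eq_mul]

theorem apply_mk_eq_prod {R : Type} [CommRing R] (l : AddChar (KCentre n R) ℂ)
    (X : Matrix (Fin n) (Fin n) R) : l (Submodule.Quotient.mk X) =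
      ∏ i, ∏ j, l (Submodule.Quotient.mk (Matrix.single i j (X i j))) := by
  have h1 : (Submodule.Quotient.mk X : KCentre n R) =
      ∑ i, ∑ j, Submodule.Quotient.mk (Matrix.single i j (X i j)) := by
    conv_lhs => rw [Matrix.matrix_eq_sum_single X]
    simp only [← Submodule.mkQ_apply, map_sum]
  rw [h1]
  exact (map_sum l.toAddMonoidHom _ _).trans
    (Finset.sum_congr rfl fun i _ => map_sum l.toAddMonoidHom _ _)

/-- Self-duality of the finite quotient supplies each entry of the matrix separately; the trace
vanishes because `l` is trivial on scalar matrices. -/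
theorem exists_eq_matrixChar {L : ℕ} (l : AddChar (KCentre n 𝔬) ℂ)
    (hl : TrivialAtLevel l (L + 1)) :
    ∃ M, ∃ hM : M.trace = 0, l = matrixChar 𝔬 n (L := L) M hM := by
  have hij : ∀ i j, ∃ a : LevelRing 𝔬 (L + 1), ∀ x : 𝔬,
      l (Submodule.Quotient.mk (Matrix.single i j x)) = levelChar 𝔬 L (x • a) := by
    intro i j
    obtain ⟨χ, hχ⟩ := exists_addChar_quotient (maximalIdeal 𝔬 ^ (L + 1)) (l.compAddMonoidHom
      ((Submodule.mkQ (Submodule.span 𝔬 {(1 : Matrix (Fin n) (Fin n) 𝔬)})).toAddMonoidHom.comp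
        (Matrix.singleAddMonoidHom i j))) fun x hx => hl _ fun k m => by
          change Matrix.single i j x k m ∈ _
          rw [Matrix.single_apply]
          split_ifs
          · exact hx
          · exact zero_mem _
    obtain ⟨a, ha⟩ := exists_eq_mulShift_levelChar 𝔬 L χ
    exact ⟨a, fun x => (hχ x).symm.trans (ha _)⟩
  choose M hM using hij
  have hl2 : ∀ X : Matrix (Fin n) (Fin n) 𝔬, l (Submodule.Quotient.mk X) =
      levelChar 𝔬 L (∑ i, ∑ j, X i j • M i j) := by
    intro X
    rw [apply_mk_eq_prod]
    simp only [hM]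
    exact ((map_sum (levelChar 𝔬 L).toAddMonoidHom _ _).trans
      (Finset.sum_congr rfl fun i _ => map_sum (levelChar 𝔬 L).toAddMonoidHom _ _)).symm
  have htr : Matrix.trace (Matrix.of M) = 0 := by
    refine eq_zero_of_levelChar_smul 𝔬 fun x => ?_
    have h1 := hl2 (x • 1)
    rw [(Submodule.Quotient.mk_eq_zero _).2 (Submodule.smul_mem _ _
      (Submodule.mem_span_singleton_self _)), AddChar.map_zero_eq_one] at h1
    rw [h1]
    congr 1
    simp [Matrix.trace, Matrix.one_apply, Finset.smul_sum]
  refine ⟨Matrix.of M, htr, ?_⟩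
  ext c
  obtain ⟨X, rfl⟩ := Submodule.Quotient.mk_surjective _ c
  rw [hl2, matrixChar_apply, matrixPairing_mk]
  rfl

/-- By primitivity of `levelChar` the radical is the kernel of `b ↦ M b` modulo `𝔪^(L+1)`, so its
quotient is the image of `M`. -/
theorem charDim_matrixChar {L : ℕ} (M : Matrix (Fin n) (Fin n) (LevelRing 𝔬 (L + 1)))
    (hM : M.trace = 0) : charDim (matrixChar 𝔬 n M hM) = imCard M := by
  let f : (Fin n → 𝔬) →+ (Fin n → LevelRing 𝔬 (L + 1)) :=
    M.mulVecLin.toAddMonoidHom.comp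
      (AddMonoidHom.compLeft (Ideal.Quotient.mk (maximalIdeal 𝔬 ^ (L + 1))).toAddMonoidHom (Fin n))
  have hf : ∀ b i, f b i = ∑ j, b j • M i j := fun b i => by
    change ∑ j, M i j * _ = _
    refine Finset.sum_congr rfl fun j _ => ?_
    rw [mul_comm]
    rfl
  have hker : f.ker = charRad (matrixChar 𝔬 n M hM) := by
    ext b
    have h1 : ∀ a, matrixChar 𝔬 n M hM (kPair a b) = levelChar 𝔬 L (∑ i, a i • f b i) := by
      intro a
      rw [matrixChar_apply, kPair, matrixPairing_mk]
      simp only [Matrix.vecMulVec_apply, hf, Finset.smul_sum, mul_smul]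
    rw [AddMonoidHom.mem_ker, mem_charRad]
    constructor
    · intro h a
      rw [h1, h]
      simp
    · intro h
      ext i
      refine eq_zero_of_levelChar_smul 𝔬 fun x => ?_
      have := h (Pi.single i x)
      rw [h1, Finset.sum_eq_single i] at this
      · simpa using this
      · intro k _ hk; simp [hk]
      · simp
  rw [charDim, ← hker, Nat.card_congr (QuotientAddGroup.quotientKerEquivRange f).toEquiv, imCard]
  refine Nat.card_congr (Equiv.subtypeEquivRight fun w => ?_)
  constructor
  · rintro ⟨b, rfl⟩
    exact ⟨_, rfl⟩
  · rintro ⟨c, rfl⟩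
    refine ⟨fun i => (c i).out, ?_⟩
    change M.mulVecLin _ = _
    congr 1
    ext i
    exact Ideal.Quotient.mk_out (c i)

theorem charDim_one {R : Type} [CommRing R] : charDim (1 : AddChar (KCentre n R) ℂ) = 1 := by
  have : charRad (1 : AddChar (KCentre n R) ℂ) = ⊤ := by
    ext b
    simp [mem_charRad]
  rw [charDim, this]
  exact Nat.card_eq_one_iff_unique.2 ⟨QuotientAddGroup.subsingleton_quotient_top, ⟨0⟩⟩

end LevelDuality
end

/-! ### Continuity of central characters -/

noncomputable section

section ContinuousCharacters

open IsLocalRing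

/-- No small subgroups: near `1`, squaring multiplies the distance to `1` by `‖z + 1‖ ≥ 3 / 2`, so
repeated doubling of `x` would leave the disc of radius `1 / 2`. -/
theorem AddChar.eq_one_of_norm_sub_one_lt {H : Type} [AddGroup H] (f : AddChar H ℂ)
    (S : AddSubgroup H) (h : ∀ x ∈ S, ‖f x - 1‖ < 1 / 2) {x : H} (hx : x ∈ S) : f x = 1 := by
  by_contra h1
  have hpos : 0 < ‖f x - 1‖ := norm_pos_iff.2 (sub_ne_zero.2 h1)
  have hgrow : ∀ j : ℕ, (3 / 2 : ℝ) ^ j * ‖f x - 1‖ ≤ ‖f ((2 ^ j : ℕ) • x) - 1‖ := by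
    intro j
    induction j with
    | zero => simp
    | succ j ih =>
      set z := f ((2 ^ j : ℕ) • x) with hz
      have hz1 : f ((2 ^ (j + 1) : ℕ) • x) - 1 = (z - 1) * (z + 1) := by
        rw [pow_succ, mul_nsmul, two_nsmul, AddChar.map_add_eq_mul, hz]
        ring
      have hz2 : 3 / 2 ≤ ‖z + 1‖ := by
        have h2 := norm_sub_norm_le (2 : ℂ) (-(z - 1))
        rw [norm_neg, show (2 : ℂ) - -(z - 1) = z + 1 by ring, Complex.norm_ofNat] at h2
        have := h _ (S.nsmul_mem hx (2 ^ j))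
        linarith
      rw [hz1, norm_mul, pow_succ]
      nlinarith [norm_nonneg (z - 1)]
  obtain ⟨j, hj⟩ := pow_unbounded_of_one_lt (1 / ‖f x - 1‖) (by norm_num : (1 : ℝ) < 3 / 2)
  have h2 := (hgrow j).trans_lt (h _ (S.nsmul_mem hx (2 ^ j)))
  rw [div_lt_iff₀ hpos] at hj
  linarith

variable {n : ℕ} {𝔬 : Type} [CommRing 𝔬] [TopologicalSpace 𝔬] [IsTopologicalRing 𝔬]

variable [IsDomain 𝔬] [IsDiscreteValuationRing 𝔬]

theorem continuous_iff_trivialAtLevel (hadic : IsAdic (maximalIdeal 𝔬))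
    (l : AddChar (KCentre n 𝔬) ℂ) : Continuous l ↔ ∃ L, TrivialAtLevel l L := by
  rw [isAdic_iff] at hadic
  constructor
  · intro h
    have hij : ∀ i j, ∃ L, ∀ x ∈ maximalIdeal 𝔬 ^ L,
        l (Submodule.Quotient.mk (Matrix.single i j x)) = 1 := by
      intro i j
      let f : AddChar 𝔬 ℂ := l.compAddMonoidHom
        ((Submodule.mkQ (Submodule.span 𝔬 {(1 : Matrix (Fin n) (Fin n) 𝔬)})).toAddMonoidHom.comp
          (Matrix.singleAddMonoidHom i j))
      have hf : Continuous f := by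
        refine h.comp (continuous_quot_mk.comp (continuous_matrix fun k m => ?_))
        change Continuous fun x => Matrix.single i j x k m
        simp only [Matrix.single_apply]
        split_ifs
        exacts [continuous_id, continuous_const]
      have hnear : {x | ‖f x - 1‖ < 1 / 2} ∈ nhds (0 : 𝔬) :=
        (isOpen_lt (hf.sub continuous_const).norm continuous_const).mem_nhds (by simp)
      obtain ⟨L, hL⟩ := hadic.2 _ hnear
      exact ⟨L, fun x hx =>
        f.eq_one_of_norm_sub_one_lt (maximalIdeal 𝔬 ^ L).toAddSubgroup (fun y hy => hL hy) hx⟩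
    choose L hL using hij
    refine ⟨∑ i, ∑ j, L i j, fun X hX => ?_⟩
    rw [apply_mk_eq_prod]
    refine Finset.prod_eq_one fun i _ => Finset.prod_eq_one fun j _ => hL i j _ ?_
    refine Ideal.pow_le_pow_right ?_ (hX i j)
    exact (Finset.single_le_sum (f := fun j => L i j) (fun _ _ => Nat.zero_le _)
      (Finset.mem_univ j)).trans (Finset.single_le_sum (f := fun i => ∑ j, L i j)
        (fun _ _ => Nat.zero_le _) (Finset.mem_univ i))
  · rintro ⟨L, hL⟩
    refine isQuotientMap_quot_mk.continuous_iff.2 ?_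
    change Continuous fun X : Matrix (Fin n) (Fin n) 𝔬 => l (Submodule.Quotient.mk X)
    refine Continuous.congr ?_ fun X => (apply_mk_eq_prod l X).symm
    refine continuous_finsetProd _ fun i _ => continuous_finsetProd _ fun j _ => ?_
    have hc : Continuous fun x : 𝔬 => l (Submodule.Quotient.mk (Matrix.single i j x)) := by
      refine continuous_iff_continuousAt.2 fun x₀ => ?_
      refine ContinuousAt.congr (f := fun _ => l (Submodule.Quotient.mk (Matrix.single i j x₀)))
        continuousAt_const ?_
      have hopen : IsOpen {x : 𝔬 | x - x₀ ∈ maximalIdeal 𝔬 ^ L} :=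
        (hadic.1 L).preimage (continuous_id.sub continuous_const)
      filter_upwards [hopen.mem_nhds (by simp)] with x hx
      have h1 := hL (Matrix.single i j (x - x₀)) fun k m => by
        rw [Matrix.single_apply]
        split_ifs
        exacts [hx, zero_mem _]
      rw [← sub_add_cancel x x₀, Matrix.single_add, Submodule.Quotient.mk_add,
        AddChar.map_add_eq_mul, h1, one_mul]
    exact hc.comp (continuous_id.matrix_elem i j)

theorem isOpen_charRad (hadic : IsAdic (maximalIdeal 𝔬)) (l : AddChar (KCentre n 𝔬) ℂ)
    (hl : Continuous l) : IsOpen (charRad l : Set (Fin n → 𝔬)) := by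
  obtain ⟨L, hL⟩ := (continuous_iff_trivialAtLevel hadic l).1 hl
  have hopen : IsOpen (Set.pi Set.univ fun _ : Fin n => ((maximalIdeal 𝔬 ^ L : Ideal 𝔬) : Set 𝔬)) :=
    isOpen_set_pi Set.finite_univ fun _ _ => (isAdic_iff.1 hadic).1 L
  refine AddSubgroup.isOpen_of_mem_nhds (g := 0) _ (Filter.mem_of_superset
    (hopen.mem_nhds fun i _ => zero_mem _) fun b hb a => hL _ fun i j => ?_)
  rw [Matrix.vecMulVec_apply]
  exact Ideal.mul_mem_left _ _ (hb j trivial)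

theorem finite_quotient_charRad [CompactSpace 𝔬] (hadic : IsAdic (maximalIdeal 𝔬))
    (l : AddChar (KCentre n 𝔬) ℂ) (hl : Continuous l) : Finite ((Fin n → 𝔬) ⧸ charRad l) :=
  AddSubgroup.quotient_finite_of_isOpen _ (isOpen_charRad hadic l hl)

theorem finite_residueField [CompactSpace 𝔬] (hadic : IsAdic (maximalIdeal 𝔬)) :
    Finite (ResidueField 𝔬) := by
  have h := (isAdic_iff.1 hadic).1 1
  rw [pow_one] at h
  exact AddSubgroup.quotient_finite_of_isOpen (maximalIdeal 𝔬).toAddSubgroup h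

/-- Characters are sorted by the least level at which they are trivial: level `0` is the trivial
character, and least level `L + 1` means a primitive matrix modulo `𝔪^(L+1)`. -/
theorem exists_character_equiv [Finite (ResidueField 𝔬)] (hadic : IsAdic (maximalIdeal 𝔬)) :
    ∃ e : Option (PrimitiveMatrix 𝔬 n) ≃ {l : AddChar (KCentre n 𝔬) ℂ // Continuous l},
      charDim (e none).1 = 1 ∧ ∀ p, charDim (e (some p)).1 = imCard p.2.1 := by
  let f : Option (PrimitiveMatrix 𝔬 n) → {l : AddChar (KCentre n 𝔬) ℂ // Continuous l} := fun o =>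
    o.elim ⟨1, continuous_const⟩ fun p => ⟨matrixChar 𝔬 n p.2.1 p.2.2.1,
      (continuous_iff_trivialAtLevel hadic _).2 ⟨_, trivialAtLevel_matrixChar _ _⟩⟩
  have hone : TrivialAtLevel (1 : AddChar (KCentre n 𝔬) ℂ) 0 := fun _ _ => rfl
  have hprim : ∀ p : PrimitiveMatrix 𝔬 n, ¬ TrivialAtLevel (matrixChar 𝔬 n p.2.1 p.2.2.1) p.1 :=
    fun p h => p.2.2.2 ((trivialAtLevel_matrixChar_iff _ _).1 h)
  have hle : ∀ p p' : PrimitiveMatrix 𝔬 n,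
      matrixChar 𝔬 n p.2.1 p.2.2.1 = matrixChar 𝔬 n p'.2.1 p'.2.2.1 → p.1 ≤ p'.1 := by
    intro p p' h
    by_contra! hlt
    refine hprim p (h ▸ (trivialAtLevel_matrixChar p'.2.1 p'.2.2.1).mono hlt)
  have hf : Function.Bijective f := by
    constructor
    · intro o o' h
      have h0 : (f o).1 = (f o').1 := congrArg _ h
      match o, o' with
      | none, none => rfl
      | none, some p =>
        have h1 : 1 = matrixChar 𝔬 n p.2.1 p.2.2.1 := h0
        exact (hprim p (h1 ▸ hone.mono (Nat.zero_le _))).elim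
      | some p, none =>
        have h1 : matrixChar 𝔬 n p.2.1 p.2.2.1 = 1 := h0
        exact (hprim p (h1 ▸ hone.mono (Nat.zero_le _))).elim
      | some p, some p' =>
        have h1 : matrixChar 𝔬 n p.2.1 p.2.2.1 = matrixChar 𝔬 n p'.2.1 p'.2.2.1 := h0
        obtain ⟨L, M, hM⟩ := p
        obtain ⟨L', M', hM'⟩ := p'
        obtain rfl : L = L' := le_antisymm (hle _ _ h1) (hle _ _ h1.symm)
        obtain rfl : M = M' := matrixChar_injective h1
        rfl
    · rintro ⟨l, hl⟩
      have hex := (continuous_iff_trivialAtLevel hadic l).1 hl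
      classical
      rcases hL : Nat.find hex with _ | L
      · refine ⟨none, Subtype.ext ?_⟩
        have h0 := Nat.find_spec hex
        rw [hL] at h0
        ext c
        obtain ⟨X, rfl⟩ := Submodule.Quotient.mk_surjective _ c
        refine (h0 X fun i j => ?_).symm
        rw [pow_zero, Ideal.one_eq_top]
        trivial
      · have h0 := Nat.find_spec hex
        rw [hL] at h0
        obtain ⟨M, hM, rfl⟩ := exists_eq_matrixChar l h0
        refine ⟨some ⟨L, M, hM, fun h1 => ?_⟩, rfl⟩
        exact Nat.find_min hex (hL ▸ L.lt_succ_self) ((trivialAtLevel_matrixChar_iff M hM).2 h1)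
  exact ⟨Equiv.ofBijective f hf, charDim_one, fun p => charDim_matrixChar _ _⟩

end ContinuousCharacters
end

/-! ### The local zeta function -/

noncomputable section

section LocalZeta

open IsLocalRing

/-- The homomorphism `k ↦ k ^ (-s)`. -/
def powHom (s : ℂ) : ℕ →* ℂ where
  toFun k := (k : ℂ) ^ (-s)
  map_one' := by simp
  map_mul' a b := by rw [Nat.cast_mul, Complex.natCast_mul_natCast_cpow]

theorem powHom_apply (s : ℂ) (k : ℕ) : powHom s k = (k : ℂ) ^ (-s) := rfl

theorem norm_powHom (s : ℂ) {k : ℕ} (hk : 0 < k) : ‖powHom s k‖ = (k : ℝ) ^ (-s.re) := by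
  rw [powHom_apply, Complex.norm_natCast_cpow_of_pos hk, Complex.neg_re]

theorem powHom_ne_zero (s : ℂ) {k : ℕ} (hk : 0 < k) : powHom s k ≠ 0 := by
  rw [powHom_apply, Complex.cpow_ne_zero_iff]
  exact Or.inl (Nat.cast_ne_zero.2 hk.ne')

theorem norm_powHom_anti {s : ℂ} (hs : 0 ≤ s.re) (j k : ℕ) (hj : 0 < j) (hjk : j ≤ k) :
    ‖powHom s k‖ ≤ ‖powHom s j‖ := by
  rw [norm_powHom s hj, norm_powHom s (hj.trans_le hjk)]
  exact Real.rpow_le_rpow_of_nonpos (by exact_mod_cast hj) (by exact_mod_cast hjk)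
    (by linarith)

theorem norm_powHom_mul_lt {s : ℂ} {k d : ℕ} (hk : 1 < k) (hs : (d : ℝ) < s.re) :
    ‖powHom s k‖ * (k : ℝ) ^ d < 1 := by
  have hk0 : (0 : ℝ) < k := by exact_mod_cast zero_lt_one.trans hk
  rw [norm_powHom s (zero_lt_one.trans hk), ← Real.rpow_natCast, ← Real.rpow_add hk0]
  exact Real.rpow_lt_one_of_one_lt_of_neg (by exact_mod_cast hk) (by linarith)

/-- A Dirichlet series whose coefficients count the fibres of a positive function. -/
theorem lSeriesHasSum_of_fibres {P : Type} (D : P → ℕ) (hD : ∀ p, 0 < D p) {s w : ℂ}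
    (h : HasSum (fun p => powHom s (D p)) w) :
    (∀ m, Finite {p // D p = m}) ∧
      LSeriesHasSum (fun m => (Nat.card {p // D p = m} : ℂ)) s w := by
  have hfin : ∀ m, Finite {p // D p = m} := fun m => by
    rcases Nat.eq_zero_or_pos m with rfl | hm
    · have : IsEmpty {p // D p = 0} := ⟨fun p => (hD p.1).ne' p.2⟩
      infer_instance
    · by_contra hinf
      rw [not_finite_iff_infinite] at hinf
      have h1 : Summable fun p : {p // D p = m} => powHom s (D p.1) :=
        h.summable.comp_injective Subtype.val_injective
      have h2 : (fun p : {p // D p = m} => powHom s (D p.1)) = fun _ => powHom s m :=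
        funext fun p => by rw [p.2]
      rw [h2, summable_const_iff] at h1
      exact powHom_ne_zero s hm h1
  refine ⟨hfin, ?_⟩
  have h1 : HasSum (fun x : Σ m, {p // D p = m} => powHom s (D x.2.1)) w :=
    (Equiv.sigmaFiberEquiv D).hasSum_iff (f := fun p => powHom s (D p)) |>.2 h
  refine h1.sigma fun m => ?_
  have h2 : (fun p : {p // D p = m} => powHom s (D p.1)) = fun _ => powHom s m :=
    funext fun p => by rw [p.2]
  rw [h2]
  let _ := Fintype.ofFinite {p // D p = m}
  convert hasSum_fintype (fun _ : {p // D p = m} => powHom s m) using 1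
  rw [Finset.sum_const, Finset.card_univ, nsmul_eq_mul, LSeries.term_def, Nat.card_eq_fintype_card]
  split_ifs with hm
  · subst hm
    have : IsEmpty {p // D p = 0} := ⟨fun p => (hD p.1).ne' p.2⟩
    simp
  · rw [powHom_apply, Complex.cpow_neg, div_eq_mul_inv]

theorem isLocalRepZeta_genericDenom {n : ℕ} {f : MvPolynomial (Fin 2) ℚ}
    (hf : ∀ (x y w : ℂ) (G : ℕ → ℂ), IsLevelSum n x y G → IsZetaValue n x y G w →
      w * MvPolynomial.aeval ![x, y] (genericDenom n) = MvPolynomial.aeval ![x, y] f)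
    (𝔬 : Type) [CommRing 𝔬] [IsDomain 𝔬] [IsDiscreteValuationRing 𝔬] [TopologicalSpace 𝔬]
    [IsTopologicalRing 𝔬] [CompactSpace 𝔬] (hadic : IsAdic (maximalIdeal 𝔬)) :
    IsLocalRepZeta n f (genericDenom n) 𝔬 := by
  have hres := finite_residueField hadic
  obtain ⟨e, he0, he⟩ := exists_character_equiv (n := n) hadic
  have H : ∀ l : AddChar (KCentre n 𝔬) ℂ, Continuous l →
      IsOpen (charRad l : Set (Fin n → 𝔬)) ∧ Finite ((Fin n → 𝔬) ⧸ charRad l) := fun l hl =>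
    ⟨isOpen_charRad hadic l hl, finite_quotient_charRad hadic l hl⟩
  let D : Option (PrimitiveMatrix 𝔬 n) → ℕ := fun o => charDim (e o).1
  have hD : ∀ o, 0 < D o := fun o => by
    have := (H _ (e o).2).2
    exact Nat.card_pos
  have hfib : ∀ m, {o // D o = m} ≃ TwistIsoclass (KGroup n 𝔬) m := fun m =>
    (e.subtypeEquiv fun _ => Iff.rfl).trans (twistIsoclassEquiv H m)
  have hcount : repCount (KGroup n 𝔬) = fun m => (Nat.card {o // D o = m} : ℂ) := funext fun m => by
    rw [repCount, Nat.card_congr (hfib m)]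
  -- The bound `n ^ 2` comes from at most `q ^ (n ^ 2 * (L + 1))` matrices modulo `𝔪^(L+1)`, each of
  -- image size at least `q ^ (L + 1)`.
  have hsum : ∀ s : ℂ, ((n ^ 2 : ℕ) : ℝ) < s.re → HasSum (fun o => powHom s (D o))
      (1 + ∑' L, sumPrimitive (LevelRing 𝔬 (L + 1)) (powHom s) n) := fun s hs => by
    have hs0 : 0 ≤ s.re := (Nat.cast_nonneg _).trans hs.le
    have h1 := hasSum_primitiveMatrix (φ := powHom s) 𝔬 n (summable_primitiveMatrix 𝔬 n
      (norm_powHom_anti hs0) (norm_powHom_mul_lt (one_lt_resCard 𝔬) hs))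
    have h2 := (hasSum_ite_eq (none : Option (PrimitiveMatrix 𝔬 n)) (1 : ℂ)).add
      ((hasSum_extend_zero (Option.some_injective _)).2 h1)
    refine h2.congr_fun ?_
    rintro (_ | p)
    · rw [if_pos rfl, Function.extend_apply' _ _ _ (by simp), Pi.zero_apply, add_zero]
      change powHom s (charDim (e none).1) = 1
      rw [he0, map_one]
    · rw [if_neg (by simp), (Option.some_injective _).extend_apply, zero_add]
      exact congrArg (powHom s) (he p)
  constructor
  · intro m
    have := (lSeriesHasSum_of_fibres D hD (hsum (((n ^ 2 : ℕ) : ℂ) + 1) (by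
      rw [Complex.add_re, Complex.natCast_re, Complex.one_re]; linarith))).1 m
    exact Finite.of_equiv _ (hfib m)
  · refine ⟨((n ^ 2 : ℕ) : ℝ), fun s hs => ?_⟩
    have hs0 : 0 ≤ s.re := (Nat.cast_nonneg _).trans hs.le
    have hy := (norm_powHom_mul_lt (one_lt_resCard 𝔬) hs).le
    have hφ : ∀ k ≠ 0, ‖powHom s k‖ ≤ 1 := fun k hk => by
      simpa using norm_powHom_anti hs0 1 k one_pos (Nat.one_le_iff_ne_zero.2 hk)
    have hne : MvPolynomial.aeval ![(resCard 𝔬 : ℂ), powHom s (resCard 𝔬)]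
        (genericDenom n) ≠ 0 := by
      rw [aeval_genericDenom]
      have hq := one_lt_resCard 𝔬
      refine mul_ne_zero (Nat.cast_ne_zero.2 (by omega))
        (Finset.prod_ne_zero_iff.2 fun m hm h => ?_)
      have h1 := norm_levelRatio_lt 𝔬 n hy m (Finset.mem_range.1 hm)
      rw [← sub_eq_zero.1 h, norm_one, one_mul] at h1
      exact h1.not_ge (one_le_pow₀ (by exact_mod_cast hq.le))
    refine ⟨hne, ?_⟩
    have h1 := hf _ _ _ _ (isLevelSum_levelSeries 𝔬 n hφ hy) (isZetaValue_levelSeries 𝔬 n hφ hy)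
    have h2 := (lSeriesHasSum_of_fibres D hD (hsum s hs)).2
    rw [hcount]
    rw [eq_div_of_mul_eq hne h1] at h2
    exact h2

end LocalZeta
end

/-! ### The `p`-adic integers as test rings -/

noncomputable section

section PadicPlaces

open IsLocalRing

variable (p : ℕ) [Fact p.Prime]

theorem PadicInt.isAdic_maximalIdeal : IsAdic (maximalIdeal ℤ_[p]) := by
  have hp : (1 : ℝ) < p := by exact_mod_cast (Fact.out : p.Prime).one_lt
  have hball : ∀ k : ℕ, ((maximalIdeal ℤ_[p] ^ k : Ideal ℤ_[p]) : Set ℤ_[p]) =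
      Metric.closedBall 0 ((p : ℝ) ^ (-k : ℤ)) := fun k => by
    ext x
    rw [SetLike.mem_coe, PadicInt.maximalIdeal_eq_span_p, Ideal.span_singleton_pow,
      ← PadicInt.norm_le_pow_iff_mem_span_pow, mem_closedBall_zero_iff]
  rw [isAdic_iff]
  refine ⟨fun k => ?_, fun s hs => ?_⟩
  · rw [hball]
    exact IsUltrametricDist.isOpen_closedBall _ (by positivity)
  · obtain ⟨ε, hε, hs⟩ := Metric.mem_nhds_iff.1 hs
    obtain ⟨k, hk⟩ := exists_pow_lt_of_lt_one hε (inv_lt_one_of_one_lt₀ hp)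
    refine ⟨k, fun x hx => hs ?_⟩
    rw [hball, mem_closedBall_zero_iff, zpow_neg, zpow_natCast, ← inv_pow] at hx
    exact mem_ball_zero_iff.2 (hx.trans_lt hk)

theorem PadicInt.card_residueField : Nat.card (ResidueField ℤ_[p]) = p := by
  rw [Nat.card_congr PadicInt.residueField.toEquiv, Nat.card_zmod]

theorem PadicInt.ringChar_residueField : ringChar (ResidueField ℤ_[p]) = p := by
  have : CharP (ResidueField ℤ_[p]) p := charP_of_injective_ringHom
    (f := (PadicInt.residueField (p := p)).symm.toRingHom) (RingEquiv.injective _) p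
  exact ringChar.eq_iff.2 this

end PadicPlaces

/-! ### Independence of the choice of rational function -/

section Uniqueness

open IsLocalRing MvPolynomial

/-- A polynomial that vanishes at the points `(p, p ^ (-s))`, for infinitely many natural numbers
`p` and for all `s` far to the right, is zero. -/
theorem eq_zero_of_aeval_natCast_cpow {h : MvPolynomial (Fin 2) ℚ} {T : Set ℕ} (hT : T.Infinite)
    (hT1 : ∀ p ∈ T, 1 < p)
    (H : ∀ p ∈ T, ∃ α : ℝ, ∀ s : ℂ, α < s.re → aeval ![(p : ℂ), (p : ℂ) ^ (-s)] h = 0) : h = 0 := by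
  have hfib : ∀ p ∈ T, ∀ y : ℂ, aeval ![(p : ℂ), y] h = 0 := by
    intro p hp y
    obtain ⟨α, hα⟩ := H p hp
    have hp1 : (1 : ℝ) < p := by exact_mod_cast hT1 p hp
    let P : Polynomial ℂ := aeval ![Polynomial.C (p : ℂ), Polynomial.X] h
    have hP : ∀ z : ℂ, P.eval z = aeval ![(p : ℂ), z] h := fun z => by
      have := MvPolynomial.comp_aeval_apply (R := ℚ) (![Polynomial.C (p : ℂ), Polynomial.X])
        ((Polynomial.aeval (R := ℂ) z).restrictScalars ℚ) h
      refine (show P.eval z = (Polynomial.aeval (R := ℂ) z).restrictScalars ℚ P from ?_).trans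
        (this.trans (congrArg (fun v => aeval v h) ?_))
      · simp
      · ext i
        fin_cases i <;> simp
    -- For fixed `p`, the integers `s` beyond `α` already give infinitely many zeros `p ^ (-s)`.
    have hP0 : P = 0 := by
      refine Polynomial.eq_zero_of_infinite_isRoot P (Set.Infinite.mono ?_
        (Set.infinite_range_of_injective (f := fun k : ℕ =>
          (p : ℂ) ^ (-(((⌈|α|⌉₊ + 1 + k : ℕ) : ℂ)))) fun k m hkm => ?_))
      · rintro _ ⟨k, rfl⟩
        rw [Set.mem_ofPred_eq, Polynomial.IsRoot, hP]
        refine hα _ ?_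
        rw [Complex.natCast_re]
        push_cast
        have := (le_abs_self α).trans (Nat.le_ceil |α|)
        have := Nat.cast_nonneg (α := ℝ) k
        linarith
      · have h1 : (p : ℂ) ^ (⌈|α|⌉₊ + 1 + k) = (p : ℂ) ^ (⌈|α|⌉₊ + 1 + m) := by
          simpa only [Complex.cpow_neg, Complex.cpow_natCast, inv_inj] using hkm
        have h2 := Nat.pow_right_injective (hT1 p hp) (by exact_mod_cast h1 :
          p ^ (⌈|α|⌉₊ + 1 + k) = p ^ (⌈|α|⌉₊ + 1 + m))
        omega
    rw [← hP, hP0, Polynomial.eval_zero]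
  have hmap : MvPolynomial.map (algebraMap ℚ ℂ) h = 0 := by
    refine MvPolynomial.funext_set (![(fun k : ℕ => (k : ℂ)) '' T, Set.univ]) ?_ ?_
    · intro i
      fin_cases i
      · exact hT.image Nat.cast_injective.injOn
      · exact Set.infinite_univ
    · intro x hx
      obtain ⟨p, hp, hpx⟩ := hx 0 trivial
      have h1 := hfib p hp (x 1)
      rw [map_zero, eval_map, ← aeval_def, ← h1]
      congr 2
      ext i
      fin_cases i
      · exact hpx.symm
      · rfl
  exact MvPolynomial.map_injective _ (algebraMap ℚ ℂ).injective (by rw [hmap, map_zero])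

/-- The rings `ℤ_[p]`, for primes outside both exceptional sets, give enough points: there both
quotients are the sum of the same Dirichlet series. -/
theorem mul_eq_mul_of_isGenericLocalRepZeta {n : ℕ} {f g f' g' : MvPolynomial (Fin 2) ℚ}
    (h : IsGenericLocalRepZeta n f g) (h' : IsGenericLocalRepZeta n f' g') : f * g' = f' * g := by
  obtain ⟨S, hS⟩ := h
  obtain ⟨S', hS'⟩ := h'
  have hinf : ({p : ℕ | p.Prime} \ (S ∪ S' : Finset ℕ)).Infinite :=
    Nat.infinite_setOfPred_prime.sdiff (Finset.finite_toSet _)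
  refine sub_eq_zero.1 (eq_zero_of_aeval_natCast_cpow hinf (fun p hp => hp.1.one_lt) fun p hp => ?_)
  have hpp : Fact p.Prime := ⟨hp.1⟩
  have hpS : p ∉ S ∧ p ∉ S' := by simpa using hp.2
  have hadic := PadicInt.isAdic_maximalIdeal p
  obtain ⟨-, α, hα⟩ := hS ℤ_[p] hadic (by rw [PadicInt.ringChar_residueField]; exact hpS.1)
  obtain ⟨-, α', hα'⟩ := hS' ℤ_[p] hadic (by rw [PadicInt.ringChar_residueField]; exact hpS.2)
  rw [PadicInt.card_residueField] at hα hα'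
  refine ⟨max α α', fun s hs => ?_⟩
  obtain ⟨h1, h2⟩ := hα s ((le_max_left _ _).trans_lt hs)
  obtain ⟨h1', h2'⟩ := hα' s ((le_max_right _ _).trans_lt hs)
  have h3 := HasSum.unique h2 h2'
  rw [div_eq_div_iff h1 h1'] at h3
  rw [map_sub, map_mul, map_mul, h3, sub_self]

theorem qExpansion_eq_of_mul_eq_mul {f g f' g' : MvPolynomial (Fin 2) ℚ} (hg : g ≠ 0)
    (hg' : g' ≠ 0) (h : f * g' = f' * g) : qExpansion f g = qExpansion f' g' := by
  rw [qExpansion, qExpansion, div_eq_div_iff (coe_polyExpansion_ne_zero hg)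
    (coe_polyExpansion_ne_zero hg')]
  have h1 : polyExpansion f * polyExpansion g' = polyExpansion f' * polyExpansion g := by
    rw [polyExpansion, polyExpansion, polyExpansion, polyExpansion, ← map_mul, ← map_mul, h]
  rw [← PowerSeries.coe_mul, ← PowerSeries.coe_mul, h1]

end Uniqueness
end

theorem mainTheorem5 (n : ℕ) (hn : 1 ≤ n) (Z : RatFunc ℚ) :
    IsTopologicalRepZeta n Z ↔
      Z = ∏ i ∈ Finset.range n,
        (RatFunc.X - RatFunc.C (i : ℚ)) /
          (RatFunc.X - RatFunc.C ((n : ℚ) + (i : ℚ) - 1 / ((n : ℚ) - (i : ℚ)))) := by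
  obtain ⟨f, hf, hord, hlead⟩ := exists_genericZeta n hn
  have hgen : IsGenericLocalRepZeta n f (genericDenom n) :=
    -- No residue characteristic needs to be excluded, since the classification of representations
    -- never divides by `2`.
    ⟨∅, fun 𝔬 _ _ _ _ _ _ _ hadic _ => isLocalRepZeta_genericDenom hf 𝔬 hadic⟩
  change _ ↔ Z = topZeta n
  constructor
  · rintro ⟨f', g', hg', hgen', -, rfl⟩
    rw [← hlead, qExpansion_eq_of_mul_eq_mul hg' (genericDenom_ne_zero n)
      (mul_eq_mul_of_isGenericLocalRepZeta hgen' hgen)]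
  · rintro rfl
    exact ⟨f, genericDenom n, genericDenom_ne_zero n, hgen, hord, hlead⟩
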